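/- For $N\ge 2$ and $1\le n<N$ let $\mathbf X=(\xi_{jk}X_{jk})_{1\le j\le N,\,1\le k\le n}$, where the $X_{jk}$ are i.i.d. real random variables with $\mathbf E X_{jk}=0$, $\mathbf E X_{jk}^2=1$ (their common distribution may depend on $N$), and the $\xi_{jk}$ are independent Bernoulli variables with $\mathbf P\{\xi_{jk}=1\}=p=p_N$, independent of the $X_{jk}$. Let $s_1\ge\dots\ge s_n$ be the singular values of $\mathbf X$. Let $\delta>0$, $\varkappa=\frac{\delta}{2(4+\delta)}$, let $\mu_{4+\delta}, B, C_0, c>0$ and $y_0\in(0,1)$ be constants, and let $n=n(N)$ with $n(N)/N\to y_0$ as $N\to\infty$. Assume that $$\mathbf E|X_{11}|^{4+\delta}\le \mu_{4+\delta},\qquad Np\ge B(\log N)^{\frac{3}{2\varkappa}},$$ and that for every real $q$ with $4+\delta\le q\le c\log n$ $$\mathbf E|X_{11}|^q\le C_0^q\,q^q\,(Np)^{q(\frac12-\varkappa)-2}.$$ (i) For every $Q\ge 1$ there exist a constant $K>0$ depending only on $Q,\delta,\mu_{4+\delta}$, and a constant $C>0$ depending only on $Q,\delta,\mu_{4+\delta},B,C_0,c,y_0$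 and the sequence $n(\cdot)$, such that for every $N$ with $1\le n(N)<N$ $$\mathbf P\{s_1\ge K\sqrt{Np}\}\le CN^{-Q}.$$ (ii) There exists a constant $\tau_0>0$, depending only on $\delta,\mu_{4+\delta},B,C_0,c,y_0$ (and not on $Q$), such that for every $Q\ge1$ there is a constant $C>0$, depending only on $Q,\delta,\mu_{4+\delta},B,C_0,c,y_0$ and the sequence $n(\cdot)$, such that for every $\tau\le\tau_0$ and every $N$ with $1\le n(N)<N$ $$\mathbf P\{s_n\le\tau\sqrt{Np}\}\le CN^{-Q}.$$ -/

import Mathlib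

open Filter Topology MeasureTheory ProbabilityTheory

/-- The exponent `ϰ = δ / (2 (4 + δ))`. -/
noncomputable def varkappa (δ : ℝ) : ℝ := δ / (2 * (4 + δ))

/-- The random families behind a sparse `N × n` matrix: the `X j k` are i.i.d. real random variables
with mean zero and variance one, the `ξ j k` are Bernoulli variables with success probability `p`,
and all the variables `ξ j k`, `X j k` together are mutually independent. -/
structure IsSparseModel {Ω : Type*} [MeasurableSpace Ω] (P : Measure Ω) {N n : ℕ} (p : ℝ)
    (ξ X : Fin N → Fin n → Ω → ℝ) : Prop where
  measurable_mask : ∀ j k, Measurable (ξ j k)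
  measurable_entry : ∀ j k, Measurable (X j k)
  indep : iIndepFun (fun i : (Fin N × Fin n) ⊕ (Fin N × Fin n) =>
    Sum.elim (fun a => ξ a.1 a.2) (fun a => X a.1 a.2) i) P
  mask_zero_or_one : ∀ j k, ∀ᵐ ω ∂P, ξ j k ω = 0 ∨ ξ j k ω = 1
  mask_prob : ∀ j k, P.real {ω | ξ j k ω = 1} = p
  identDistrib : ∀ j k j' k', IdentDistrib (X j k) (X j' k') P P
  integrable : ∀ j k, Integrable (X j k) P
  mean_zero : ∀ j k, ∫ ω, X j k ω ∂P = 0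
  variance_one : ∀ j k, ∫ ω, X j k ω ^ 2 ∂P = 1

/-- The standing assumptions for one value of `N`: the sparse model, `E|X|^(4+δ) ≤ μ`,
`N p ≥ B (log N)^(3/(2ϰ))`, and
`E|X|^q ≤ C₀^q q^q (N p)^(q(1/2 - ϰ) - 2)` for all real `4 + δ ≤ q ≤ c log n`. -/
structure SparseAssumptions {Ω : Type*} [MeasurableSpace Ω] (P : Measure Ω) {N n : ℕ}
    (δ μ B C₀ c p : ℝ) (ξ X : Fin N → Fin n → Ω → ℝ) : Prop extends IsSparseModel P p ξ X where
  moment_delta : ∀ j k,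
    ∫⁻ ω, ENNReal.ofReal (|X j k ω| ^ (4 + δ)) ∂P ≤ ENNReal.ofReal μ
  sparsity : B * Real.log N ^ (3 / (2 * varkappa δ)) ≤ N * p
  moment_q : ∀ q : ℝ, 4 + δ ≤ q → q ≤ c * Real.log n → ∀ j k,
    ∫⁻ ω, ENNReal.ofReal (|X j k ω| ^ q) ∂P ≤
      ENNReal.ofReal (C₀ ^ q * q ^ q * (N * p) ^ (q * (1 / 2 - varkappa δ) - 2))

/-- The sparse random matrix `(ξ_{jk} X_{jk})`. -/
def sparseMatrix {Ω : Type*} {N n : ℕ} (ξ X : Fin N → Fin n → Ω → ℝ) (ω : Ω) :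
    Matrix (Fin N) (Fin n) ℝ :=
  Matrix.of fun j k => ξ j k ω * X j k ω

/-- The `i`-th singular value of a real `N × n` matrix, in decreasing order and counted from `1`
(meant for `1 ≤ i ≤ n`). -/
noncomputable def singVal {N n : ℕ} (A : Matrix (Fin N) (Fin n) ℝ) (i : ℕ) : ℝ :=
  (Matrix.toEuclideanLin A).singularValues (i - 1)

/-! Write `D = N p` and `ℓ = log N`. The sparsity hypothesis is used in two forms: `D ≥ B ℓ ^ 3`,
and `D ^ (-ϰ) = O(ℓ ^ (-3/2))`.

Largest singular value. Divide the entries by `√D`, truncate at a small constant `L`, and centre.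
The high moment hypothesis at order proportional to `ℓ` makes an entry above `L` superpolynomially
unlikely, and the centring perturbs the operator norm by at most one. For the truncated matrix the
trace method is run with `k` of order `ℓ`. Walks are not enumerated. The expected weight of a closed
walk depends only on the coincidence pattern of its edges, and a walk has at most one more vertex
than it has edges. Hence the trace moment is bounded by that of a `2k × 2k` matrix with i.i.d.
entries whose moments dominate (`abs_integral_walk_le`, `sum_ker_le_sum_ker`). The model entry is a
skewed two-point variable plus a rare jump of size `√k`. It is subgaussian in the range `|t| ≤ √k`,
which is all that a net argument for the `2k × 2k` matrix needs (`model_mgf_le`,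
`sum_classProd_walk_le`). The domination of moments is `moment_truncAt_le`. Markov's inequality then
gives norm at most `1001 √D` (`eventually_opNorm_le`).

Smallest singular value. Normalize the entries to variance one, so that the Gram matrix is a sum of
`N` independent rank-one matrices `r rᵀ` and the target is a least eigenvalue of order `N`. The rows
are used in two stages.

In the first stage a fixed proportion of the rows is used, so few that they still outnumber `n` by a
constant factor. The trace of the resolvent at `-κ |s|` is close to a solution `φ κ` of `κ φ + φ /
(1 + φ) = y`. As `y < 1`, this solution is analytic at `κ = 0`. A finite-difference combination of
resolvents at nearby points is a positive test function bounded below on small eigenvalues, while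
the same combination of an analytic `φ` is tiny. With McDiarmid's inequality this leaves at most `η
N / ℓ` eigenvalues below `κ |s|` (`exists_lowSet`).

In the second stage the remaining rows are added one by one to a matrix `S₀` equal to `L` on those
few bad directions and to a much larger number elsewhere, where now `L` is of order `N`. The
potential `tr S⁻ᵐ`, with `m` of order `ℓ`, decays as if each row raised the least eigenvalue by
`1/6`, provided that `m · tr S₀⁻¹` is small (`IsUnitRow.integral_trace_update_le`,
`integral_trace_inv_pow_le`). This condition is the reason for the first stage: with a multiple of
the identity as `S₀` the trace would be of order one, whereas `O(N / ℓ)` bad directions make it `O(1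
/ ℓ)`. Markov's inequality for the potential gives a polynomially small probability. The upper bound
from the first half serves to glue good and bad directions together (`exists_unit_form_le_of_split`,
`measureReal_split_le`). -/

open scoped Matrix

universe u

/-! ### Closed bipartite walks and their coincidence patterns -/

section Combinatorics

/-- The diagonal sum of a matrix power is a sum over closed walks. -/
theorem pow_succ_apply_eq_sum {n : Type*} [Fintype n] [DecidableEq n] (M : Matrix n n ℝ) (K : ℕ)
    (a b : n) :
    (M ^ (K + 1)) a b = ∑ j : Fin (K + 1) → n, (if j 0 = a then 1 else 0) *
      (∏ t : Fin K, M (j t.castSucc) (j t.succ)) * M (j (Fin.last K)) b := by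
  induction K generalizing a b with
  | zero =>
    rw [← (Equiv.funUnique (Fin 1) n).symm.sum_comp]
    simp
  | succ K ih =>
    rw [pow_succ', Matrix.mul_apply]
    simp_rw [ih]
    rw [← (Fin.consEquiv (fun _ : Fin (K + 2) => n)).sum_comp, Fintype.sum_prod_type]
    have : ∀ x : n, ∀ y : Fin (K + 1) → n,
        (if (Fin.consEquiv (fun _ : Fin (K + 2) => n)) (x, y) 0 = a then (1 : ℝ) else 0) *
        (∏ t : Fin (K + 1), M ((Fin.consEquiv (fun _ : Fin (K + 2) => n)) (x, y) t.castSucc)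
          ((Fin.consEquiv (fun _ : Fin (K + 2) => n)) (x, y) t.succ)) *
          M ((Fin.consEquiv (fun _ : Fin (K + 2) => n)) (x, y) (Fin.last (K + 1))) b
        = (if x = a then (1 : ℝ) else 0) * (M x (y 0) *
          ((∏ t : Fin K, M (y t.castSucc) (y t.succ)) * M (y (Fin.last K)) b)) := by
      intro x y
      rw [Fin.prod_univ_succ]
      simp only [Fin.consEquiv_apply, Fin.cons_zero, Fin.castSucc_zero, Fin.cons_succ,
        ← Fin.succ_castSucc, ← Fin.succ_last]
      ring
    simp_rw [this]
    rw [Finset.sum_comm]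
    simp only [ite_mul, one_mul, zero_mul, Finset.sum_ite_eq', Finset.mem_univ, if_true,
      Finset.mul_sum]
    rw [Finset.sum_comm]
    refine Finset.sum_congr rfl fun y _ => ?_
    simp

theorem trace_pow_eq_sum_closed_walks {n : Type*} [Fintype n] [DecidableEq n]
    (M : Matrix n n ℝ) (K : ℕ) :
    (M ^ (K + 1)).trace = ∑ j : Fin (K + 1) → n, ∏ t, M (j t) (j (t + 1)) := by
  rw [Matrix.trace]
  simp_rw [Matrix.diag_apply, pow_succ_apply_eq_sum]
  rw [Finset.sum_comm]
  refine Finset.sum_congr rfl fun j _ => ?_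
  rw [Fin.prod_univ_castSucc]
  simp [ite_mul]

/-- The edge sequence of the closed bipartite walk `j 0, i 0, j 1, i 1, …`. -/
def walkEdge {α β : Type*} {k : ℕ} [NeZero k] (i : Fin k → α) (j : Fin k → β) :
    Fin k ⊕ Fin k → α × β :=
  Sum.elim (fun t => (i t, j t)) (fun t => (i t, j (t + 1)))

theorem trace_gram_pow_eq_sum {α β : Type*} [Fintype α] [Fintype β] [DecidableEq α]
    [DecidableEq β] (A : Matrix α β ℝ) (k : ℕ) [NeZero k] :
    ((Aᵀ * A) ^ k).trace = ∑ j : Fin k → β, ∑ i : Fin k → α,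
      ∏ t, A (walkEdge i j t).1 (walkEdge i j t).2 := by
  obtain ⟨K, rfl⟩ : ∃ K, k = K + 1 := ⟨k - 1, by have := NeZero.pos k; omega⟩
  rw [trace_pow_eq_sum_closed_walks]
  refine Finset.sum_congr rfl fun j _ => ?_
  simp_rw [Matrix.mul_apply, Matrix.transpose_apply]
  rw [Finset.prod_univ_sum]
  simp only [Fintype.piFinset_univ]
  refine Finset.sum_congr rfl fun i _ => ?_
  simp [walkEdge, Finset.prod_mul_distrib]

/-- Product over the classes of a partition of a function of the class size. -/
noncomputable def classProd {τ : Type*} [Fintype τ] (z : ℕ → ℝ) (s : Setoid τ) : ℝ := by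
  classical
  exact ∏ q : Quotient s, z (Finset.card {t : τ | (⟦t⟧ : Quotient s) = q})

/-- The condition `z 0 = 1` makes unvisited edges contribute nothing, so the weight of a walk is a
function of the partition of its time set alone. This is what allows the vertex set to be exchanged
for another one. -/
theorem prod_fiber_card_eq_classProd {τ α : Type*} [Fintype τ] [Fintype α] [DecidableEq α]
    (z : ℕ → ℝ) (hz : z 0 = 1) (e : τ → α) :
    ∏ a, z (Finset.card {t : τ | e t = a}) = classProd z (Setoid.ker e) := by
  classical
  unfold classProd
  have hinj : Function.Injective (Setoid.kerLift e) := Setoid.kerLift_injective e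
  rw [← Finset.prod_subset (Finset.subset_univ (Finset.univ.image (Setoid.kerLift e)))]
  · rw [Finset.prod_image (fun a _ b _ h => hinj h)]
    refine Finset.prod_congr (by ext; simp) fun q _ => ?_
    congr 2
    ext t
    simp only [Finset.mem_filter, Finset.mem_univ, true_and]
    rw [← hinj.eq_iff]
    rfl
  · intro a _ ha
    have : (Finset.univ.filter fun t => e t = a) = ∅ := by
      refine Finset.filter_eq_empty_iff.2 fun t _ h => ha ?_
      exact Finset.mem_image.2 ⟨⟦t⟧, Finset.mem_univ _, h⟩
    rw [this]; simpa using hz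

theorem classProd_nonneg {τ : Type*} [Fintype τ] {z : ℕ → ℝ} (hz : ∀ m, 0 ≤ z m) (s : Setoid τ) :
    0 ≤ classProd z s := Finset.prod_nonneg fun _ _ => hz _

theorem card_image_eq_card_quotient_ker {τ α : Type*} [Fintype τ] [DecidableEq α] (e : τ → α) :
    (Finset.univ.image e).card = Nat.card (Quotient (Setoid.ker e)) := by
  classical
  have hinj : Function.Injective (Setoid.kerLift e) := Setoid.kerLift_injective e
  rw [Nat.card_eq_fintype_card, ← Finset.card_univ, ← Finset.card_image_of_injective _ hinj]
  congr 1
  ext a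
  simp only [Finset.mem_image, Finset.mem_univ, true_and]
  constructor
  · rintro ⟨t, rfl⟩; exact ⟨⟦t⟧, rfl⟩
  · rintro ⟨q, rfl⟩
    induction q using Quotient.inductionOn with
    | h t => exact ⟨t, rfl⟩

/-- Such functions are the embeddings of the quotient. -/
theorem card_filter_ker_eq {τ α : Type*} [Fintype τ] [Fintype α] [DecidableEq τ]
    [DecidableEq (Setoid τ)] (s : Setoid τ) :
    (Finset.univ.filter fun f : τ → α => Setoid.ker f = s).card =
      (Fintype.card α).descFactorial (Nat.card (Quotient s)) := by
  classical
  rw [Nat.card_eq_fintype_card, ← Fintype.card_embedding_eq, ← Fintype.card_subtype]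
  refine Fintype.card_congr ⟨fun f => ⟨Quotient.lift f.1 (fun a b h => ?_), ?_⟩,
    fun g => ⟨fun t => g ⟦t⟧, ?_⟩, ?_, ?_⟩
  · have : Setoid.ker f.1 a b := by rw [f.2]; exact h
    exact this
  · intro q r
    induction q using Quotient.inductionOn with
    | h a =>
      induction r using Quotient.inductionOn with
      | h b =>
        intro h
        refine Quotient.sound ?_
        have : Setoid.ker f.1 a b := h
        rw [f.2] at this; exact this
  · ext a b
    rw [Setoid.ker_def]
    exact ⟨fun h => Quotient.exact (g.injective h), fun h => congrArg g (Quotient.sound h)⟩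
  · intro f; rfl
  · intro g
    ext q
    induction q using Quotient.inductionOn with
    | h a => rfl

/-- Sums over functions of a quantity that depends on the kernel only, compared across codomains. -/
theorem sum_ker_le_sum_ker {k N : ℕ} (hN : 0 < N) {α : Type*} [Fintype α] [DecidableEq α]
    (hα : Fintype.card α ≤ N) (G : Setoid (Fin k) → ℝ) (hG : ∀ s, 0 ≤ G s) :
    ∑ i : Fin k → α, ((k : ℝ) / N) ^ (Finset.univ.image i).card * G (Setoid.ker i) ≤
      ∑ i : Fin k → Fin (2 * k), G (Setoid.ker i) := by
  classical
  have : Finite (Setoid (Fin k)) :=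
    Finite.of_injective (fun (s : Setoid (Fin k)) (a b : Fin k) => s a b) fun s t h =>
      Setoid.ext fun a b => by rw [show s a b = t a b from congrFun (congrFun h a) b]
  have : Fintype (Setoid (Fin k)) := Fintype.ofFinite _
  rw [← Finset.sum_fiberwise_of_maps_to (s := Finset.univ) (t := Finset.univ)
    (g := fun i : Fin k → α => Setoid.ker i) (fun _ _ => Finset.mem_univ _),
    ← Finset.sum_fiberwise_of_maps_to (s := Finset.univ) (t := Finset.univ)
    (g := fun i : Fin k → Fin (2 * k) => Setoid.ker i) (fun _ _ => Finset.mem_univ _)]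
  refine Finset.sum_le_sum fun s _ => ?_
  have h1 : ∑ i : Fin k → α with Setoid.ker i = s,
      ((k : ℝ) / N) ^ (Finset.univ.image i).card * G (Setoid.ker i) =
      ((Fintype.card α).descFactorial (Nat.card (Quotient s)) : ℝ) *
        (((k : ℝ) / N) ^ (Nat.card (Quotient s)) * G s) := by
    rw [← card_filter_ker_eq (α := α) s, ← nsmul_eq_mul, ← Finset.sum_const]
    refine Finset.sum_congr rfl fun i hi => ?_
    rw [card_image_eq_card_quotient_ker, (Finset.mem_filter.1 hi).2]
  have h2 : ∑ i : Fin k → Fin (2 * k) with Setoid.ker i = s, G (Setoid.ker i) =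
      ((2 * k).descFactorial (Nat.card (Quotient s)) : ℝ) * G s := by
    have h := card_filter_ker_eq (α := Fin (2 * k)) s
    rw [Fintype.card_fin] at h
    rw [← h, ← nsmul_eq_mul, ← Finset.sum_const]
    refine Finset.sum_congr rfl fun i hi => ?_
    rw [(Finset.mem_filter.1 hi).2]
  rw [h1, h2, ← mul_assoc]
  refine mul_le_mul_of_nonneg_right ?_ (hG s)
  set v := Nat.card (Quotient s)
  have hv : v ≤ k := by
    have := Nat.card_le_card_of_surjective _ (Quotient.mk_surjective (s := s))
    simpa [v] using this
  have h3 : ((Fintype.card α).descFactorial v : ℝ) ≤ (N : ℝ) ^ v := by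
    calc ((Fintype.card α).descFactorial v : ℝ) ≤ ((Fintype.card α) ^ v : ℕ) := by
          exact_mod_cast Nat.descFactorial_le_pow _ _
      _ ≤ (N : ℝ) ^ v := by push_cast; gcongr
  -- The size `2k` of the model is chosen here: since `v ≤ k`, every factor of the falling factorial
  -- exceeds `k`.
  have h4 : ((k : ℝ)) ^ v ≤ ((2 * k).descFactorial v : ℝ) := by
    have : k ^ v ≤ (2 * k).descFactorial v :=
      le_trans (Nat.pow_le_pow_left (by omega) v) (Nat.pow_sub_le_descFactorial (2 * k) v)
    exact_mod_cast this
  calc ((Fintype.card α).descFactorial v : ℝ) * ((k : ℝ) / N) ^ v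
      ≤ (N : ℝ) ^ v * ((k : ℝ) / N) ^ v := by gcongr
    _ = (k : ℝ) ^ v := by rw [← mul_pow, mul_div_cancel₀]; positivity
    _ ≤ _ := h4

theorem ker_walkEdge_congr {α β α' β' : Type*} {k : ℕ} [NeZero k] {i : Fin k → α} {j : Fin k → β}
    {i' : Fin k → α'} {j' : Fin k → β'} (hi : Setoid.ker i = Setoid.ker i')
    (hj : Setoid.ker j = Setoid.ker j') :
    Setoid.ker (walkEdge i j) = Setoid.ker (walkEdge i' j') := by
  have hi' : ∀ a b, i a = i b ↔ i' a = i' b := fun a b => by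
    have := congrArg (fun s : Setoid (Fin k) => s a b) hi
    simpa [Setoid.ker_def] using this
  have hj' : ∀ a b, j a = j b ↔ j' a = j' b := fun a b => by
    have := congrArg (fun s : Setoid (Fin k) => s a b) hj
    simpa [Setoid.ker_def] using this
  ext a b
  rcases a with a | a <;> rcases b with b | b <;>
    simp [Setoid.ker_def, walkEdge, Prod.ext_iff, hi', hj']

/-- A closed bipartite walk visiting `v + v'` vertices uses at least `v + v' - 1` edges. -/
theorem card_vertices_le_card_edges {α β : Type*} [DecidableEq α] [DecidableEq β] {k : ℕ}
    [NeZero k] (i : Fin k → α) (j : Fin k → β) :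
    (Finset.univ.image i).card + (Finset.univ.image j).card ≤
      (Finset.univ.image (walkEdge i j)).card + 1 := by
  classical
  -- Choose for each vertex the time of its first visit. The starting vertex `j 0` is left out,
  -- since no edge leads to its first visit; this is the `+ 1` in the statement.
  have hfi : ∀ a ∈ Finset.univ.image i, ∃ t, i t = a ∧ ∀ s, i s = a → t ≤ s := by
    intro a ha
    obtain ⟨t, -, ht⟩ := Finset.mem_image.1 ha
    have hne : (Finset.univ.filter fun s => i s = a).Nonempty := ⟨t, by simp [ht]⟩
    refine ⟨_, (Finset.mem_filter.1 (Finset.min'_mem _ hne)).2, fun s hs => ?_⟩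
    exact Finset.min'_le _ _ (by simp [hs])
  have hfj : ∀ b ∈ (Finset.univ.image j).erase (j 0), ∃ t : Fin k, j t = b ∧
      (∀ s, j s = b → t ≤ s) ∧ t ≠ 0 := by
    intro b hb
    obtain ⟨hb0, hb⟩ := Finset.mem_erase.1 hb
    obtain ⟨t, -, ht⟩ := Finset.mem_image.1 hb
    have hne : (Finset.univ.filter fun s => j s = b).Nonempty := ⟨t, by simp [ht]⟩
    have h1 := (Finset.mem_filter.1 (Finset.min'_mem _ hne)).2
    refine ⟨_, h1, fun s hs => Finset.min'_le _ _ (by simp [hs]), fun h => hb0 ?_⟩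
    rw [← h1, h]
  choose! f hf hfm using hfi
  choose! g hg hgm hg0 using hfj
  have hsub : ∀ b ∈ (Finset.univ.image j).erase (j 0), (g b - 1) + 1 = g b := fun b _ => by simp
  have hlt : ∀ b ∈ (Finset.univ.image j).erase (j 0), g b - 1 < g b := by
    intro b hb
    have h0 := hg0 b hb
    rw [Fin.lt_def]
    have h1 : (g b).val ≠ 0 := fun h => h0 (Fin.ext (by simpa using h))
    obtain ⟨K, rfl⟩ : ∃ K, k = K + 1 := ⟨k - 1, by have := NeZero.pos k; omega⟩
    rw [Fin.val_sub_one_of_ne_zero h0]; omega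
  let E1 := (Finset.univ.image i).image fun a => (a, j (f a))
  let E2 := ((Finset.univ.image j).erase (j 0)).image fun b => (i (g b - 1), b)
  have hE1 : E1.card = (Finset.univ.image i).card :=
    Finset.card_image_of_injective _ fun a b h => (Prod.ext_iff.1 h).1
  have hE2 : E2.card = ((Finset.univ.image j).erase (j 0)).card :=
    Finset.card_image_of_injective _ fun a b h => (Prod.ext_iff.1 h).2
  -- A common edge `(a, b)` would give `g b ≤ f a`, as `b` occurs at time `f a`, and `f a ≤ g b -
  -- 1`, as `a` occurs at time `g b - 1`.
  have hdisj : Disjoint E1 E2 := by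
    rw [Finset.disjoint_left]
    rintro ⟨a, b⟩ h1 h2
    obtain ⟨a', ha', e1⟩ := Finset.mem_image.1 h1
    obtain ⟨b', hb', e2⟩ := Finset.mem_image.1 h2
    simp only [Prod.mk.injEq] at e1 e2
    obtain ⟨rfl, e1⟩ := e1
    obtain ⟨e2, rfl⟩ := e2
    have h3 := hgm _ hb' (f a') e1
    have h4 := hfm _ ha' _ e2
    exact absurd (lt_of_le_of_lt h4 (hlt _ hb')) (not_lt.2 h3)
  have hsubset : E1 ∪ E2 ⊆ Finset.univ.image (walkEdge i j) := by
    intro x hx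
    rcases Finset.mem_union.1 hx with hx | hx
    · obtain ⟨a, ha, rfl⟩ := Finset.mem_image.1 hx
      exact Finset.mem_image.2 ⟨Sum.inl (f a), Finset.mem_univ _, by simp [walkEdge, hf a ha]⟩
    · obtain ⟨b, hb, rfl⟩ := Finset.mem_image.1 hx
      exact Finset.mem_image.2 ⟨Sum.inr (g b - 1), Finset.mem_univ _, by
        simp [walkEdge, hg b hb]⟩
  have hcard := Finset.card_le_card hsubset
  rw [Finset.card_union_of_disjoint hdisj, hE1, hE2,
    Finset.card_erase_of_mem (Finset.mem_image_of_mem _ (Finset.mem_univ _))] at hcard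
  omega

end Combinatorics

/-! ### Spectral calculus for symmetric real matrices, and singular values -/

theorem dotProduct_gram_mulVec {m n : Type*} [Fintype m] [Fintype n] (A : Matrix m n ℝ) (x : n → ℝ) :
    x ⬝ᵥ ((Aᵀ * A) *ᵥ x) = (A *ᵥ x) ⬝ᵥ (A *ᵥ x) := by
  rw [← Matrix.mulVec_mulVec, Matrix.dotProduct_mulVec, Matrix.vecMul_transpose]

theorem isHermitian_gram {m n : Type*} [Fintype m] (A : Matrix m n ℝ) : (Aᵀ * A).IsHermitian := by
  simpa using Matrix.isHermitian_conjTranspose_mul_self A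

theorem dotProduct_self_nonneg' {m : Type*} [Fintype m] (x : m → ℝ) : 0 ≤ x ⬝ᵥ x :=
  Finset.sum_nonneg fun _ _ => mul_self_nonneg _

section Spectral

variable {n : Type*} [Fintype n] [DecidableEq n]

/-- `U diag(d) Uᵀ`. -/
def conjDiag (U : Matrix n n ℝ) (d : n → ℝ) : Matrix n n ℝ := U * Matrix.diagonal d * Uᵀ

theorem Matrix.IsHermitian.exists_conjDiag {S : Matrix n n ℝ} (hS : S.IsHermitian) :
    ∃ (U : Matrix n n ℝ) (d : n → ℝ), Uᵀ * U = 1 ∧ U * Uᵀ = 1 ∧ S = conjDiag U d := by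
  refine ⟨hS.eigenvectorUnitary, hS.eigenvalues, ?_, ?_, ?_⟩
  · simpa [Matrix.star_eq_conjTranspose] using Unitary.coe_star_mul_self hS.eigenvectorUnitary
  · simpa [Matrix.star_eq_conjTranspose] using Unitary.coe_mul_star_self hS.eigenvectorUnitary
  · have := hS.spectral_theorem
    rw [Unitary.conjStarAlgAut_apply] at this
    simpa [conjDiag, Matrix.star_eq_conjTranspose, Function.comp_def] using this

variable {U : Matrix n n ℝ}

theorem conjDiag_mul (hU : Uᵀ * U = 1) (d e : n → ℝ) :
    conjDiag U d * conjDiag U e = conjDiag U (fun i => d i * e i) := by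
  unfold conjDiag
  rw [← Matrix.diagonal_mul_diagonal]
  calc U * Matrix.diagonal d * Uᵀ * (U * Matrix.diagonal e * Uᵀ)
      = U * Matrix.diagonal d * (Uᵀ * U) * Matrix.diagonal e * Uᵀ := by simp only [mul_assoc]
    _ = _ := by rw [hU]; simp only [mul_assoc, mul_one]

theorem conjDiag_const (hU : U * Uᵀ = 1) (c : ℝ) :
    conjDiag U (fun _ => c) = c • (1 : Matrix n n ℝ) := by
  unfold conjDiag
  rw [← Matrix.smul_one_eq_diagonal]; simp [hU]

theorem conjDiag_add (d e : n → ℝ) :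
    conjDiag U d + conjDiag U e = conjDiag U (fun i => d i + e i) := by
  unfold conjDiag
  rw [← Matrix.diagonal_add, mul_add, add_mul]

theorem conjDiag_pow (hU : Uᵀ * U = 1) (hU' : U * Uᵀ = 1) (d : n → ℝ) (k : ℕ) :
    conjDiag U d ^ k = conjDiag U (fun i => d i ^ k) := by
  induction k with
  | zero => simp [conjDiag_const hU']
  | succ k ih => rw [pow_succ, ih, conjDiag_mul hU]; simp only [pow_succ]

theorem conjDiag_inv (hU : Uᵀ * U = 1) (hU' : U * Uᵀ = 1) {d : n → ℝ} (hd : ∀ i, d i ≠ 0) :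
    (conjDiag U d)⁻¹ = conjDiag U (fun i => (d i)⁻¹) := by
  refine Matrix.inv_eq_right_inv ?_
  rw [conjDiag_mul hU]
  simp only [mul_inv_cancel₀ (hd _)]
  simpa using conjDiag_const hU' 1

theorem trace_conjDiag (hU : Uᵀ * U = 1) (d : n → ℝ) : (conjDiag U d).trace = ∑ i, d i := by
  unfold conjDiag
  rw [Matrix.trace_mul_comm, ← mul_assoc, hU, one_mul, Matrix.trace_diagonal]

theorem dotProduct_conjDiag_mulVec (d x : n → ℝ) :
    x ⬝ᵥ (conjDiag U d *ᵥ x) = ∑ i, d i * (Uᵀ *ᵥ x) i ^ 2 := by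
  unfold conjDiag
  rw [← Matrix.mulVec_mulVec, ← Matrix.mulVec_mulVec, Matrix.dotProduct_mulVec,
    ← Matrix.mulVec_transpose]
  simp only [dotProduct, Matrix.mulVec_diagonal]
  exact Finset.sum_congr rfl fun i _ => by ring

theorem sum_sq_transpose_mulVec (hU' : U * Uᵀ = 1) (x : n → ℝ) :
    ∑ i, (Uᵀ *ᵥ x) i ^ 2 = x ⬝ᵥ x := by
  have h := dotProduct_conjDiag_mulVec (U := U) (fun _ => 1) x
  rw [conjDiag_const hU'] at h
  simpa using h.symm

theorem transpose_mulVec_col (hU : Uᵀ * U = 1) (i : n) :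
    (Uᵀ *ᵥ (fun a => U a i)) = Pi.single i 1 := by
  ext j
  have := congrFun (congrFun hU j) i
  simp only [Matrix.mul_apply, Matrix.transpose_apply] at this
  simp only [Matrix.mulVec, dotProduct, Matrix.transpose_apply]
  rw [this, Matrix.one_apply, Pi.single_apply]

theorem dotProduct_conjDiag_col (hU : Uᵀ * U = 1) (d : n → ℝ) (i : n) :
    (fun a => U a i) ⬝ᵥ (conjDiag U d *ᵥ (fun a => U a i)) = d i := by
  rw [dotProduct_conjDiag_mulVec, transpose_mulVec_col hU]
  simp [Pi.single_apply]

theorem dotProduct_col_self (hU : Uᵀ * U = 1) (i : n) :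
    (fun a => U a i) ⬝ᵥ (fun a => U a i) = 1 := by
  have := congrFun (congrFun hU i) i
  simpa [Matrix.mul_apply, dotProduct] using this

/-- Powers of the quadratic form of a Gram matrix are bounded by traces of its powers. -/
theorem norm_sq_mulVec_pow_le_trace {m : Type*} [Fintype m] (A : Matrix m n ℝ) {x : n → ℝ}
    (hx : x ⬝ᵥ x = 1) (k : ℕ) :
    ((A *ᵥ x) ⬝ᵥ (A *ᵥ x)) ^ k ≤ ((Aᵀ * A) ^ k).trace := by
  obtain ⟨U, d, hU, hU', hS⟩ := (isHermitian_gram A).exists_conjDiag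
  have hd : ∀ i, 0 ≤ d i := fun i => by
    rw [← dotProduct_conjDiag_col hU d i, ← hS, dotProduct_gram_mulVec]
    exact dotProduct_self_nonneg' _
  rw [← dotProduct_gram_mulVec, hS, conjDiag_pow hU hU', trace_conjDiag hU,
    dotProduct_conjDiag_mulVec]
  have hsum := sum_sq_transpose_mulVec hU' x
  rw [hx] at hsum
  set w : n → ℝ := fun i => (Uᵀ *ᵥ x) i ^ 2
  have hw : ∀ i, 0 ≤ w i := fun i => sq_nonneg _
  -- The squared coordinates of `x` in the eigenbasis are weights of total mass one, so Jensen's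
  -- inequality applies.
  calc (∑ i, d i * w i) ^ k = (∑ i, w i * d i) ^ k := by simp only [mul_comm]
    _ ≤ ∑ i, w i * d i ^ k :=
        Real.pow_arith_mean_le_arith_mean_pow _ _ _ (fun i _ => hw i) hsum (fun i _ => hd i) k
    _ ≤ ∑ i, d i ^ k := by
        refine Finset.sum_le_sum fun i _ => ?_
        have : w i ≤ 1 := by
          rw [← hsum]
          exact Finset.single_le_sum (f := w) (fun i _ => hw i) (Finset.mem_univ i)
        exact mul_le_of_le_one_left (pow_nonneg (hd i) k) this

theorem trace_gram_pow_le {m : Type*} [Fintype m] (A : Matrix m n ℝ) {b : ℝ}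
    (hb : ∀ x : n → ℝ, x ⬝ᵥ x = 1 → (A *ᵥ x) ⬝ᵥ (A *ᵥ x) ≤ b) (k : ℕ) :
    ((Aᵀ * A) ^ k).trace ≤ Fintype.card n * b ^ k := by
  obtain ⟨U, d, hU, hU', hS⟩ := (isHermitian_gram A).exists_conjDiag
  have hd : ∀ i, 0 ≤ d i ∧ d i ≤ b := fun i => by
    rw [← dotProduct_conjDiag_col hU d i, ← hS, dotProduct_gram_mulVec]
    exact ⟨dotProduct_self_nonneg' _, hb _ (dotProduct_col_self hU i)⟩
  rw [hS, conjDiag_pow hU hU', trace_conjDiag hU]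
  calc ∑ i, d i ^ k ≤ ∑ _i : n, b ^ k :=
        Finset.sum_le_sum fun i _ => pow_le_pow_left₀ (hd i).1 (hd i).2 k
    _ = _ := by simp

end Spectral

/-- Each singular value is the norm of the image of some unit vector. -/
theorem exists_unit_singVal {N n : ℕ} (A : Matrix (Fin N) (Fin n) ℝ) {i : ℕ} (hi : 1 ≤ i)
    (hin : i ≤ n) : ∃ x : Fin n → ℝ, x ⬝ᵥ x = 1 ∧ (A *ᵥ x) ⬝ᵥ (A *ᵥ x) = singVal A i ^ 2 := by
  set T := Matrix.toEuclideanLin A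
  have hfr : i - 1 < Module.finrank ℝ (EuclideanSpace ℝ (Fin n)) := by
    rw [finrank_euclideanSpace_fin]; omega
  have hev := T.hasEigenvalue_adjoint_comp_self_sq_singularValues hfr
  obtain ⟨v, hv⟩ := hev.exists_hasEigenvector
  have hv0 : ‖v‖ ≠ 0 := norm_ne_zero_iff.2 hv.2
  set u : EuclideanSpace ℝ (Fin n) := (‖v‖)⁻¹ • v
  have hu : ‖u‖ = 1 := by simp [u, norm_smul, hv0]
  have hTu : (LinearMap.adjoint T ∘ₗ T) u = (T.singularValues (i - 1) ^ 2) • u := by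
    have := hv.apply_eq_smul
    simp only [u, map_smul]
    rw [this, smul_comm]
    rfl
  have h1 : ‖T u‖ ^ 2 = singVal A i ^ 2 := by
    rw [← real_inner_self_eq_norm_sq, ← LinearMap.adjoint_inner_left,
      show LinearMap.adjoint T (T u) = (T.singularValues (i - 1) ^ 2) • u from hTu,
      real_inner_smul_left, real_inner_self_eq_norm_sq, hu]
    simp [singVal, T]
  refine ⟨u.ofLp, ?_, ?_⟩
  · have := EuclideanSpace.real_norm_sq_eq u
    rw [hu] at this
    simp only [dotProduct, ← pow_two]
    linarith
  · rw [← h1, EuclideanSpace.real_norm_sq_eq]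
    simp [dotProduct, T, ← pow_two, Matrix.toLpLin_apply]

theorem singVal_nonneg {N n : ℕ} (A : Matrix (Fin N) (Fin n) ℝ) (i : ℕ) : 0 ≤ singVal A i :=
  LinearMap.singularValues_nonneg _ _

/-! ### Comparison of trace moments with a `2k × 2k` model -/

theorem prod_comp_eq_prod_pow {τ α : Type*} [Fintype τ] [Fintype α] [DecidableEq α]
    (e : τ → α) (y : α → ℝ) :
    ∏ t, y (e t) = ∏ a, y a ^ (Finset.card {t : τ | e t = a}) := by
  rw [← Finset.prod_fiberwise_of_maps_to (s := Finset.univ) (t := Finset.univ) (g := e)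
    (fun _ _ => Finset.mem_univ _)]
  refine Finset.prod_congr rfl fun a _ => ?_
  rw [← Finset.prod_const]
  exact Finset.prod_congr rfl fun t ht => by rw [(Finset.mem_filter.1 ht).2]

/-- By independence the expectation factors over the distinct edges, each of which contributes `k /
N` times a model moment. A walk on `v` vertices has at least `v - 1` distinct edges and `k / N ≤ 1`,
so the number of edges in the exponent may be replaced by `v - 1`. The factor `k ^ k` is `√k` to the
total number `2k` of steps. -/
theorem abs_integral_walk_le {Ω : Type*} [MeasurableSpace Ω] {P : Measure Ω}
    [IsProbabilityMeasure P] {N k : ℕ} [NeZero k] (hkN : k ≤ N)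
    {α β : Type*} [Fintype α] [Fintype β] [DecidableEq α] [DecidableEq β]
    {Y : α → β → Ω → ℝ} (hmeas : ∀ a b, Measurable (Y a b))
    (hind : iIndepFun (fun ab : α × β => Y ab.1 ab.2) P) {z : ℕ → ℝ}
    (hz0 : z 0 = 1) (hz : ∀ m, 0 ≤ z m)
    (hmom : ∀ a b m, 1 ≤ m → m ≤ 2 * k → |∫ ω, Y a b ω ^ m ∂P| * √k ^ m ≤ k / N * z m)
    (i : Fin k → α) (j : Fin k → β) :
    |∫ ω, ∏ t, Y (walkEdge i j t).1 (walkEdge i j t).2 ω ∂P| * (k : ℝ) ^ k ≤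
      ((k : ℝ) / N) ^ ((Finset.univ.image i).card + (Finset.univ.image j).card - 1) *
        classProd z (Setoid.ker (walkEdge i j)) := by
  classical
  set e := walkEdge i j
  set c : α × β → ℕ := fun ab => Finset.card {t : Fin k ⊕ Fin k | e t = ab} with hc
  have hk0 : 0 < k := NeZero.pos k
  have hN0 : 0 < N := lt_of_lt_of_le hk0 hkN
  have hsum : ∑ ab, c ab = 2 * k := by
    have := Finset.card_eq_sum_card_fiberwise (f := e) (s := Finset.univ) (t := Finset.univ)
      (fun _ _ => Finset.mem_univ _)
    rw [← this]; simp; ring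
  have hcle : ∀ ab, c ab ≤ 2 * k := fun ab => by
    rw [← hsum]; exact Finset.single_le_sum (fun _ _ => Nat.zero_le _) (Finset.mem_univ ab)
  have h1 : ∫ ω, ∏ t, Y (e t).1 (e t).2 ω ∂P = ∏ ab, ∫ ω, Y ab.1 ab.2 ω ^ c ab ∂P := by
    have h2 : ∀ ω, ∏ t, Y (e t).1 (e t).2 ω = ∏ ab : α × β, Y ab.1 ab.2 ω ^ c ab := fun ω =>
      prod_comp_eq_prod_pow e (fun ab => Y ab.1 ab.2 ω)
    simp_rw [h2]
    have h3 := hind.comp (fun ab (x : ℝ) => x ^ c ab) (fun ab => measurable_id.pow_const _)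
    exact h3.integral_fun_prod_eq_prod_integral
      (fun ab => ((hmeas _ _).pow_const _).aestronglyMeasurable)
  have hsq : (k : ℝ) ^ k = ∏ ab, √k ^ c ab := by
    rw [Finset.prod_pow_eq_pow_sum, hsum, pow_mul, Real.sq_sqrt (Nat.cast_nonneg k)]
  rw [h1, Finset.abs_prod, hsq, ← Finset.prod_mul_distrib]
  have h4 : ∏ ab, |∫ ω, Y ab.1 ab.2 ω ^ c ab ∂P| * √k ^ c ab ≤
      ∏ ab, (if c ab = 0 then 1 else (k : ℝ) / N) * z (c ab) := by
    refine Finset.prod_le_prod (fun ab _ => by positivity) fun ab _ => ?_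
    split_ifs with h
    · simp [h, hz0]
    · exact hmom _ _ _ (Nat.one_le_iff_ne_zero.2 h) (hcle ab)
  refine h4.trans ?_
  rw [Finset.prod_mul_distrib, prod_fiber_card_eq_classProd z hz0 e]
  refine mul_le_mul_of_nonneg_right ?_ (classProd_nonneg hz _)
  have himg : (Finset.univ.filter fun ab => ¬ c ab = 0) = Finset.univ.image e := by
    ext ab
    simp [hc, Finset.filter_eq_empty_iff]
    rw [← not_exists, ← or_iff_not_imp_left]
  have h5 : ∏ ab, (if c ab = 0 then 1 else (k : ℝ) / N) =
      ((k : ℝ) / N) ^ (Finset.univ.image e).card := by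
    rw [Finset.prod_ite]
    simp [himg, div_pow]
  rw [h5]
  refine pow_le_pow_of_le_one (by positivity) ?_ ?_
  · rw [div_le_one (by positivity)]; exact_mod_cast hkN
  · have := card_vertices_le_card_edges i j
    simp only [e]; omega

/-- Comparison of the trace moments of a matrix with independent entries of variance `1 / N` with
the moments of a `2k × 2k` model. -/
theorem integral_trace_gram_pow_le {Ω : Type*} [MeasurableSpace Ω] {P : Measure Ω}
    [IsProbabilityMeasure P] {N n k : ℕ} [NeZero k] (hkN : k ≤ N) (hnN : n ≤ N)
    {Y : Fin N → Fin n → Ω → ℝ} (hmeas : ∀ a b, Measurable (Y a b)) {L : ℝ}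
    (hL : ∀ a b ω, |Y a b ω| ≤ L)
    (hind : iIndepFun (fun ab : Fin N × Fin n => Y ab.1 ab.2) P) {z : ℕ → ℝ}
    (hz0 : z 0 = 1) (hz : ∀ m, 0 ≤ z m)
    (hmom : ∀ a b m, 1 ≤ m → m ≤ 2 * k → |∫ ω, Y a b ω ^ m ∂P| * √k ^ m ≤ k / N * z m) :
    (∫ ω, (((Matrix.of fun a b => Y a b ω)ᵀ * (Matrix.of fun a b => Y a b ω)) ^ k).trace ∂P) *
        (k : ℝ) ^ k ≤
      (N : ℝ) / k * ∑ j : Fin k → Fin (2 * k), ∑ i : Fin k → Fin (2 * k),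
        classProd z (Setoid.ker (walkEdge i j)) := by
  classical
  have hk0 : 0 < k := NeZero.pos k
  have hN0 : 0 < N := lt_of_lt_of_le hk0 hkN
  have hkR : (0 : ℝ) < k := by exact_mod_cast hk0
  have hNR : (0 : ℝ) < N := by exact_mod_cast hN0
  simp_rw [trace_gram_pow_eq_sum, Matrix.of_apply]
  have hint : ∀ (j : Fin k → Fin n) (i : Fin k → Fin N), Integrable
      (fun ω => ∏ t, Y (walkEdge i j t).1 (walkEdge i j t).2 ω) P := fun j i => by
    refine Integrable.of_bound (C := ∏ _t : Fin k ⊕ Fin k, L)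
      (Finset.measurable_fun_prod _ fun t _ => hmeas _ _).aestronglyMeasurable
      (Eventually.of_forall fun ω => ?_)
    rw [Real.norm_eq_abs, Finset.abs_prod]
    exact Finset.prod_le_prod (fun _ _ => abs_nonneg _) fun t _ => hL _ _ _
  rw [integral_finsetSum _ fun j _ => integrable_finsetSum _ fun i _ => hint j i]
  simp_rw [integral_finsetSum _ fun i _ => hint _ i]
  have hG : ∀ {α β : Type} (i : Fin k → α) (j : Fin k → β),
      0 ≤ classProd z (Setoid.ker (walkEdge i j)) := fun i j => classProd_nonneg hz _
  calc (∑ j : Fin k → Fin n, ∑ i : Fin k → Fin N,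
          ∫ ω, ∏ t, Y (walkEdge i j t).1 (walkEdge i j t).2 ω ∂P) * (k : ℝ) ^ k
      ≤ ∑ j : Fin k → Fin n, ∑ i : Fin k → Fin N, (N : ℝ) / k *
          (((k : ℝ) / N) ^ (Finset.univ.image j).card *
          (((k : ℝ) / N) ^ (Finset.univ.image i).card *
            classProd z (Setoid.ker (walkEdge i j)))) := by
        rw [Finset.sum_mul]
        refine Finset.sum_le_sum fun j _ => ?_
        rw [Finset.sum_mul]
        refine Finset.sum_le_sum fun i _ => ?_
        refine (mul_le_mul_of_nonneg_right (le_abs_self _) (by positivity)).trans ?_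
        refine (abs_integral_walk_le hkN hmeas hind hz0 hz hmom i j).trans (le_of_eq ?_)
        have hpos : 0 < (Finset.univ.image i).card :=
          Finset.card_pos.2 (Finset.univ_nonempty.image _)
        obtain ⟨v, hv⟩ : ∃ v, (Finset.univ.image i).card = v + 1 :=
          ⟨_, (Nat.succ_pred_eq_of_pos hpos).symm⟩
        rw [hv, show v + 1 + (Finset.univ.image j).card - 1 = v + (Finset.univ.image j).card by
          omega, pow_add, pow_succ]
        field_simp
    _ = (N : ℝ) / k * ∑ j : Fin k → Fin n, ((k : ℝ) / N) ^ (Finset.univ.image j).card *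
          ∑ i : Fin k → Fin N, ((k : ℝ) / N) ^ (Finset.univ.image i).card *
            classProd z (Setoid.ker (walkEdge i j)) := by
        simp only [Finset.mul_sum]
    _ ≤ (N : ℝ) / k * ∑ j : Fin k → Fin n, ((k : ℝ) / N) ^ (Finset.univ.image j).card *
          ∑ i : Fin k → Fin (2 * k), classProd z (Setoid.ker (walkEdge i j)) := by
        gcongr with j _
        -- The weight depends on `i` only through its kernel, which is expressed by replacing `i`
        -- with the quotient map. Rows are exchanged first, then columns in the same way.
        have := sum_ker_le_sum_ker (k := k) hN0 (α := Fin N) (by simp)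
          (fun s => classProd z (Setoid.ker (walkEdge (Quotient.mk s) j)))
          (fun s => classProd_nonneg hz _)
        have hker : ∀ {α : Type} (i : Fin k → α), classProd z (Setoid.ker
            (walkEdge (Quotient.mk (Setoid.ker i)) j)) = classProd z (Setoid.ker (walkEdge i j)) :=
          fun i => by rw [ker_walkEdge_congr (Setoid.ker_mk_eq _) rfl]
        simpa only [hker] using this
    _ = (N : ℝ) / k * ∑ j : Fin k → Fin n, ((k : ℝ) / N) ^ (Finset.univ.image j).card *
          ∑ i : Fin k → Fin (2 * k), classProd z (Setoid.ker (walkEdge i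
            (Quotient.mk (Setoid.ker j)))) := by
        have hker : ∀ (j : Fin k → Fin n) (i : Fin k → Fin (2 * k)), classProd z (Setoid.ker
            (walkEdge i (Quotient.mk (Setoid.ker j)))) = classProd z (Setoid.ker (walkEdge i j)) :=
          fun j i => by rw [ker_walkEdge_congr rfl (Setoid.ker_mk_eq _)]
        simp only [hker]
    _ ≤ (N : ℝ) / k * ∑ j : Fin k → Fin (2 * k), ∑ i : Fin k → Fin (2 * k),
        classProd z (Setoid.ker (walkEdge i (Quotient.mk (Setoid.ker j)))) := by
        gcongr
        exact sum_ker_le_sum_ker (k := k) hN0 (α := Fin n) (by simpa using hnN)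
          (fun s => ∑ i : Fin k → Fin (2 * k),
            classProd z (Setoid.ker (walkEdge i (Quotient.mk s))))
          (fun s => Finset.sum_nonneg fun i _ => classProd_nonneg hz _)
    _ = _ := by
        have hker : ∀ (j : Fin k → Fin (2 * k)) (i : Fin k → Fin (2 * k)), classProd z (Setoid.ker
            (walkEdge i (Quotient.mk (Setoid.ker j)))) = classProd z (Setoid.ker (walkEdge i j)) :=
          fun j i => by rw [ker_walkEdge_congr rfl (Setoid.ker_mk_eq _)]
        simp only [hker]

/-! ### Nets of the unit ball and bilinear forms -/

section Net

/-- A `1/2`-net of the Euclidean unit ball with at most `5 ^ d` elements. -/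
theorem exists_half_net (ι : Type*) [Fintype ι] :
    ∃ s : Finset (EuclideanSpace ℝ ι), s.card ≤ 5 ^ Fintype.card ι ∧ (∀ c ∈ s, ‖c‖ ≤ 1) ∧
      ∀ x : EuclideanSpace ℝ ι, ‖x‖ ≤ 1 → ∃ c ∈ s, ‖x - c‖ ≤ 1 / 2 := by
  classical
  -- A maximal 1-separated subset of the ball of radius 2, scaled by one half, is the net. The
  -- volume bound `5 ^ d` is stated for this normalization.
  let p : Finset (EuclideanSpace ℝ ι) → Prop := fun s =>
    (∀ c ∈ s, ‖c‖ ≤ 2) ∧ ∀ c ∈ s, ∀ d ∈ s, c ≠ d → 1 ≤ ‖c - d‖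
  have hcard : ∀ s, p s → s.card ≤ 5 ^ Fintype.card ι := fun s hs => by
    have := Besicovitch.card_le_of_separated s hs.1 hs.2
    rwa [finrank_euclideanSpace] at this
  let M : Set ℕ := {m | ∃ s, p s ∧ s.card = m}
  have hM : M.Nonempty := ⟨0, ∅, ⟨by simp, by simp⟩, rfl⟩
  have hMb : BddAbove M := ⟨5 ^ Fintype.card ι, by rintro _ ⟨s, hs, rfl⟩; exact hcard s hs⟩
  obtain ⟨s, hs, hsM⟩ := Nat.sSup_mem hM hMb
  refine ⟨s.image fun c => (1 / 2 : ℝ) • c, Finset.card_image_le.trans (hcard s hs), ?_, ?_⟩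
  · intro c hc
    obtain ⟨d, hd, rfl⟩ := Finset.mem_image.1 hc
    rw [norm_smul]
    have := hs.1 d hd
    norm_num; linarith
  · intro x hx
    by_contra! hcon
    have hy : ‖(2 : ℝ) • x‖ ≤ 2 := by rw [norm_smul]; norm_num; linarith
    have hfar : ∀ c ∈ s, 1 < ‖(2 : ℝ) • x - c‖ := fun c hc => by
      have := hcon _ (Finset.mem_image_of_mem _ hc)
      have h2 : (2 : ℝ) • x - c = (2 : ℝ) • (x - (1 / 2 : ℝ) • c) := by
        rw [smul_sub, smul_smul]; norm_num
      rw [h2, norm_smul]; norm_num; linarith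
    have hnot : (2 : ℝ) • x ∉ s := fun h => by simpa using (hfar _ h).le.trans_lt' zero_lt_one
    have hp : p (insert ((2 : ℝ) • x) s) := by
      refine ⟨fun c hc => ?_, fun c hc d hd hcd => ?_⟩
      · rcases Finset.mem_insert.1 hc with rfl | hc
        exacts [hy, hs.1 c hc]
      · rcases Finset.mem_insert.1 hc with rfl | hc <;> rcases Finset.mem_insert.1 hd with rfl | hd
        · exact absurd rfl hcd
        · exact (hfar d hd).le
        · rw [norm_sub_rev]; exact (hfar c hc).le
        · exact hs.2 c hc d hd hcd
    have := le_csSup hMb ⟨_, hp, rfl⟩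
    rw [Finset.card_insert_of_notMem hnot, hsM] at this
    omega

/-- Approximating the left vector by a net point doubles the bound, and approximating the right
vector doubles it again. The operator norm is thus at most `4 b`. -/
theorem norm_sq_mulVec_le_of_net {ι : Type*} [Fintype ι] [DecidableEq ι]
    {s : Finset (EuclideanSpace ℝ ι)}
    (hs : ∀ x : EuclideanSpace ℝ ι, ‖x‖ ≤ 1 → ∃ c ∈ s, ‖x - c‖ ≤ 1 / 2) (Z : Matrix ι ι ℝ) {b : ℝ}
    (hb0 : 0 ≤ b) (hb : ∀ x ∈ s, ∀ y ∈ s, x.ofLp ⬝ᵥ (Z *ᵥ y.ofLp) ≤ b) (y : ι → ℝ)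
    (hy : y ⬝ᵥ y = 1) : (Z *ᵥ y) ⬝ᵥ (Z *ᵥ y) ≤ 16 * b ^ 2 := by
  let T : EuclideanSpace ℝ ι →L[ℝ] EuclideanSpace ℝ ι := Matrix.toEuclideanCLM (𝕜 := ℝ) Z
  have hT : ∀ x, (T x).ofLp = Z *ᵥ x.ofLp := fun x => by simp [T]
  have hinner : ∀ x w : EuclideanSpace ℝ ι, inner ℝ x w = x.ofLp ⬝ᵥ w.ofLp := fun x w => by
    rw [EuclideanSpace.inner_eq_star_dotProduct]; simp [dotProduct_comm]
  have hc : ∀ c ∈ s, ‖T c‖ ≤ 2 * b := by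
    intro c hc
    rcases eq_or_ne (T c) 0 with h0 | h0
    · rw [h0]; simpa using hb0
    have hw : ‖T c‖ ≠ 0 := norm_ne_zero_iff.2 h0
    set u : EuclideanSpace ℝ ι := (‖T c‖)⁻¹ • T c
    have hu : ‖u‖ = 1 := by simp [u, norm_smul, hw]
    obtain ⟨x, hx, hxu⟩ := hs u hu.le
    have h1 : inner ℝ u (T c) = ‖T c‖ := by
      simp only [u, real_inner_smul_left, real_inner_self_eq_norm_sq]
      field_simp
    have h2 : inner ℝ u (T c) = inner ℝ x (T c) + inner ℝ (u - x) (T c) := by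
      rw [← inner_add_left]; simp
    have h3 : inner ℝ x (T c) ≤ b := by rw [hinner, hT]; exact hb x hx c hc
    have h4 : inner ℝ (u - x) (T c) ≤ 1 / 2 * ‖T c‖ :=
      (real_inner_le_norm _ _).trans (mul_le_mul_of_nonneg_right hxu (norm_nonneg _))
    linarith
  have hTn : ‖T‖ ≤ 4 * b := by
    have : ‖T‖ ≤ 2 * b + ‖T‖ / 2 := by
      refine ContinuousLinearMap.opNorm_le_of_unit_norm (by positivity) fun x hx => ?_
      obtain ⟨c, hcs, hxc⟩ := hs x hx.le
      have : T x = T c + T (x - c) := by simp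
      rw [this]
      refine (norm_add_le _ _).trans (add_le_add (hc c hcs) ?_)
      refine (T.le_opNorm _).trans ?_
      rw [div_eq_mul_one_div]
      exact mul_le_mul_of_nonneg_left hxc (norm_nonneg _)
    linarith
  set v : EuclideanSpace ℝ ι := WithLp.toLp 2 y
  have hv : ‖v‖ ^ 2 = 1 := by
    rw [← real_inner_self_eq_norm_sq, hinner]; exact hy
  have h5 : (Z *ᵥ y) ⬝ᵥ (Z *ᵥ y) = ‖T v‖ ^ 2 := by
    rw [← real_inner_self_eq_norm_sq, hinner, hT]
  rw [h5]
  calc ‖T v‖ ^ 2 ≤ (‖T‖ * ‖v‖) ^ 2 := by gcongr; exact T.le_opNorm _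
    _ = ‖T‖ ^ 2 := by rw [mul_pow, hv, mul_one]
    _ ≤ (4 * b) ^ 2 := by gcongr
    _ = _ := by ring

end Net

/-! ### Trace moments of the model matrix -/

section FiniteModel

variable {S : Type*} [Fintype S] {ρ val : S → ℝ}

theorem sum_prod_weights_mul {A : Type*} [Fintype A] [DecidableEq A] (ρ : S → ℝ)
    (g : A → S → ℝ) :
    ∑ ω : A → S, (∏ a, ρ (ω a)) * ∏ a, g a (ω a) = ∏ a, ∑ s, ρ s * g a s := by
  rw [Finset.prod_univ_sum]
  simp only [Fintype.piFinset_univ, Finset.prod_mul_distrib]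

/-- Chernoff's method at `t = ±√k`. The coefficients satisfy `|x a * y b| ≤ 1`, so each single-entry
parameter stays in the range where the subgaussian bound is assumed, and the exponents add up to at
most `2k`. The power `2k` is controlled by `u ^ (2k) / (2k)! ≤ exp |u|`. -/
theorem sum_weights_bilinear_pow_le {r k : ℕ} (hk : 1 ≤ k) (hρ : ∀ s, 0 ≤ ρ s)
    (hmgf : ∀ t : ℝ, |t| ≤ √k → ∑ s, ρ s * Real.exp (t * val s) ≤ Real.exp (2 * t ^ 2))
    {x y : Fin r → ℝ} (hx : x ⬝ᵥ x ≤ 1) (hy : y ⬝ᵥ y ≤ 1) :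
    ∑ ω : Fin r × Fin r → S, (∏ a, ρ (ω a)) *
      (x ⬝ᵥ ((Matrix.of fun a b => val (ω (a, b))) *ᵥ y)) ^ (2 * k) ≤
      2 * ((2 * k).factorial * (Real.exp 2) ^ k / k ^ k) := by
  have hkR : (0 : ℝ) < k := by exact_mod_cast hk
  have hx1 : ∀ a, x a ^ 2 ≤ 1 := fun a => le_trans (by
    rw [pow_two]
    exact Finset.single_le_sum (f := fun i => x i * x i) (fun i _ => mul_self_nonneg _)
      (Finset.mem_univ a)) hx
  have hy1 : ∀ a, y a ^ 2 ≤ 1 := fun a => le_trans (by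
    rw [pow_two]
    exact Finset.single_le_sum (f := fun i => y i * y i) (fun i _ => mul_self_nonneg _)
      (Finset.mem_univ a)) hy
  set B : (Fin r × Fin r → S) → ℝ := fun ω =>
    x ⬝ᵥ ((Matrix.of fun a b => val (ω (a, b))) *ᵥ y) with hB
  have hBsum : ∀ ω, B ω = ∑ ab : Fin r × Fin r, x ab.1 * y ab.2 * val (ω ab) := fun ω => by
    simp only [hB, dotProduct, Matrix.mulVec, Matrix.of_apply, Finset.mul_sum,
      Fintype.sum_prod_type]
    exact Finset.sum_congr rfl fun a _ => Finset.sum_congr rfl fun b _ => by ring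
  have hexp : ∀ t : ℝ, t ^ 2 = k → ∑ ω : Fin r × Fin r → S, (∏ a, ρ (ω a)) *
      Real.exp (t * B ω) ≤ (Real.exp 2) ^ k := by
    intro t ht
    have h1 : ∀ ω, Real.exp (t * B ω) =
        ∏ ab : Fin r × Fin r, Real.exp (t * (x ab.1 * y ab.2) * val (ω ab)) := fun ω => by
      rw [← Real.exp_sum, hBsum, Finset.mul_sum]
      congr 1
      exact Finset.sum_congr rfl fun a _ => by ring
    simp_rw [h1]
    rw [sum_prod_weights_mul ρ (fun (ab : Fin r × Fin r) s =>
      Real.exp (t * (x ab.1 * y ab.2) * val s))]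
    calc ∏ ab : Fin r × Fin r, ∑ s, ρ s * Real.exp (t * (x ab.1 * y ab.2) * val s)
        ≤ ∏ ab : Fin r × Fin r, Real.exp (2 * (t * (x ab.1 * y ab.2)) ^ 2) := by
          refine Finset.prod_le_prod (fun ab _ => Finset.sum_nonneg fun s _ =>
            mul_nonneg (hρ s) (Real.exp_nonneg _)) fun ab _ => hmgf _ ?_
          refine Real.abs_le_sqrt ?_
          rw [mul_pow, mul_pow, ht]
          exact mul_le_of_le_one_right hkR.le (mul_le_one₀ (hx1 _) (sq_nonneg _) (hy1 _))
      _ = Real.exp (2 * k * ((x ⬝ᵥ x) * (y ⬝ᵥ y))) := by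
          rw [← Real.exp_sum]
          congr 1
          simp only [dotProduct]
          rw [Finset.sum_mul_sum, Fintype.sum_prod_type, Finset.mul_sum]
          refine Finset.sum_congr rfl fun a _ => ?_
          rw [Finset.mul_sum]
          refine Finset.sum_congr rfl fun b _ => ?_
          rw [← ht]; ring
      _ ≤ Real.exp (2 * k * 1) := by
          gcongr
          exact mul_le_one₀ hx (dotProduct_self_nonneg' _) hy
      _ = _ := by rw [← Real.exp_nat_mul]; congr 1; ring
  have hpt : ∀ ω, B ω ^ (2 * k) ≤ (2 * k).factorial / k ^ k *
      (Real.exp (√k * B ω) + Real.exp (-√k * B ω)) := by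
    intro ω
    have h1 := Real.pow_div_factorial_le_exp (|√k * B ω|) (abs_nonneg _) (2 * k)
    have h2 : |√k * B ω| ^ (2 * k) = k ^ k * B ω ^ (2 * k) := by
      rw [pow_mul, sq_abs, mul_pow, Real.sq_sqrt hkR.le, mul_pow, ← pow_mul]
    have h3 : Real.exp |√k * B ω| ≤ Real.exp (√k * B ω) + Real.exp (-√k * B ω) := by
      rcases abs_cases (√k * B ω) with ⟨h, _⟩ | ⟨h, _⟩ <;> rw [h]
      · linarith [Real.exp_pos (-√k * B ω)]
      · rw [neg_mul]; linarith [Real.exp_pos (√k * B ω)]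
    rw [h2] at h1
    have hf : (0 : ℝ) < (2 * k).factorial := by positivity
    rw [div_le_iff₀ hf] at h1
    rw [div_mul_eq_mul_div, le_div_iff₀ (by positivity)]
    nlinarith
  have hw : ∀ ω : Fin r × Fin r → S, 0 ≤ ∏ a, ρ (ω a) := fun ω =>
    Finset.prod_nonneg fun a _ => hρ _
  calc ∑ ω, (∏ a, ρ (ω a)) * B ω ^ (2 * k)
      ≤ ∑ ω, (∏ a, ρ (ω a)) * ((2 * k).factorial / k ^ k *
        (Real.exp (√k * B ω) + Real.exp (-√k * B ω))) :=
        Finset.sum_le_sum fun ω _ => mul_le_mul_of_nonneg_left (hpt ω) (hw ω)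
    _ = (2 * k).factorial / k ^ k * (∑ ω, (∏ a, ρ (ω a)) * Real.exp (√k * B ω) +
          ∑ ω, (∏ a, ρ (ω a)) * Real.exp (-√k * B ω)) := by
        rw [← Finset.sum_add_distrib, Finset.mul_sum]
        exact Finset.sum_congr rfl fun ω _ => by ring
    _ ≤ (2 * k).factorial / k ^ k * ((Real.exp 2) ^ k + (Real.exp 2) ^ k) := by
        gcongr
        · exact hexp _ (Real.sq_sqrt hkR.le)
        · exact hexp _ (by rw [neg_sq, Real.sq_sqrt hkR.le])
    _ = _ := by ring

/-- The sum over walks is the expected trace of the `k`-th power of the Gram matrix of the model. In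
`40000 = 16 · 625 · 4` the first factor is the loss of the net, the second its number of pairs per
power of `k`, and the third comes from `(2k)! ≤ 4 ^ k * k ^ (2k)`. -/
theorem sum_classProd_walk_le {k : ℕ} [NeZero k] (hρ : ∀ s, 0 ≤ ρ s) (hρ1 : ∑ s, ρ s = 1)
    (hmgf : ∀ t : ℝ, |t| ≤ √k → ∑ s, ρ s * Real.exp (t * val s) ≤ Real.exp (2 * t ^ 2)) :
    ∑ j : Fin k → Fin (2 * k), ∑ i : Fin k → Fin (2 * k),
        classProd (fun m => ∑ s, ρ s * val s ^ m) (Setoid.ker (walkEdge i j)) ≤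
      4 * k * (40000 * Real.exp 2) ^ k * k ^ k := by
  classical
  have hk : 1 ≤ k := NeZero.one_le
  have hkR : (0 : ℝ) < k := by exact_mod_cast hk
  set Z : (Fin (2 * k) × Fin (2 * k) → S) → Matrix (Fin (2 * k)) (Fin (2 * k)) ℝ :=
    fun ω => Matrix.of fun a b => val (ω (a, b)) with hZ
  have hw : ∀ ω : Fin (2 * k) × Fin (2 * k) → S, 0 ≤ ∏ a, ρ (ω a) := fun ω =>
    Finset.prod_nonneg fun a _ => hρ _
  have h1 : ∀ (i j : Fin k → Fin (2 * k)),
      classProd (fun m => ∑ s, ρ s * val s ^ m) (Setoid.ker (walkEdge i j)) =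
      ∑ ω : Fin (2 * k) × Fin (2 * k) → S, (∏ a, ρ (ω a)) *
        ∏ t, Z ω (walkEdge i j t).1 (walkEdge i j t).2 := by
    intro i j
    rw [← prod_fiber_card_eq_classProd _ (by simpa using hρ1)]
    rw [← sum_prod_weights_mul]
    refine Finset.sum_congr rfl fun ω _ => ?_
    congr 1
    exact (prod_comp_eq_prod_pow (walkEdge i j) (fun ab => val (ω ab))).symm
  have h2 : ∑ j : Fin k → Fin (2 * k), ∑ i : Fin k → Fin (2 * k),
      classProd (fun m => ∑ s, ρ s * val s ^ m) (Setoid.ker (walkEdge i j)) =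
      ∑ ω : Fin (2 * k) × Fin (2 * k) → S, (∏ a, ρ (ω a)) * (((Z ω)ᵀ * Z ω) ^ k).trace := by
    simp_rw [h1, trace_gram_pow_eq_sum, Finset.mul_sum]
    rw [Finset.sum_comm]
    conv_rhs => rw [Finset.sum_comm]
    rw [Finset.sum_comm]
    refine Finset.sum_congr rfl fun j _ => ?_
    rw [Finset.sum_comm]
  rw [h2]
  obtain ⟨s, hscard, hs1, hs⟩ := exists_half_net (Fin (2 * k))
  rw [Fintype.card_fin] at hscard
  set X : (Fin (2 * k) × Fin (2 * k) → S) → ℝ := fun ω =>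
    ∑ x ∈ s, ∑ y ∈ s, (x.ofLp ⬝ᵥ (Z ω *ᵥ y.ofLp)) ^ (2 * k) with hX
  have heven : ∀ u : ℝ, 0 ≤ u ^ (2 * k) := fun u => by rw [pow_mul]; positivity
  have hX0 : ∀ ω, 0 ≤ X ω := fun ω =>
    Finset.sum_nonneg fun x _ => Finset.sum_nonneg fun y _ => heven _
  have h3 : ∀ ω, (((Z ω)ᵀ * Z ω) ^ k).trace ≤ 2 * k * (16 ^ k * X ω) := by
    intro ω
    -- The `ℓ^{2k}` norm of the values on pairs of net points dominates their maximum and has an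
    -- explicit `2k`-th moment.
    set b : ℝ := X ω ^ (((2 * k : ℕ) : ℝ)⁻¹) with hbdef
    have hb0 : 0 ≤ b := Real.rpow_nonneg (hX0 ω) _
    have hbk : b ^ (2 * k) = X ω := Real.rpow_inv_natCast_pow (hX0 ω) (by omega)
    have hb : ∀ x ∈ s, ∀ y ∈ s, x.ofLp ⬝ᵥ (Z ω *ᵥ y.ofLp) ≤ b := by
      intro x hx y hy
      refine le_of_abs_le (le_of_pow_le_pow_left₀ (n := 2 * k) (by omega) hb0 ?_)
      rw [hbk, pow_mul, sq_abs, ← pow_mul]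
      have h4 := Finset.single_le_sum
        (f := fun y : EuclideanSpace ℝ (Fin (2 * k)) => (x.ofLp ⬝ᵥ (Z ω *ᵥ y.ofLp)) ^ (2 * k))
        (fun y _ => heven _) hy
      have h5 := Finset.single_le_sum
        (f := fun x : EuclideanSpace ℝ (Fin (2 * k)) =>
          ∑ y ∈ s, (x.ofLp ⬝ᵥ (Z ω *ᵥ y.ofLp)) ^ (2 * k))
        (fun y _ => Finset.sum_nonneg fun y _ => heven _) hx
      exact h4.trans h5
    have := trace_gram_pow_le (Z ω) (b := 16 * b ^ 2)
      (fun y hy => norm_sq_mulVec_le_of_net hs (Z ω) hb0 hb y hy) k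
    rw [mul_pow, ← pow_mul, hbk] at this
    simpa using this
  have hdot : ∀ c ∈ s, c.ofLp ⬝ᵥ c.ofLp ≤ 1 := fun c hc => by
    have h := EuclideanSpace.real_norm_sq_eq c
    have h' : ‖c‖ ^ 2 ≤ 1 := pow_le_one₀ (norm_nonneg _) (hs1 c hc)
    simp only [dotProduct, ← pow_two]
    linarith
  set D : ℝ := 2 * ((2 * k).factorial * (Real.exp 2) ^ k / k ^ k) with hD
  have hD0 : 0 ≤ D := by positivity
  have h6 : ∑ ω, (∏ a, ρ (ω a)) * X ω ≤ 625 ^ k * D := by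
    calc ∑ ω, (∏ a, ρ (ω a)) * X ω = ∑ x ∈ s, ∑ y ∈ s, ∑ ω : Fin (2 * k) × Fin (2 * k) → S,
          (∏ a, ρ (ω a)) * (x.ofLp ⬝ᵥ (Z ω *ᵥ y.ofLp)) ^ (2 * k) := by
          simp_rw [hX, Finset.mul_sum]
          rw [Finset.sum_comm]
          refine Finset.sum_congr rfl fun x _ => ?_
          rw [Finset.sum_comm]
      _ ≤ ∑ x ∈ s, ∑ y ∈ s, D := Finset.sum_le_sum fun x hx => Finset.sum_le_sum fun y hy =>
          sum_weights_bilinear_pow_le hk hρ hmgf (hdot x hx) (hdot y hy)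
      _ = (s.card : ℝ) * s.card * D := by simp [mul_assoc]
      _ ≤ (5 ^ (2 * k)) * (5 ^ (2 * k)) * D := by
          have : (s.card : ℝ) ≤ 5 ^ (2 * k) := by exact_mod_cast hscard
          gcongr
      _ = 625 ^ k * D := by rw [pow_mul, ← mul_pow]; norm_num
  have hfact : ((2 * k).factorial : ℝ) ≤ 4 ^ k * (k ^ k * k ^ k) := by
    calc ((2 * k).factorial : ℝ) ≤ ((2 * k) ^ (2 * k) : ℕ) := by
          exact_mod_cast Nat.factorial_le_pow _
      _ = _ := by push_cast; rw [mul_pow, pow_mul, pow_mul]; norm_num; rw [sq, mul_pow]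
  calc ∑ ω : Fin (2 * k) × Fin (2 * k) → S, (∏ a, ρ (ω a)) * (((Z ω)ᵀ * Z ω) ^ k).trace
      ≤ ∑ ω : Fin (2 * k) × Fin (2 * k) → S, (∏ a, ρ (ω a)) * (2 * k * (16 ^ k * X ω)) :=
        Finset.sum_le_sum fun ω _ => mul_le_mul_of_nonneg_left (h3 ω) (hw ω)
    _ = 2 * k * (16 ^ k * ∑ ω, (∏ a, ρ (ω a)) * X ω) := by
        simp only [Finset.mul_sum]
        exact Finset.sum_congr rfl fun ω _ => by ring
    _ ≤ 2 * k * (16 ^ k * (625 ^ k * D)) := by gcongr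
    _ ≤ 2 * k * (16 ^ k * (625 ^ k * (2 * (4 ^ k * (k ^ k * k ^ k) * (Real.exp 2) ^ k / k ^ k)))) := by
        rw [hD]; gcongr
    _ = 4 * k * ((16 * 625 * 4 * Real.exp 2) ^ k) * k ^ k := by
        rw [mul_pow, mul_pow, mul_pow]; field_simp; ring
    _ = _ := by norm_num

end FiniteModel

/-! ### The six-atom law of the model entries -/

section ModelLaw

/-- Weights of the six-atom law of `W + V` with `W ∈ {-1, 2}` and `V ∈ {0, √k, -√k}`. -/
noncomputable def modelWeight (k : ℕ) (s : Fin 2 × Fin 3) : ℝ :=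
  ![2 / 3, 1 / 3] s.1 *
    ![1 - Real.exp (-(2 * k)), Real.exp (-(2 * k)) / 2, Real.exp (-(2 * k)) / 2] s.2

/-- Atoms of the six-atom law. -/
noncomputable def modelValue (k : ℕ) (s : Fin 2 × Fin 3) : ℝ :=
  ![-1, 2] s.1 + ![0, √k, -√k] s.2

/-- Moments of the six-atom law. -/
noncomputable def modelMoment (k m : ℕ) : ℝ := ∑ s, modelWeight k s * modelValue k s ^ m

theorem exp_neg_two_mul_le_one (k : ℕ) : Real.exp (-(2 * k)) ≤ 1 :=
  Real.exp_le_one_iff.2 (by linarith [Nat.cast_nonneg (α := ℝ) k])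

theorem modelWeight_nonneg (k : ℕ) (s : Fin 2 × Fin 3) : 0 ≤ modelWeight k s := by
  have h := exp_neg_two_mul_le_one k
  have h' := Real.exp_pos (-(2 * (k : ℝ)))
  obtain ⟨a, b⟩ := s
  unfold modelWeight
  refine mul_nonneg ?_ ?_
  · fin_cases a <;> norm_num
  · fin_cases b <;> simp <;> first | assumption | positivity

theorem sum_modelWeight (k : ℕ) : ∑ s, modelWeight k s = 1 := by
  simp [modelWeight, Fintype.sum_prod_type, Fin.sum_univ_succ]; ring

/-- `cosh x - 1 = 2 sinh² (x/2)`, together with `sinh u ≤ u * exp u` for `u ≥ 0`. -/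
theorem cosh_sub_one_le (x : ℝ) : Real.cosh x - 1 ≤ x ^ 2 / 2 * Real.exp |x| := by
  wlog hx : 0 ≤ x generalizing x
  · have := this (-x) (by linarith)
    simpa using this
  rw [abs_of_nonneg hx]
  have h1 : Real.cosh x - 1 = 2 * Real.sinh (x / 2) ^ 2 := by
    have := Real.cosh_two_mul (x / 2)
    have h2 := Real.cosh_sq (x / 2)
    rw [show 2 * (x / 2) = x by ring] at this
    linarith
  have h2 : Real.sinh (x / 2) ≤ x / 2 * Real.exp (x / 2) := by
    rw [Real.sinh_eq]
    have h3 : 1 - x ≤ Real.exp (-x) := by linarith [Real.add_one_le_exp (-x)]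
    have h4 : Real.exp (-(x / 2)) = Real.exp (x / 2) * Real.exp (-x) := by
      rw [← Real.exp_add]; congr 1; ring
    rw [h4]
    nlinarith [Real.exp_pos (x / 2)]
  have h3 : 0 ≤ Real.sinh (x / 2) := Real.sinh_nonneg_iff.2 (by linarith)
  have h4 : Real.exp x = Real.exp (x / 2) ^ 2 := by
    rw [← Real.exp_nat_mul]; congr 1; push_cast; ring
  rw [h1, h4]
  have : Real.sinh (x / 2) ^ 2 ≤ (x / 2 * Real.exp (x / 2)) ^ 2 := pow_le_pow_left₀ h3 h2 2
  nlinarith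

/-- Hoeffding's lemma on an interval of length 3 gives `exp (9/8 t²)`. -/
theorem two_point_mgf_le (t : ℝ) :
    2 / 3 * Real.exp (-t) + 1 / 3 * Real.exp (2 * t) ≤ Real.exp (3 / 2 * t ^ 2) := by
  let μ : Measure Bool := ENNReal.ofReal (2 / 3) • Measure.dirac false +
    ENNReal.ofReal (1 / 3) • Measure.dirac true
  have hμ : IsProbabilityMeasure μ := ⟨by
    simp only [μ, Measure.add_apply, Measure.smul_apply, measure_univ, smul_eq_mul, mul_one]
    rw [← ENNReal.ofReal_add (by norm_num) (by norm_num)]; norm_num⟩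
  let X : Bool → ℝ := fun b => if b then 2 else -1
  have hint : ∀ f : Bool → ℝ, ∫ b, f b ∂μ = 2 / 3 * f false + 1 / 3 * f true := fun f => by
    simp only [μ]
    have := Measure.smul_finite (Measure.dirac false) (ENNReal.ofReal_ne_top (r := 2 / 3))
    have := Measure.smul_finite (Measure.dirac true) (ENNReal.ofReal_ne_top (r := 1 / 3))
    rw [integral_add_measure (Integrable.of_finite) (Integrable.of_finite)]
    rw [integral_smul_measure, integral_smul_measure, integral_dirac, integral_dirac]
    rw [ENNReal.toReal_ofReal (by norm_num), ENNReal.toReal_ofReal (by norm_num)]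
    simp
  have hs := hasSubgaussianMGF_of_mem_Icc_of_integral_eq_zero (μ := μ) (X := X) (a := -1) (b := 2)
    (measurable_of_finite _).aemeasurable (Eventually.of_forall fun b => by
      cases b <;> norm_num [X]) (by rw [hint]; simp [X]; norm_num)
  have := hs.mgf_le t
  rw [mgf, hint] at this
  have h2 : (((‖(2 : ℝ) - -1‖₊ / 2) ^ 2 : NNReal) : ℝ) = 9 / 4 := by
    push_cast; rw [Real.norm_eq_abs]; norm_num
  rw [h2] at this
  simp only [X] at this
  norm_num at this
  rw [mul_comm t 2] at this
  refine le_trans (by linarith) (this.trans ?_)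
  refine Real.exp_le_exp.2 ?_
  nlinarith [sq_nonneg t]

/-- The two summands of the model are independent, so the sum factors. The jump costs `exp (-2k) *
(cosh (t √k) - 1)`. As `|t| √k ≤ k`, the probability of a jump absorbs `exp k` and a further factor
`k ≤ exp k`. -/
theorem model_mgf_le {k : ℕ} {t : ℝ} (ht : |t| ≤ √k) :
    ∑ s, modelWeight k s * Real.exp (t * modelValue k s) ≤ Real.exp (2 * t ^ 2) := by
  set ε := Real.exp (-(2 * k)) with hε
  have hprod : ∑ s, modelWeight k s * Real.exp (t * modelValue k s) =
      (2 / 3 * Real.exp (-t) + 1 / 3 * Real.exp (2 * t)) *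
        (1 + ε * (Real.cosh (t * √k) - 1)) := by
    simp only [modelWeight, modelValue, Fintype.sum_prod_type, Fin.sum_univ_succ]
    simp [mul_add, Real.exp_add, Real.cosh_eq, ← hε]
    ring_nf
  rw [hprod]
  have h2 : 1 + ε * (Real.cosh (t * √k) - 1) ≤ Real.exp (1 / 2 * t ^ 2) := by
    have h3 := cosh_sub_one_le (t * √k)
    have h4 : |t * √k| ≤ k := by
      rw [abs_mul, abs_of_nonneg (Real.sqrt_nonneg _)]
      calc |t| * √k ≤ √k * √k := by gcongr
        _ = k := Real.mul_self_sqrt (Nat.cast_nonneg k)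
    have h5 : ε * Real.exp |t * √k| * k ≤ 1 := by
      have h6 : Real.exp |t * √k| ≤ Real.exp k := Real.exp_le_exp.2 h4
      have h7 : (k : ℝ) ≤ Real.exp k := by linarith [Real.add_one_le_exp (k : ℝ)]
      calc ε * Real.exp |t * √k| * k ≤ ε * Real.exp k * Real.exp k := by gcongr
        _ = 1 := by rw [hε, ← Real.exp_add, ← Real.exp_add]; simp; ring
    have hε0 : 0 < ε := Real.exp_pos _
    have h8 : ε * (Real.cosh (t * √k) - 1) ≤ 1 / 2 * t ^ 2 := by
      calc ε * (Real.cosh (t * √k) - 1) ≤ ε * ((t * √k) ^ 2 / 2 * Real.exp |t * √k|) := by gcongr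
        _ = (1 / 2 * t ^ 2) * (ε * Real.exp |t * √k| * k) := by
            rw [mul_pow, Real.sq_sqrt (Nat.cast_nonneg k)]; ring
        _ ≤ (1 / 2 * t ^ 2) * 1 := by gcongr
        _ = _ := mul_one _
    linarith [Real.add_one_le_exp (1 / 2 * t ^ 2)]
  calc _ ≤ Real.exp (3 / 2 * t ^ 2) * Real.exp (1 / 2 * t ^ 2) := by
        refine mul_le_mul (two_point_mgf_le t) h2 ?_ (Real.exp_nonneg _)
        have : 0 ≤ ε * (Real.cosh (t * √k) - 1) :=
          mul_nonneg (Real.exp_nonneg _) (by linarith [Real.one_le_cosh (t * √k)])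
        linarith
    _ = _ := by rw [← Real.exp_add]; congr 1; ring

theorem modelMoment_eq_sum (k m : ℕ) :
    modelMoment k m = ∑ j ∈ Finset.range (m + 1),
      (2 / 3 * (-1) ^ j + 1 / 3 * 2 ^ j) * ((1 - Real.exp (-(2 * k))) * 0 ^ (m - j) +
        Real.exp (-(2 * k)) / 2 * ((√k) ^ (m - j) + (-√k) ^ (m - j))) * m.choose j := by
  unfold modelMoment modelWeight modelValue
  simp_rw [add_pow, Finset.mul_sum]
  rw [Finset.sum_comm]
  refine Finset.sum_congr rfl fun j _ => ?_
  simp [Fintype.sum_prod_type, Fin.sum_univ_succ]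
  ring

theorem two_point_moment_nonneg (j : ℕ) : (0 : ℝ) ≤ 2 / 3 * (-1) ^ j + 1 / 3 * 2 ^ j := by
  rcases Nat.eq_zero_or_pos j with rfl | hj
  · norm_num
  · have h2 : (2 : ℝ) ≤ 2 ^ j := by simpa using pow_le_pow_right₀ (by norm_num : (1 : ℝ) ≤ 2) hj
    rcases neg_one_pow_eq_or ℝ j with h | h <;> rw [h] <;> linarith

theorem one_le_two_point_moment {j : ℕ} (hj : 2 ≤ j) :
    (1 : ℝ) ≤ 2 / 3 * (-1) ^ j + 1 / 3 * 2 ^ j := by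
  rcases hj.eq_or_lt with rfl | hj
  · norm_num
  · have h2 : (8 : ℝ) ≤ 2 ^ j := by
      have := pow_le_pow_right₀ (by norm_num : (1 : ℝ) ≤ 2) (show 3 ≤ j from hj)
      linarith
    rcases neg_one_pow_eq_or ℝ j with h | h <;> rw [h] <;> linarith

theorem three_point_moment_nonneg (k i : ℕ) : 0 ≤ (1 - Real.exp (-(2 * k))) * 0 ^ i +
    Real.exp (-(2 * k)) / 2 * ((√k) ^ i + (-√k) ^ i) := by
  have h := exp_neg_two_mul_le_one k
  refine add_nonneg (mul_nonneg (by linarith) (by positivity)) (mul_nonneg (by positivity) ?_)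
  rcases Nat.even_or_odd i with h | h
  · rw [h.neg_pow]; positivity
  · rw [h.neg_pow]; simp

theorem modelMoment_term_le (k : ℕ) {m j : ℕ} (hj : j ≤ m) :
    (2 / 3 * (-1) ^ j + 1 / 3 * 2 ^ j) * ((1 - Real.exp (-(2 * k))) * 0 ^ (m - j) +
        Real.exp (-(2 * k)) / 2 * ((√k) ^ (m - j) + (-√k) ^ (m - j))) * m.choose j ≤
      modelMoment k m := by
  rw [modelMoment_eq_sum]
  refine Finset.single_le_sum (f := fun j => (2 / 3 * (-1) ^ j + 1 / 3 * 2 ^ j) *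
    ((1 - Real.exp (-(2 * (k : ℝ)))) * 0 ^ (m - j) +
        Real.exp (-(2 * k)) / 2 * ((√k) ^ (m - j) + (-√k) ^ (m - j))) * (m.choose j : ℝ))
    (fun i _ => ?_) (Finset.mem_range.2 (Nat.lt_succ_of_le hj))
  exact mul_nonneg (mul_nonneg (two_point_moment_nonneg i) (three_point_moment_nonneg k _))
    (Nat.cast_nonneg _)

theorem modelMoment_zero (k : ℕ) : modelMoment k 0 = 1 := by
  simpa [modelMoment] using sum_modelWeight k

theorem one_le_modelMoment (k : ℕ) {m : ℕ} (hm : 2 ≤ m) : 1 ≤ modelMoment k m := by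
  have := modelMoment_term_le k (le_refl m)
  simp at this
  have h2 := one_le_two_point_moment hm
  norm_num at h2
  linarith

theorem modelMoment_nonneg (k m : ℕ) : 0 ≤ modelMoment k m := by
  rw [modelMoment_eq_sum]
  exact Finset.sum_nonneg fun i _ => mul_nonneg (mul_nonneg (two_point_moment_nonneg i)
    (three_point_moment_nonneg k _)) (Nat.cast_nonneg _)

/-- For even `m` the pure jump term suffices. For odd `m` the jump, being symmetric, has no moment
of order `m`. The term combining the positive third moment of the two-point part with the even jump
moment of order `m - 3` is used instead, which explains the exponent and the asymmetry of the law.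
-/
theorem exp_mul_pow_le_modelMoment {k m : ℕ} (hk : 1 ≤ k) (hm : 3 ≤ m) :
    Real.exp (-(2 * k)) * √k ^ (m - 3) ≤ modelMoment k m := by
  have hε := Real.exp_pos (-(2 * (k : ℝ)))
  have hε1 := exp_neg_two_mul_le_one k
  have hk1 : 1 ≤ √k := by rw [Real.one_le_sqrt]; exact_mod_cast hk
  rcases Nat.even_or_odd m with h | h
  · have := modelMoment_term_le k (Nat.zero_le m)
    rw [Nat.sub_zero, h.neg_pow] at this
    have h0 : (0 : ℝ) ^ m = 0 := zero_pow (by omega)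
    rw [h0] at this
    norm_num at this
    have h2 := mul_le_mul_of_nonneg_left (pow_le_pow_right₀ hk1 (Nat.sub_le m 3)) hε.le
    linarith
  · have h3 : Even (m - 3) := Nat.Odd.sub_odd h (by decide)
    have := modelMoment_term_le k hm
    rw [h3.neg_pow] at this
    refine le_trans ?_ this
    have hc : (1 : ℝ) ≤ m.choose 3 := by exact_mod_cast Nat.choose_pos hm
    have h4 : Real.exp (-(2 * k)) * √k ^ (m - 3) ≤ ((1 - Real.exp (-(2 * k))) * 0 ^ (m - 3) +
        Real.exp (-(2 * k)) / 2 * ((√k) ^ (m - 3) + (√k) ^ (m - 3))) := by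
      have : 0 ≤ (1 - Real.exp (-(2 * (k : ℝ)))) * 0 ^ (m - 3) :=
        mul_nonneg (by linarith) (by positivity)
      linarith
    have h5 : (0 : ℝ) ≤ Real.exp (-(2 * k)) * √k ^ (m - 3) := by positivity
    norm_num
    nlinarith [mul_le_mul h4 hc (by norm_num) (h5.trans h4)]

theorem sum_classProd_model_le {k : ℕ} [NeZero k] :
    ∑ j : Fin k → Fin (2 * k), ∑ i : Fin k → Fin (2 * k),
        classProd (modelMoment k) (Setoid.ker (walkEdge i j)) ≤
      4 * k * (40000 * Real.exp 2) ^ k * k ^ k :=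
  sum_classProd_walk_le (modelWeight_nonneg k) (sum_modelWeight k) fun _ => model_mgf_le

end ModelLaw

/-- Trace moment bound for matrices with independent entries whose moments are dominated by those
of the model law. -/
theorem integral_trace_gram_pow_le_of_moments {Ω : Type*} [MeasurableSpace Ω] {P : Measure Ω}
    [IsProbabilityMeasure P] {N n k : ℕ} (hk : 1 ≤ k) (hkN : k ≤ N) (hnN : n ≤ N)
    {Y : Fin N → Fin n → Ω → ℝ} (hmeas : ∀ a b, Measurable (Y a b)) {L : ℝ}
    (hL : ∀ a b ω, |Y a b ω| ≤ L)
    (hind : iIndepFun (fun ab : Fin N × Fin n => Y ab.1 ab.2) P)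
    (hmom : ∀ a b m, 1 ≤ m → m ≤ 2 * k →
      |∫ ω, Y a b ω ^ m ∂P| * √k ^ m ≤ k / N * modelMoment k m) :
    ∫ ω, (((Matrix.of fun a b => Y a b ω)ᵀ * (Matrix.of fun a b => Y a b ω)) ^ k).trace ∂P ≤
      4 * N * (40000 * Real.exp 2) ^ k := by
  have : NeZero k := ⟨by omega⟩
  have hkR : (0 : ℝ) < k := by exact_mod_cast hk
  have h := integral_trace_gram_pow_le hkN hnN hmeas hL hind (modelMoment_zero k)
    (modelMoment_nonneg k) hmom
  have h2 := h.trans (mul_le_mul_of_nonneg_left sum_classProd_model_le (by positivity))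
  refine le_of_mul_le_mul_right (h2.trans (le_of_eq ?_)) (pow_pos hkR k)
  field_simp

/-- Grouping a doubly indexed independent family by its first index. -/
lemma iIndepFun_curry {Ω ι κ : Type*} [MeasurableSpace Ω] {P : Measure Ω}
    {Y : ι → κ → Ω → ℝ} (mY : ∀ i j, Measurable (Y i j))
    (h : iIndepFun (fun (a : ι × κ) ω => Y a.1 a.2 ω) P) :
    iIndepFun (fun i ω j => Y i j ω) P := by
  have := h.isProbabilityMeasure
  have h1 : ∀ a : ι × κ, IsProbabilityMeasure (P.map (Y a.1 a.2)) :=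
    fun a => Measure.isProbabilityMeasure_map (mY a.1 a.2).aemeasurable
  have h1' : ∀ i j, IsProbabilityMeasure (P.map (Y i j)) :=
    fun i j => Measure.isProbabilityMeasure_map (mY i j).aemeasurable
  rw [iIndepFun_iff_map_fun_eq_infinitePi_map (by fun_prop)] at h ⊢
  have h2 : (fun ω i j => Y i j ω)
      = (MeasurableEquiv.curry ι κ ℝ) ∘ (fun ω (a : ι × κ) => Y a.1 a.2 ω) := by
    ext; simp
  rw [h2, ← Measure.map_map (by fun_prop) (by fun_prop), h,
    Measure.infinitePi_map_curry (fun i j => P.map (Y i j))]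
  congr 1
  ext1 i
  have h3 : iIndepFun (fun j ω => Y i j ω) P := by
    have h0 : iIndepFun (fun (a : ι × κ) ω => Y a.1 a.2 ω) P := by
      rw [iIndepFun_iff_map_fun_eq_infinitePi_map (by fun_prop)]; exact h
    exact h0.precomp (g := fun j => (i, j)) (fun a b hab => by simpa using hab)
  rw [(iIndepFun_iff_map_fun_eq_infinitePi_map (by fun_prop)).1 h3]

/-! ### Independence and moments of the entries of the sparse matrix -/

section Entries

variable {Ω : Type*} [MeasurableSpace Ω] {P : Measure Ω} {N n : ℕ} {p : ℝ}
  {ξ X : Fin N → Fin n → Ω → ℝ}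

namespace IsSparseModel

lemma measurable_sparseMatrix (h : IsSparseModel P p ξ X) (j : Fin N) (k : Fin n) :
    Measurable fun ω => sparseMatrix ξ X ω j k := by
  exact (h.measurable_mask j k).mul (h.measurable_entry j k)

lemma indepFun_mask_entry (h : IsSparseModel P p ξ X) (j : Fin N) (k : Fin n) :
    IndepFun (ξ j k) (X j k) P := by
  have := h.indep.indepFun (i := Sum.inl (j, k)) (j := Sum.inr (j, k)) (by simp)
  simpa using this

/-- Mask and entry at one position are grouped as a family indexed by `Bool`, and their product is a
function of that group. -/
lemma iIndepFun_sparseMatrix (h : IsSparseModel P p ξ X) :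
    iIndepFun (fun (a : Fin N × Fin n) ω => sparseMatrix ξ X ω a.1 a.2) P := by
  let Y : Fin N × Fin n → Bool → Ω → ℝ := fun a b => cond b (ξ a.1 a.2) (X a.1 a.2)
  have hY : ∀ a b, Measurable (Y a b) := by
    rintro a (_ | _)
    · exact h.measurable_entry a.1 a.2
    · exact h.measurable_mask a.1 a.2
  have h1 : iIndepFun (fun (c : (Fin N × Fin n) × Bool) ω => Y c.1 c.2 ω) P := by
    let g : (Fin N × Fin n) × Bool → (Fin N × Fin n) ⊕ (Fin N × Fin n) :=
      fun c => cond c.2 (Sum.inl c.1) (Sum.inr c.1)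
    have hg : Function.Injective g := by
      rintro ⟨a, _ | _⟩ ⟨b, _ | _⟩ hab <;> simp_all [g]
    convert h.indep.precomp hg using 2 with c
    obtain ⟨a, _ | _⟩ := c <;> rfl
  have h2 := (iIndepFun_curry hY h1).comp (fun _ (f : Bool → ℝ) => f true * f false)
    (fun _ => by fun_prop)
  exact h2

lemma prob_nonneg (h : IsSparseModel P p ξ X) (j : Fin N) (k : Fin n) : 0 ≤ p := by
  rw [← h.mask_prob j k]; exact measureReal_nonneg

lemma prob_le_one [IsProbabilityMeasure P] (h : IsSparseModel P p ξ X) (j : Fin N) (k : Fin n) :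
    p ≤ 1 := by
  rw [← h.mask_prob j k]; exact measureReal_le_one

lemma lintegral_mask [IsFiniteMeasure P] (h : IsSparseModel P p ξ X) (j : Fin N) (k : Fin n) :
    ∫⁻ ω, ENNReal.ofReal (ξ j k ω) ∂P = ENNReal.ofReal p := by
  have hS : MeasurableSet {ω | ξ j k ω = 1} :=
    h.measurable_mask j k (measurableSet_singleton 1)
  have h1 : ∫⁻ ω, ENNReal.ofReal (ξ j k ω) ∂P
      = ∫⁻ ω, Set.indicator {ω | ξ j k ω = 1} (fun _ => 1) ω ∂P := by
    refine lintegral_congr_ae ?_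
    filter_upwards [h.mask_zero_or_one j k] with ω hω
    rcases hω with hω | hω <;> simp [Set.indicator, hω]
  rw [h1, lintegral_indicator_const hS, one_mul, ← h.mask_prob j k, measureReal_def,
    ENNReal.ofReal_toReal (measure_ne_top _ _)]

/-- The absolute moments of an entry of the sparse matrix are `p` times those of `X`. -/
lemma lintegral_abs_sparseMatrix_rpow [IsFiniteMeasure P] (h : IsSparseModel P p ξ X)
    (j : Fin N) (k : Fin n) {q : ℝ} (hq : q ≠ 0) :
    ∫⁻ ω, ENNReal.ofReal (|sparseMatrix ξ X ω j k| ^ q) ∂P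
      = ENNReal.ofReal p * ∫⁻ ω, ENNReal.ofReal (|X j k ω| ^ q) ∂P := by
  have h1 : ∫⁻ ω, ENNReal.ofReal (|sparseMatrix ξ X ω j k| ^ q) ∂P
      = ∫⁻ ω, ((fun ω => ENNReal.ofReal (ξ j k ω)) *
          (fun ω => ENNReal.ofReal (|X j k ω| ^ q))) ω ∂P := by
    refine lintegral_congr_ae ?_
    filter_upwards [h.mask_zero_or_one j k] with ω hω
    rcases hω with hω | hω <;> simp [sparseMatrix, hω, hq]
  rw [h1, lintegral_mul_eq_lintegral_mul_lintegral_of_indepFun, h.lintegral_mask]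
  · exact (h.measurable_mask j k).ennreal_ofReal
  · exact ((h.measurable_entry j k).abs.pow_const q).ennreal_ofReal
  · exact (h.indepFun_mask_entry j k).comp (φ := fun x : ℝ => ENNReal.ofReal x)
      (ψ := fun x : ℝ => ENNReal.ofReal (|x| ^ q)) (by fun_prop) (by fun_prop)

lemma integral_mask [IsFiniteMeasure P] (h : IsSparseModel P p ξ X) (j : Fin N) (k : Fin n) :
    ∫ ω, ξ j k ω ∂P = p := by
  have hp := h.prob_nonneg j k
  rw [integral_eq_lintegral_of_nonneg_ae, h.lintegral_mask, ENNReal.toReal_ofReal hp]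
  · filter_upwards [h.mask_zero_or_one j k] with ω hω
    rcases hω with hω | hω <;> simp [hω]
  · exact (h.measurable_mask j k).aestronglyMeasurable

lemma integral_sparseMatrix (h : IsSparseModel P p ξ X)
    (j : Fin N) (k : Fin n) : ∫ ω, sparseMatrix ξ X ω j k ∂P = 0 := by
  have := (h.indepFun_mask_entry j k).integral_fun_mul_eq_mul_integral
    (h.measurable_mask j k).aestronglyMeasurable (h.measurable_entry j k).aestronglyMeasurable
  simpa [sparseMatrix, h.mean_zero] using this

lemma integral_sparseMatrix_sq [IsFiniteMeasure P] (h : IsSparseModel P p ξ X)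
    (j : Fin N) (k : Fin n) : ∫ ω, sparseMatrix ξ X ω j k ^ 2 ∂P = p := by
  have h1 : ∫ ω, sparseMatrix ξ X ω j k ^ 2 ∂P = ∫ ω, ξ j k ω * (X j k ω ^ 2) ∂P := by
    refine integral_congr_ae ?_
    filter_upwards [h.mask_zero_or_one j k] with ω hω
    rcases hω with hω | hω <;> simp [sparseMatrix, hω]
  have h2 := ((h.indepFun_mask_entry j k).comp (φ := fun x : ℝ => x) (ψ := fun x : ℝ => x ^ 2)
    (by fun_prop) (by fun_prop)).integral_fun_mul_eq_mul_integral
    (h.measurable_mask j k).aestronglyMeasurable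
    ((h.measurable_entry j k).pow_const 2).aestronglyMeasurable
  rw [h1]
  simpa [Function.comp_def, h.variance_one, h.integral_mask] using h2

/-- Natural-power absolute moments from real-power ones. -/
lemma abs_moments_le [IsFiniteMeasure P] (h : IsSparseModel P p ξ X) (j : Fin N) (k : Fin n)
    {q V : ℝ} (hq : q ≠ 0) (hV : 0 ≤ V)
    (hX : ∫⁻ ω, ENNReal.ofReal (|X j k ω| ^ q) ∂P ≤ ENNReal.ofReal V) :
    Integrable (fun ω => |sparseMatrix ξ X ω j k| ^ q) P ∧
      ∫ ω, |sparseMatrix ξ X ω j k| ^ q ∂P ≤ p * V := by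
  have hp := h.prob_nonneg j k
  have hm : Measurable fun ω => |sparseMatrix ξ X ω j k| ^ q :=
    (h.measurable_sparseMatrix j k).abs.pow_const q
  have h0 : ∀ ω, 0 ≤ |sparseMatrix ξ X ω j k| ^ q := fun ω => by positivity
  have h1 : ∫⁻ ω, ENNReal.ofReal (|sparseMatrix ξ X ω j k| ^ q) ∂P ≤ ENNReal.ofReal (p * V) := by
    rw [h.lintegral_abs_sparseMatrix_rpow j k hq, ENNReal.ofReal_mul hp]
    gcongr
  have hi : Integrable (fun ω => |sparseMatrix ξ X ω j k| ^ q) P := by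
    refine ⟨hm.aestronglyMeasurable, ?_⟩
    rw [hasFiniteIntegral_iff_ofReal (ae_of_all _ h0)]
    exact h1.trans_lt ENNReal.ofReal_lt_top
  refine ⟨hi, ?_⟩
  rw [integral_eq_lintegral_of_nonneg_ae (ae_of_all _ h0) hm.aestronglyMeasurable]
  exact ENNReal.toReal_le_of_le_ofReal (by positivity) h1

lemma integrable_sparseMatrix_four [IsProbabilityMeasure P] (h : IsSparseModel P p ξ X)
    (j : Fin N) (k : Fin n) {δ μ : ℝ} (hδ : 0 < δ)
    (hX : ∫⁻ ω, ENNReal.ofReal (|X j k ω| ^ (4 + δ)) ∂P ≤ ENNReal.ofReal μ) :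
    Integrable (fun ω => sparseMatrix ξ X ω j k ^ 4) P ∧
      ∫ ω, sparseMatrix ξ X ω j k ^ 4 ∂P ≤ (1 + |μ|) * p := by
  have h4 : ∫⁻ ω, ENNReal.ofReal (|X j k ω| ^ (4 : ℝ)) ∂P ≤ ENNReal.ofReal (1 + |μ|) := by
    calc ∫⁻ ω, ENNReal.ofReal (|X j k ω| ^ (4 : ℝ)) ∂P
        ≤ ∫⁻ ω, (1 + ENNReal.ofReal (|X j k ω| ^ (4 + δ))) ∂P := by
          refine lintegral_mono fun ω => ?_
          rw [← ENNReal.ofReal_one, ← ENNReal.ofReal_add zero_le_one (by positivity)]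
          refine ENNReal.ofReal_le_ofReal ?_
          rcases le_total (|X j k ω|) 1 with hx | hx
          · have := Real.rpow_le_one (abs_nonneg (X j k ω)) hx (z := 4) (by norm_num)
            have h' : 0 ≤ |X j k ω| ^ (4 + δ) := by positivity
            linarith
          · have := Real.rpow_le_rpow_of_exponent_le hx (show (4 : ℝ) ≤ 4 + δ by linarith)
            linarith
      _ = 1 + ∫⁻ ω, ENNReal.ofReal (|X j k ω| ^ (4 + δ)) ∂P := by
          rw [lintegral_add_left measurable_const]; simp
      _ ≤ 1 + ENNReal.ofReal |μ| := by
          gcongr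
          exact hX.trans (ENNReal.ofReal_le_ofReal (le_abs_self μ))
      _ = ENNReal.ofReal (1 + |μ|) := by
          rw [ENNReal.ofReal_add zero_le_one (abs_nonneg μ), ENNReal.ofReal_one]
  obtain ⟨h5, h6⟩ := h.abs_moments_le j k (by norm_num) (by positivity) h4
  have h7 : (fun ω => |sparseMatrix ξ X ω j k| ^ (4 : ℝ))
      = fun ω => sparseMatrix ξ X ω j k ^ 4 := by
    ext ω
    rw [show (4 : ℝ) = ((4 : ℕ) : ℝ) by norm_num, Real.rpow_natCast,
      Even.pow_abs (by decide : Even 4)]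
  rw [h7] at h5 h6
  exact ⟨h5, by linarith⟩

end IsSparseModel

end Entries

/-! ### Truncated entries against the model moments -/

section Truncation

/-- Truncation at level `L`. -/
noncomputable def truncAt (L x : ℝ) : ℝ := if |x| ≤ L then x else 0

lemma measurable_truncAt (L : ℝ) : Measurable (truncAt L) :=
  Measurable.ite (measurableSet_le measurable_id.abs measurable_const) measurable_id
    measurable_const

lemma abs_truncAt_le {L : ℝ} (hL : 0 ≤ L) (x : ℝ) : |truncAt L x| ≤ L := by
  unfold truncAt; split_ifs with h
  · exact h
  · simpa using hL

lemma abs_truncAt_le_abs (L x : ℝ) : |truncAt L x| ≤ |x| := by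
  unfold truncAt; split_ifs with h <;> simp

variable {Ω : Type*} [MeasurableSpace Ω] {P : Measure Ω} [IsProbabilityMeasure P]

lemma integrable_of_abs_le {f : Ω → ℝ} (hf : Measurable f) {C : ℝ} (hC : ∀ ω, |f ω| ≤ C) :
    Integrable f P :=
  Integrable.of_bound hf.aestronglyMeasurable C (ae_of_all _ hC)

lemma integral_centered_pow_le {f : Ω → ℝ} (hf : Measurable f) {L : ℝ} (hL : ∀ ω, |f ω| ≤ L)
    {m : ℕ} (hm : 1 ≤ m) :
    |∫ ω, (f ω - ∫ x, f x ∂P) ^ m ∂P| ≤ 2 ^ m * ∫ ω, |f ω| ^ m ∂P := by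
  have hL0 : 0 ≤ L := by
    obtain ⟨ω⟩ := nonempty_of_isProbabilityMeasure P
    exact (abs_nonneg _).trans (hL ω)
  set e := ∫ x, f x ∂P
  have hfi : Integrable (fun ω => |f ω|) P := integrable_of_abs_le hf.abs (by simpa using hL)
  have hfm : Integrable (fun ω => |f ω| ^ m) P :=
    integrable_of_abs_le (hf.abs.pow_const m) (C := L ^ m) fun ω => by
      rw [abs_pow, abs_abs]; exact pow_le_pow_left₀ (abs_nonneg _) (hL ω) m
  have hJ : |e| ^ m ≤ ∫ ω, |f ω| ^ m ∂P := by
    refine (pow_le_pow_left₀ (abs_nonneg _) (abs_integral_le_integral_abs) m).trans ?_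
    exact (convexOn_pow m).map_integral_le (continuous_pow m).continuousOn isClosed_Ici
      (ae_of_all _ fun ω => abs_nonneg (f ω)) hfi hfm
  calc |∫ ω, (f ω - e) ^ m ∂P| ≤ ∫ ω, |(f ω - e) ^ m| ∂P := abs_integral_le_integral_abs
    _ ≤ ∫ ω, 2 ^ (m - 1) * (|f ω| ^ m + |e| ^ m) ∂P := by
        refine integral_mono_of_nonneg (ae_of_all _ fun ω => abs_nonneg _)
          ((hfm.add (integrable_const _)).const_mul _) (ae_of_all _ fun ω => ?_)
        simp only [abs_pow]
        exact (pow_le_pow_left₀ (abs_nonneg _) (abs_sub _ _) m).trans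
          (add_pow_le (abs_nonneg _) (abs_nonneg _) m)
    _ = 2 ^ (m - 1) * ((∫ ω, |f ω| ^ m ∂P) + |e| ^ m) := by
        rw [integral_const_mul, integral_add hfm (integrable_const _)]; simp
    _ ≤ 2 ^ (m - 1) * ((∫ ω, |f ω| ^ m ∂P) + ∫ ω, |f ω| ^ m ∂P) := by gcongr
    _ = 2 ^ m * ∫ ω, |f ω| ^ m ∂P := by
        obtain ⟨l, rfl⟩ : ∃ l, m = l + 1 := ⟨m - 1, by omega⟩
        simp only [Nat.add_sub_cancel, pow_succ]; ring

lemma integral_centered_sq_le {f : Ω → ℝ} (hf : Measurable f) {L : ℝ} (hL : ∀ ω, |f ω| ≤ L) :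
    ∫ ω, (f ω - ∫ x, f x ∂P) ^ 2 ∂P ≤ ∫ ω, f ω ^ 2 ∂P := by
  have hfi : Integrable f P := integrable_of_abs_le hf hL
  rw [← variance_eq_integral hf.aemeasurable]
  exact variance_le_expectation_sq hf.aestronglyMeasurable

/-- The moments of a centred truncated entry are dominated by those of the model law. -/
lemma moment_truncAt_le {y : Ω → ℝ} (hy : Measurable y) {N : ℕ} (hN : 1 ≤ N)
    {δ κ V D C₀ q₁ m₁ L : ℝ} {k : ℕ} (hδ : 0 < δ) (hV : 0 ≤ V) (hD : 1 ≤ D) (hC₀ : 0 < C₀)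
    (hk : 1 ≤ k) (hL : 0 < L)
    (h2i : Integrable (fun ω => y ω ^ 2) P) (h2 : ∫ ω, y ω ^ 2 ∂P ≤ 1 / N)
    (hdi : Integrable (fun ω => |y ω| ^ (4 + δ)) P)
    (hd : ∫ ω, |y ω| ^ (4 + δ) ∂P ≤ V * √D ^ (-(2 + δ)) / N)
    (hq : ∀ q : ℝ, 4 + δ ≤ q → q ≤ q₁ → Integrable (fun ω => |y ω| ^ q) P ∧
      ∫ ω, |y ω| ^ q ∂P ≤ (C₀ * q * D ^ (-κ)) ^ q * D⁻¹ / N)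
    (hkD : 64 * (1 + V) ^ 2 * k ≤ D) (hmq : m₁ ≤ q₁)
    (hm₁ : 2 * C₀ * m₁ * √k * D ^ (-κ) ≤ 1)
    (hlarge : ∀ m : ℕ, m₁ < m → 2 ^ m * L ^ (m - 2) * √k * Real.exp (2 * k) ≤ 1)
    {m : ℕ} (hm : 1 ≤ m) :
    |∫ ω, (truncAt L (y ω) - ∫ x, truncAt L (y x) ∂P) ^ m ∂P| * √k ^ m ≤
      k / N * modelMoment k m := by
  have hNR : (0 : ℝ) < N := by exact_mod_cast hN
  have hkR : (1 : ℝ) ≤ k := by exact_mod_cast hk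
  have hsk : √k ^ 2 = k := Real.sq_sqrt (by positivity)
  have hsk1 : 1 ≤ √(k : ℝ) := Real.one_le_sqrt.2 hkR
  have htm : Measurable fun ω => truncAt L (y ω) := (measurable_truncAt L).comp hy
  have htL : ∀ ω, |truncAt L (y ω)| ≤ L := fun ω => abs_truncAt_le hL.le _
  have hti : ∀ m : ℕ, Integrable (fun ω => |truncAt L (y ω)| ^ m) P := fun m =>
    integrable_of_abs_le (htm.abs.pow_const m) (C := L ^ m) fun ω => by
      rw [abs_pow, abs_abs]; exact pow_le_pow_left₀ (abs_nonneg _) (htL ω) m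
  have ht2 : ∫ ω, truncAt L (y ω) ^ 2 ∂P ≤ 1 / N := by
    refine le_trans (integral_mono_of_nonneg (ae_of_all _ fun ω => sq_nonneg _) h2i
      (ae_of_all _ fun ω => ?_)) h2
    exact sq_le_sq.2 (abs_truncAt_le_abs L _)
  -- Four regimes of `m`. For `m ≤ 2` centring and the variance are decisive, and no constant may be
  -- lost by the crude centring bound. Then come `3 ≤ m ≤ 4 + δ`, the range up to `m₁` covered by
  -- the high moment hypothesis, and the range beyond `m₁`, where only the truncation level helps.
  rcases Nat.lt_or_ge m 3 with hm3 | hm3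
  · interval_cases m
    · have hti' : Integrable (fun ω => truncAt L (y ω)) P := integrable_of_abs_le htm htL
      have : ∫ ω, (truncAt L (y ω) - ∫ x, truncAt L (y x) ∂P) ^ 1 ∂P = 0 := by
        simp only [pow_one]
        rw [integral_sub hti' (integrable_const _)]; simp
      rw [this, abs_zero, zero_mul]
      exact mul_nonneg (by positivity) (modelMoment_nonneg k 1)
    · rw [abs_of_nonneg (integral_nonneg fun ω => sq_nonneg _), hsk]
      have h3 := (integral_centered_sq_le (P := P) htm htL).trans ht2
      calc _ ≤ 1 / (N : ℝ) * k := by gcongr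
        _ = k / N * 1 := by ring
        _ ≤ _ := by gcongr; exact one_le_modelMoment k le_rfl
  have key : 2 ^ m * √k ^ m * ((∫ ω, |truncAt L (y ω)| ^ m ∂P) * N) ≤ k * modelMoment k m →
      |∫ ω, (truncAt L (y ω) - ∫ x, truncAt L (y x) ∂P) ^ m ∂P| * √k ^ m ≤
      k / N * modelMoment k m := by
    intro h
    have h1 := integral_centered_pow_le (P := P) htm htL hm
    calc _ ≤ 2 ^ m * (∫ ω, |truncAt L (y ω)| ^ m ∂P) * √k ^ m := by gcongr
      _ = 2 ^ m * √k ^ m * ((∫ ω, |truncAt L (y ω)| ^ m ∂P) * N) / N := by field_simp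
      _ ≤ k * modelMoment k m / N := by gcongr
      _ = _ := by ring
  apply key
  have hmm := one_le_modelMoment k (show 2 ≤ m by omega)
  have hks : √(k : ℝ) ^ m = k * √k ^ (m - 2) := by
    calc √(k : ℝ) ^ m = √k ^ (2 + (m - 2)) := by congr 1; omega
      _ = _ := by rw [pow_add, hsk]
  have h2m : (2 : ℝ) ^ m = 4 * 2 ^ (m - 2) := by
    rw [show (4 : ℝ) = 2 ^ 2 by norm_num, ← pow_add]; congr 1; omega
  have hD0 : 0 < D := by linarith
  rcases le_or_gt (m : ℝ) (4 + δ) with hmδ | hmδ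
  · have hsD : 0 < √D := Real.sqrt_pos.2 hD0
    -- Interpolation between the second moment and the moment of order `4 + δ`, split at the scale
    -- `|y| = 1 / √D`.
    have hpt : ∀ ω, |truncAt L (y ω)| ^ m ≤
        (√D ^ (m - 2))⁻¹ * y ω ^ 2 + (√D ^ (m - 2))⁻¹ * √D ^ (2 + δ) * |y ω| ^ (4 + δ) := by
      intro ω
      refine (pow_le_pow_left₀ (abs_nonneg _) (abs_truncAt_le_abs L (y ω)) m).trans ?_
      set x := |y ω|
      have hx : 0 ≤ x := abs_nonneg _
      have hx2 : y ω ^ 2 = x ^ 2 := (sq_abs _).symm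
      rw [hx2]
      have hxm : x ^ m = (√D ^ (m - 2))⁻¹ * x ^ 2 * (√D * x) ^ (m - 2) := by
        have : x ^ m = x ^ 2 * x ^ (m - 2) := by rw [← pow_add]; congr 1; omega
        rw [this, mul_pow]; field_simp
      have hxd : √D ^ (2 + δ) * x ^ (4 + δ) = x ^ 2 * (√D * x) ^ (2 + δ) := by
        rw [Real.mul_rpow hsD.le hx, show 4 + δ = 2 + (2 + δ) by ring,
          Real.rpow_add_of_nonneg hx (by norm_num) (by positivity)]
        norm_num; ring
      rw [hxm, mul_assoc (√D ^ (m - 2))⁻¹ (√D ^ (2 + δ)), hxd, mul_assoc, ← mul_add,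
        ← mul_one_add]
      gcongr
      rcases le_total (√D * x) 1 with h | h
      · have := pow_le_one₀ (n := m - 2) (by positivity) h
        have h' : 0 ≤ (√D * x) ^ (2 + δ) := by positivity
        linarith
      · have : (√D * x) ^ (m - 2) ≤ (√D * x) ^ (2 + δ) := by
          rw [← Real.rpow_natCast]
          refine Real.rpow_le_rpow_of_exponent_le h ?_
          rw [Nat.cast_sub (by omega)]; push_cast; linarith
        linarith
    have hint : (∫ ω, |truncAt L (y ω)| ^ m ∂P) * N ≤ (√D ^ (m - 2))⁻¹ * (1 + V) := by
      have h3 : ∫ ω, |truncAt L (y ω)| ^ m ∂P ≤ (√D ^ (m - 2))⁻¹ * (1 / N) +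
          (√D ^ (m - 2))⁻¹ * √D ^ (2 + δ) * (V * √D ^ (-(2 + δ)) / N) := by
        refine (integral_mono (hti m) ((h2i.const_mul _).add (hdi.const_mul _)) hpt).trans ?_
        simp only [Pi.add_apply]
        rw [integral_add (h2i.const_mul _) (hdi.const_mul _), integral_const_mul,
          integral_const_mul]
        gcongr
      have h4 : √D ^ (2 + δ) * √D ^ (-(2 + δ)) = 1 := by
        rw [← Real.rpow_add hsD]; simp
      calc _ ≤ ((√D ^ (m - 2))⁻¹ * (1 / N) +
          (√D ^ (m - 2))⁻¹ * √D ^ (2 + δ) * (V * √D ^ (-(2 + δ)) / N)) * N := by gcongr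
        _ = (√D ^ (m - 2))⁻¹ * (1 + V * (√D ^ (2 + δ) * √D ^ (-(2 + δ)))) := by
          field_simp
        _ = _ := by rw [h4]; ring
    have hr : 8 * (1 + V) * √k ≤ √D := by
      refine Real.le_sqrt_of_sq_le ?_
      rw [mul_pow, hsk]; linarith
    have hr1 : 2 * √k / √D ≤ 1 := by
      rw [div_le_one hsD]
      nlinarith [mul_nonneg hV (Real.sqrt_nonneg (k : ℝ))]
    calc _ ≤ 2 ^ m * √k ^ m * ((√D ^ (m - 2))⁻¹ * (1 + V)) := by gcongr
      _ = k * (4 * (1 + V) * (2 * √k / √D) ^ (m - 2)) := by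
          rw [hks, h2m, div_pow, mul_pow]; field_simp
      _ ≤ k * (4 * (1 + V) * (2 * √k / √D)) := by
          gcongr
          exact pow_le_of_le_one (by positivity) hr1 (by omega)
      _ ≤ k * 1 := by
          gcongr
          rw [mul_div_assoc', div_le_one hsD]; linarith
      _ ≤ _ := by gcongr
  rcases le_or_gt (m : ℝ) m₁ with hmm₁ | hmm₁
  · obtain ⟨hi, hle⟩ := hq m hmδ.le (hmm₁.trans hmq)
    simp only [Real.rpow_natCast] at hi hle
    have hm0 : (0 : ℝ) ≤ m := by positivity
    have hint : (∫ ω, |truncAt L (y ω)| ^ m ∂P) * N ≤ (C₀ * m * D ^ (-κ)) ^ m := by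
      have h3 : ∫ ω, |truncAt L (y ω)| ^ m ∂P ≤ (C₀ * m * D ^ (-κ)) ^ m * D⁻¹ / N := by
        refine (integral_mono (hti m) hi fun ω => ?_).trans hle
        exact pow_le_pow_left₀ (abs_nonneg _) (abs_truncAt_le_abs L (y ω)) m
      have h4 : D⁻¹ ≤ 1 := inv_le_one_of_one_le₀ hD
      calc _ ≤ (C₀ * m * D ^ (-κ)) ^ m * D⁻¹ / N * N := by gcongr
        _ = (C₀ * m * D ^ (-κ)) ^ m * D⁻¹ := by field_simp
        _ ≤ (C₀ * m * D ^ (-κ)) ^ m * 1 := by gcongr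
        _ = _ := mul_one _
    have hb : 2 * √k * (C₀ * m * D ^ (-κ)) ≤ 1 := by
      refine le_trans ?_ hm₁
      have : 0 ≤ D ^ (-κ) := by positivity
      calc 2 * √k * (C₀ * m * D ^ (-κ)) = 2 * C₀ * m * √k * D ^ (-κ) := by ring
        _ ≤ _ := by gcongr
    calc _ ≤ 2 ^ m * √k ^ m * (C₀ * m * D ^ (-κ)) ^ m := by gcongr
      _ = (2 * √k * (C₀ * m * D ^ (-κ))) ^ m := by rw [mul_pow (2 * √k), mul_pow 2]
      _ ≤ 1 := pow_le_one₀ (by positivity) hb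
      _ ≤ _ := by nlinarith
  · have hlg := hlarge m hmm₁
    have hint : (∫ ω, |truncAt L (y ω)| ^ m ∂P) * N ≤ L ^ (m - 2) := by
      have h3 : ∫ ω, |truncAt L (y ω)| ^ m ∂P ≤ L ^ (m - 2) * (1 / N) := by
        calc _ ≤ ∫ ω, L ^ (m - 2) * truncAt L (y ω) ^ 2 ∂P := by
              -- Truncation trades `m - 2` powers for `L ^ (m - 2)` and keeps the variance. The
              -- result is compared with the jump part of the model.
              refine integral_mono (hti m) (((hti 2).congr
                (ae_of_all _ fun ω => by simp [sq_abs])).const_mul _) fun ω => ?_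
              have : |truncAt L (y ω)| ^ m
                  = |truncAt L (y ω)| ^ (m - 2) * truncAt L (y ω) ^ 2 := by
                rw [← sq_abs (truncAt L (y ω)), ← pow_add]; congr 1; omega
              simp only [this]
              gcongr
              exact htL ω
          _ ≤ _ := by rw [integral_const_mul]; gcongr
      calc _ ≤ L ^ (m - 2) * (1 / N) * N := by gcongr
        _ = _ := by field_simp
    have h5 := exp_mul_pow_le_modelMoment hk hm3
    have h6 : √(k : ℝ) ^ (m - 2) = √k * √k ^ (m - 3) := by
      rw [← pow_succ']; congr 1; omega
    have h7 : 2 ^ m * L ^ (m - 2) * √k ≤ Real.exp (-(2 * k)) := by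
      rw [Real.exp_neg, ← one_div, le_div_iff₀ (Real.exp_pos _)]; exact hlg
    calc _ ≤ 2 ^ m * √k ^ m * L ^ (m - 2) := by gcongr
      _ = k * ((2 ^ m * L ^ (m - 2) * √k) * √k ^ (m - 3)) := by rw [hks, h6]; ring
      _ ≤ k * (Real.exp (-(2 * k)) * √k ^ (m - 3)) := by gcongr
      _ ≤ _ := by gcongr

end Truncation

lemma dotProduct_add_self_le {ι : Type*} [Fintype ι] {u v : ι → ℝ} {a b : ℝ} (ha : 0 ≤ a)
    (hb : 0 ≤ b) (hu : u ⬝ᵥ u ≤ a ^ 2) (hv : v ⬝ᵥ v ≤ b ^ 2) :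
    (u + v) ⬝ᵥ (u + v) ≤ (a + b) ^ 2 := by
  have hcs : (u ⬝ᵥ v) ^ 2 ≤ (u ⬝ᵥ u) * (v ⬝ᵥ v) := by
    have := Finset.sum_mul_sq_le_sq_mul_sq Finset.univ u v
    simpa [dotProduct, sq] using this
  have h0 : 0 ≤ v ⬝ᵥ v := dotProduct_self_nonneg' v
  have huv : u ⬝ᵥ v ≤ a * b := by
    refine abs_le_of_sq_le_sq' ?_ (by positivity) |>.2
    rw [mul_pow]
    exact hcs.trans (mul_le_mul hu hv h0 (by positivity))
  rw [add_dotProduct, dotProduct_add, dotProduct_add, dotProduct_comm v u]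
  nlinarith

lemma mulVec_dotProduct_self_le_of_abs_le {N n : ℕ} {M : Matrix (Fin N) (Fin n) ℝ} {ε : ℝ}
    (hM : ∀ j k, |M j k| ≤ ε) {x : Fin n → ℝ} (hx : x ⬝ᵥ x = 1) :
    (M *ᵥ x) ⬝ᵥ (M *ᵥ x) ≤ N * n * ε ^ 2 := by
  have h1 : ∀ j, (M *ᵥ x) j * (M *ᵥ x) j ≤ n * ε ^ 2 := fun j => by
    have := Finset.sum_mul_sq_le_sq_mul_sq Finset.univ (M j) x
    have hx' : ∑ i, x i ^ 2 = 1 := by rw [← hx]; simp [dotProduct, sq]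
    rw [hx', mul_one] at this
    rw [← sq]
    refine this.trans ((Finset.sum_le_sum fun k _ => (sq_abs (M j k)).symm.le.trans
      (pow_le_pow_left₀ (abs_nonneg _) (hM j k) 2)).trans ?_)
    simp
  calc (M *ᵥ x) ⬝ᵥ (M *ᵥ x) ≤ ∑ _j : Fin N, n * ε ^ 2 := Finset.sum_le_sum fun j _ => h1 j
    _ = _ := by simp; ring

/-! ### Upper tail of the operator norm -/

section OpNorm

variable {Ω : Type*} [MeasurableSpace Ω] {P : Measure Ω} [IsProbabilityMeasure P]

/-- As `y` has mean zero, the truncated mean is minus the mean over `|y| > L`, where `|y| ≤ y ^ 4 /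
L ^ 3`. -/
lemma abs_integral_truncAt_le {y : Ω → ℝ} (hy : Measurable y) {L W : ℝ} (hL : 0 < L)
    (hyi : Integrable y P) (h0 : ∫ ω, y ω ∂P = 0) (h4i : Integrable (fun ω => y ω ^ 4) P)
    (h4 : ∫ ω, y ω ^ 4 ∂P ≤ W) : |∫ ω, truncAt L (y ω) ∂P| ≤ W / L ^ 3 := by
  have hti : Integrable (fun ω => truncAt L (y ω)) P :=
    integrable_of_abs_le ((measurable_truncAt L).comp hy) fun ω => abs_truncAt_le hL.le _
  have h1 : ∫ ω, truncAt L (y ω) ∂P = ∫ ω, (truncAt L (y ω) - y ω) ∂P := by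
    rw [integral_sub hti hyi, h0, sub_zero]
  rw [h1]
  refine abs_integral_le_integral_abs.trans ?_
  calc ∫ ω, |truncAt L (y ω) - y ω| ∂P ≤ ∫ ω, y ω ^ 4 / L ^ 3 ∂P := by
        refine integral_mono (hti.sub hyi).abs (h4i.div_const _) fun ω => ?_
        simp only [truncAt]
        split_ifs with h
        · simp; positivity
        · rw [not_le] at h
          rw [zero_sub, abs_neg, le_div_iff₀ (by positivity), ← Even.pow_abs (by decide : Even 4),
            pow_succ' _ 3]
          gcongr
    _ ≤ W / L ^ 3 := by rw [integral_div]; gcongr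

variable {N n : ℕ} {p δ μ B C₀ c : ℝ} {ξ X : Fin N → Fin n → Ω → ℝ}

/-- Tail bound for the operator norm of the sparse matrix under explicit numerical conditions. -/
theorem measureReal_opNorm_le (h : SparseAssumptions P δ μ B C₀ c p ξ X) (hδ : 0 < δ)
    (hC₀ : 0 < C₀) (hn : 1 ≤ n) (hnN : n ≤ N) {k : ℕ} (hk : 1 ≤ k) (hkN : k ≤ N)
    {q₁ m₁ L : ℝ} (hL : 0 < L) (hD : 1 ≤ N * p)
    (hkD : 64 * (1 + |μ|) ^ 2 * k ≤ N * p) (hDL : (1 + |μ|) ≤ N * p * L ^ 3)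
    (hq₁ : 4 + δ ≤ q₁) (hq₁' : q₁ ≤ c * Real.log n) (hmq : m₁ ≤ q₁)
    (hm₁ : 2 * C₀ * m₁ * √k * (N * p) ^ (-varkappa δ) ≤ 1)
    (hlarge : ∀ m : ℕ, m₁ < m → 2 ^ m * L ^ (m - 2) * √k * Real.exp (2 * k) ≤ 1) :
    P.real {ω | ¬ ∀ x : Fin n → ℝ, x ⬝ᵥ x = 1 →
      (sparseMatrix ξ X ω *ᵥ x) ⬝ᵥ (sparseMatrix ξ X ω *ᵥ x) ≤ 1001 ^ 2 * (N * p)} ≤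
      N * (C₀ * q₁ * (N * p) ^ (-varkappa δ) / L) ^ q₁ + 4 * N * Real.exp (-k) := by
  set D : ℝ := N * p with hDdef
  have hN : 1 ≤ N := hn.trans hnN
  have hNR : (0 : ℝ) < N := by exact_mod_cast hN
  have hD0 : 0 < D := by linarith
  have hsD : 0 < √D := Real.sqrt_pos.2 hD0
  have hsD2 : √D ^ 2 = D := Real.sq_sqrt hD0.le
  have hpD : p = D / N := by rw [hDdef]; field_simp
  have hM := h.toIsSparseModel
  set κ := varkappa δ
  let y : Fin N → Fin n → Ω → ℝ := fun j l ω => sparseMatrix ξ X ω j l / √D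
  have hym : ∀ j l, Measurable (y j l) := fun j l => (hM.measurable_sparseMatrix j l).div_const _
  have hyabs : ∀ (q : ℝ) j l, (fun ω => |y j l ω| ^ q)
      = fun ω => |sparseMatrix ξ X ω j l| ^ q * √D ^ (-q) := fun q j l => by
    ext ω
    simp only [y]
    rw [abs_div, abs_of_pos hsD, Real.div_rpow (abs_nonneg _) hsD.le, Real.rpow_neg hsD.le]
    rfl
  have hq : ∀ j l, ∀ q : ℝ, 4 + δ ≤ q → q ≤ q₁ → Integrable (fun ω => |y j l ω| ^ q) P ∧
      ∫ ω, |y j l ω| ^ q ∂P ≤ (C₀ * q * D ^ (-κ)) ^ q * D⁻¹ / N := by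
    intro j l q h1 h2
    have hq0 : 0 < q := by linarith
    have hmq := h.moment_q q h1 (h2.trans hq₁') j l
    rw [← hDdef] at hmq
    obtain ⟨h3, h4⟩ := hM.abs_moments_le j l hq0.ne' (by positivity) hmq
    rw [hyabs]
    refine ⟨h3.mul_const _, ?_⟩
    rw [integral_mul_const]
    refine (mul_le_mul_of_nonneg_right h4 (by positivity)).trans (le_of_eq ?_)
    have e1 : √D ^ (-q) = D ^ (-(q / 2)) := by
      rw [Real.sqrt_eq_rpow, ← Real.rpow_mul hD0.le]; congr 1; ring
    have e2 : (D ^ (-κ)) ^ q = D ^ (-(κ * q)) := by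
      rw [← Real.rpow_mul hD0.le]; congr 1; ring
    have e3 : D ^ (q * (1 / 2 - κ) - 2) * D ^ (-(q / 2)) * D = D ^ (-(κ * q)) * D⁻¹ := by
      rw [← Real.rpow_neg_one D, ← Real.rpow_add hD0, ← Real.rpow_add hD0]
      nth_rewrite 2 [← Real.rpow_one D]
      rw [← Real.rpow_add hD0]
      congr 1; ring
    rw [Real.mul_rpow (x := C₀ * q) (by positivity) (by positivity), Real.mul_rpow hC₀.le hq0.le, e1, e2]
    calc p * (C₀ ^ q * q ^ q * D ^ (q * (1 / 2 - κ) - 2)) * D ^ (-(q / 2))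
        = C₀ ^ q * q ^ q * (D ^ (q * (1 / 2 - κ) - 2) * D ^ (-(q / 2)) * D) / N := by
          rw [hpD]; ring
      _ = _ := by rw [e3]; ring
  have hd : ∀ j l, Integrable (fun ω => |y j l ω| ^ (4 + δ)) P ∧
      ∫ ω, |y j l ω| ^ (4 + δ) ∂P ≤ |μ| * √D ^ (-(2 + δ)) / N := by
    intro j l
    obtain ⟨h3, h4⟩ := hM.abs_moments_le j l (by positivity) (abs_nonneg μ)
      ((h.moment_delta j l).trans (ENNReal.ofReal_le_ofReal (le_abs_self μ)))
    rw [hyabs]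
    refine ⟨h3.mul_const _, ?_⟩
    rw [integral_mul_const]
    refine (mul_le_mul_of_nonneg_right h4 (by positivity)).trans (le_of_eq ?_)
    have e1 : √D ^ (-(4 + δ)) = √D ^ (-(2 + δ)) / D := by
      rw [show -(4 + δ) = -(2 + δ) - 2 by ring, Real.rpow_sub hsD]
      norm_num [hsD2]
    rw [e1, hpD]; field_simp
  have ha4 := fun j l => hM.integrable_sparseMatrix_four j l hδ (h.moment_delta j l)
  have h4 : ∀ j l, Integrable (fun ω => y j l ω ^ 4) P ∧
      ∫ ω, y j l ω ^ 4 ∂P ≤ (1 + |μ|) / (N * D) := by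
    intro j l
    simp only [y, div_pow]
    refine ⟨(ha4 j l).1.div_const _, ?_⟩
    rw [integral_div, div_le_iff₀ (by positivity)]
    refine (ha4 j l).2.trans (le_of_eq ?_)
    rw [show (4 : ℕ) = 2 * 2 by rfl, pow_mul, hsD2, hpD]; field_simp
  have hbd : ∀ (j : Fin N) (l : Fin n) (i : ℕ), i ≤ 4 → Integrable (fun ω => y j l ω ^ i) P := by
    intro j l i hi
    refine Integrable.mono' ((integrable_const (1 : ℝ)).add (h4 j l).1)
      ((hym j l).pow_const i).aestronglyMeasurable (ae_of_all _ fun ω => ?_)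
    simp only [Pi.add_apply, Real.norm_eq_abs, abs_pow]
    rw [← Even.pow_abs (by decide : Even 4)]
    rcases le_total |y j l ω| 1 with h1 | h1
    · have := pow_le_one₀ (n := i) (abs_nonneg _) h1
      have h' : 0 ≤ |y j l ω| ^ 4 := by positivity
      linarith
    · have := pow_le_pow_right₀ h1 hi
      linarith
  have h2 : ∀ j l, ∫ ω, y j l ω ^ 2 ∂P ≤ 1 / N := by
    intro j l
    simp only [y, div_pow, hsD2]
    rw [integral_div, hM.integral_sparseMatrix_sq, hpD]
    exact le_of_eq (by field_simp)
  have h1 : ∀ j l, ∫ ω, y j l ω ∂P = 0 := by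
    intro j l
    simp only [y]
    rw [integral_div, hM.integral_sparseMatrix, zero_div]
  let e : Fin N → Fin n → ℝ := fun j l => ∫ ω, truncAt L (y j l ω) ∂P
  let z : Fin N → Fin n → Ω → ℝ := fun j l ω => truncAt L (y j l ω) - e j l
  -- Entries of size `1 / N` form a matrix of norm at most one, which accounts for `1001 = 1000 +
  -- 1`.
  have he : ∀ j l, |e j l| ≤ 1 / N := by
    intro j l
    refine (abs_integral_truncAt_le (hym j l) hL (by simpa using hbd j l 1 (by norm_num)) (h1 j l)
      (h4 j l).1 (h4 j l).2).trans ?_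
    rw [div_div, div_le_div_iff₀ (by positivity) hNR]
    nlinarith
  have hzm : ∀ j l, Measurable (z j l) := fun j l =>
    ((measurable_truncAt L).comp (hym j l)).sub_const _
  have hzb : ∀ j l ω, |z j l ω| ≤ L + 1 := by
    intro j l ω
    refine (abs_sub _ _).trans (add_le_add (abs_truncAt_le hL.le _) ((he j l).trans ?_))
    rw [div_le_one hNR]; exact_mod_cast hN
  have hind : iIndepFun (fun ab : Fin N × Fin n => z ab.1 ab.2) P :=
    hM.iIndepFun_sparseMatrix.comp
      (fun ab x => truncAt L (x / √D) - e ab.1 ab.2)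
      (fun ab => ((measurable_truncAt L).comp (measurable_id.div_const _)).sub_const _)
  have htr := integral_trace_gram_pow_le_of_moments hk hkN hnN hzm hzb hind
    (fun j l m hm1 hm2 => moment_truncAt_le (hym j l) hN hδ (abs_nonneg μ) hD hC₀ hk hL
      (hbd j l 2 (by norm_num)) (h2 j l) (hd j l).1 (hd j l).2 (hq j l) hkD hmq hm₁ hlarge hm1)
  set Z : Ω → Matrix (Fin N) (Fin n) ℝ := fun ω => Matrix.of fun a b => z a b ω
  set T : Ω → ℝ := fun ω => (((Z ω)ᵀ * Z ω) ^ k).trace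
  have hT0 : ∀ ω, 0 ≤ T ω := by
    intro ω
    obtain ⟨l⟩ : Nonempty (Fin n) := ⟨⟨0, hn⟩⟩
    refine le_trans ?_ (norm_sq_mulVec_pow_le_trace (Z ω) (x := Pi.single l 1) (by simp) k)
    exact pow_nonneg (dotProduct_self_nonneg' _) k
  have hTm : Measurable T := by
    have hZm : Measurable (fun ω a b => z a b ω) :=
      measurable_pi_iff.2 fun a => measurable_pi_iff.2 fun b => hzm a b
    have hc : Continuous fun A : Fin N → Fin n → ℝ =>
        (((Matrix.of A)ᵀ * Matrix.of A) ^ k).trace := by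
      have : Continuous fun A : Matrix (Fin N) (Fin n) ℝ => ((Aᵀ * A) ^ k).trace := by fun_prop
      exact this
    exact hc.measurable.comp hZm
  have hTi : Integrable T P := by
    have hb : ∀ (i : ℕ) (a b : Fin n), ∃ C, ∀ ω, |(((Z ω)ᵀ * Z ω) ^ i) a b| ≤ C := by
      intro i
      induction i with
      | zero => intro a b; exact ⟨|(1 : Matrix (Fin n) (Fin n) ℝ) a b|, fun ω => by simp⟩
      | succ i ih =>
        intro a b
        choose C hC using ih
        refine ⟨∑ x, C a x * ∑ _j : Fin N, (L + 1) * (L + 1), fun ω => ?_⟩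
        rw [pow_succ, Matrix.mul_apply]
        refine (Finset.abs_sum_le_sum_abs _ _).trans (Finset.sum_le_sum fun x _ => ?_)
        rw [abs_mul, Matrix.mul_apply]
        refine mul_le_mul (hC a x ω) ((Finset.abs_sum_le_sum_abs _ _).trans
          (Finset.sum_le_sum fun j _ => ?_)) (abs_nonneg _) ((abs_nonneg _).trans (hC a x ω))
        rw [abs_mul]
        exact mul_le_mul (hzb _ _ ω) (hzb _ _ ω) (abs_nonneg _) (by positivity)
    choose C hC using hb k
    refine integrable_of_abs_le hTm (C := ∑ a, C a a) fun ω => ?_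
    exact (Finset.abs_sum_le_sum_abs _ _).trans (Finset.sum_le_sum fun a _ => hC a a ω)
  -- The threshold `10 ^ 6 = 1000²` exceeds `40000 e² · e`, so each of the `k` factors gains `1 / e`
  -- in Markov's inequality.
  have hmark : P.real {ω | ((10 : ℝ) ^ 6) ^ k ≤ T ω} ≤ 4 * N * Real.exp (-k) := by
    have := mul_meas_ge_le_integral_of_nonneg (ae_of_all P hT0) hTi (((10 : ℝ) ^ 6) ^ k)
    have h10 : 40000 * Real.exp 2 * Real.exp 1 ≤ 10 ^ 6 := by
      rw [mul_assoc, ← Real.exp_add, show (2 : ℝ) + 1 = ((3 : ℕ) : ℝ) * 1 by norm_num,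
        Real.exp_nat_mul]
      have := Real.exp_one_lt_d9
      have h3 : Real.exp 1 ^ 3 ≤ 2.7182818286 ^ 3 := pow_le_pow_left₀ (Real.exp_pos _).le this.le 3
      norm_num at h3 ⊢; linarith
    have hle : (40000 * Real.exp 2) ^ k ≤ ((10 : ℝ) ^ 6) ^ k * Real.exp (-k) := by
      rw [Real.exp_neg, ← div_eq_mul_inv, le_div_iff₀ (Real.exp_pos _)]
      rw [show (k : ℝ) = k * 1 by ring, Real.exp_nat_mul, ← mul_pow]
      exact pow_le_pow_left₀ (by positivity) h10 k
    have h5 : ((10 : ℝ) ^ 6) ^ k * P.real {ω | ((10 : ℝ) ^ 6) ^ k ≤ T ω} ≤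
        ((10 : ℝ) ^ 6) ^ k * (4 * N * Real.exp (-k)) := by
      refine this.trans (htr.trans ?_)
      calc _ ≤ 4 * N * (((10 : ℝ) ^ 6) ^ k * Real.exp (-k)) := by gcongr
        _ = _ := by ring
    exact le_of_mul_le_mul_left h5 (by positivity)
  have hbig : ∀ j l, P.real {ω | L < |y j l ω|} ≤
      (C₀ * q₁ * D ^ (-κ) / L) ^ q₁ / N := by
    intro j l
    obtain ⟨hi, hle⟩ := hq j l q₁ hq₁ le_rfl
    have hq0 : 0 < q₁ := by linarith
    have := mul_meas_ge_le_integral_of_nonneg (ae_of_all P fun ω => by positivity) hi (L ^ q₁)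
    have hsub : P.real {ω | L < |y j l ω|} ≤ P.real {ω | L ^ q₁ ≤ |y j l ω| ^ q₁} :=
      measureReal_mono (fun ω hω => Real.rpow_le_rpow hL.le (le_of_lt hω) hq0.le)
    have h6 : L ^ q₁ * P.real {ω | L < |y j l ω|} ≤ (C₀ * q₁ * D ^ (-κ)) ^ q₁ * D⁻¹ / N :=
      (mul_le_mul_of_nonneg_left hsub (by positivity)).trans (this.trans hle)
    rw [Real.div_rpow (by positivity) hL.le, div_div, le_div_iff₀ (by positivity)]
    have h7 : D⁻¹ ≤ 1 := inv_le_one_of_one_le₀ hD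
    have h8 : 0 ≤ (C₀ * q₁ * D ^ (-κ)) ^ q₁ := by positivity
    rw [le_div_iff₀ hNR] at h6
    nlinarith
  -- If no entry exceeds the truncation level, the matrix equals `√D (Z + e)` exactly.
  have hincl : {ω | ¬ ∀ x : Fin n → ℝ, x ⬝ᵥ x = 1 →
      (sparseMatrix ξ X ω *ᵥ x) ⬝ᵥ (sparseMatrix ξ X ω *ᵥ x) ≤ 1001 ^ 2 * D} ⊆
      (⋃ a : Fin N × Fin n, {ω | L < |y a.1 a.2 ω|}) ∪ {ω | ((10 : ℝ) ^ 6) ^ k ≤ T ω} := by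
    intro ω hω
    by_contra hcon
    simp only [Set.mem_union, Set.mem_iUnion, Set.mem_ofPred_eq, not_or, not_exists, not_lt,
      not_le] at hcon
    obtain ⟨hy1, hT⟩ := hcon
    refine hω fun x hx => ?_
    have hdec : sparseMatrix ξ X ω *ᵥ x = √D • (Z ω *ᵥ x + (Matrix.of e) *ᵥ x) := by
      rw [← Matrix.add_mulVec, ← Matrix.smul_mulVec]
      congr 1
      ext j l
      have : truncAt L (y j l ω) = y j l ω := if_pos (hy1 (j, l))
      simp only [Matrix.smul_apply, Matrix.add_apply, Matrix.of_apply, smul_eq_mul, Z, z, this]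
      simp only [y]
      field_simp; ring
    have hZx : (Z ω *ᵥ x) ⬝ᵥ (Z ω *ᵥ x) ≤ 1000 ^ 2 := by
      have h9 := (norm_sq_mulVec_pow_le_trace (Z ω) hx k).trans hT.le
      have h10 := le_of_pow_le_pow_left₀ (by omega) (by norm_num) h9
      norm_num at h10 ⊢; exact h10
    have hex : (Matrix.of e *ᵥ x) ⬝ᵥ (Matrix.of e *ᵥ x) ≤ 1 ^ 2 := by
      refine (mulVec_dotProduct_self_le_of_abs_le (M := Matrix.of e) he hx).trans ?_
      have : (n : ℝ) ≤ N := by exact_mod_cast hnN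
      rw [div_pow, mul_div_assoc', div_le_iff₀ (by positivity)]
      nlinarith
    have := dotProduct_add_self_le (by norm_num) (by norm_num) hZx hex
    rw [hdec, smul_dotProduct, dotProduct_smul, smul_eq_mul, smul_eq_mul, ← mul_assoc, ← sq, hsD2,
      mul_comm]
    gcongr
    norm_num at this ⊢; exact this
  refine (measureReal_mono hincl).trans ((measureReal_union_le _ _).trans ?_)
  gcongr
  refine (measureReal_iUnion_fintype_le _).trans
    ((Finset.sum_le_sum fun a _ => hbig a.1 a.2).trans ?_)
  rw [Finset.sum_const, Finset.card_univ, Fintype.card_prod, Fintype.card_fin, Fintype.card_fin,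
    nsmul_eq_mul]
  push_cast
  have hq0 : 0 ≤ q₁ := by linarith
  have : (n : ℝ) ≤ N := by exact_mod_cast hnN
  have h8 : 0 ≤ (C₀ * q₁ * D ^ (-κ) / L) ^ q₁ := by positivity
  calc (N : ℝ) * n * ((C₀ * q₁ * D ^ (-κ) / L) ^ q₁ / N)
      = n * (C₀ * q₁ * D ^ (-κ) / L) ^ q₁ := by field_simp
    _ ≤ _ := by gcongr

end OpNorm

/-! ### Choice of the parameters and the bound for the largest singular value -/

lemma varkappa_pos {δ : ℝ} (hδ : 0 < δ) : 0 < varkappa δ := by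
  unfold varkappa; positivity

lemma three_le_sparsity_exponent {δ : ℝ} (hδ : 0 < δ) : 3 ≤ 3 / (2 * varkappa δ) := by
  have hκ := varkappa_pos hδ
  rw [le_div_iff₀ (by positivity)]
  have : 2 * varkappa δ ≤ 1 := by
    unfold varkappa
    rw [mul_div_assoc', div_le_one (by positivity)]; linarith
  linarith

lemma mul_log_pow_three_le {δ B ℓ D : ℝ} (hδ : 0 < δ) (hB : 0 < B) (hℓ : 1 ≤ ℓ)
    (h : B * ℓ ^ (3 / (2 * varkappa δ)) ≤ D) : B * ℓ ^ 3 ≤ D := by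
  refine le_trans ?_ h
  gcongr
  rw [← Real.rpow_natCast]
  exact Real.rpow_le_rpow_of_exponent_le hℓ (by simpa using three_le_sparsity_exponent hδ)

/-- The exponent `3 / (2ϰ)` is made for this: it turns `D ^ (-ϰ)` into `ℓ ^ (-3/2)`, which
compensates a moment order of size `ℓ` multiplied by `√k` of size `√ℓ`. -/
lemma rpow_neg_varkappa_le {δ B ℓ D : ℝ} (hδ : 0 < δ) (hB : 0 < B) (hℓ : 0 < ℓ)
    (h : B * ℓ ^ (3 / (2 * varkappa δ)) ≤ D) :
    D ^ (-varkappa δ) ≤ B ^ (-varkappa δ) / (ℓ * √ℓ) := by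
  have hκ := varkappa_pos hδ
  have h1 : D ^ (-varkappa δ) ≤ (B * ℓ ^ (3 / (2 * varkappa δ))) ^ (-varkappa δ) :=
    Real.rpow_le_rpow_of_nonpos (by positivity) h (by linarith)
  refine h1.trans (le_of_eq ?_)
  rw [Real.mul_rpow hB.le (by positivity), ← Real.rpow_mul hℓ.le, div_eq_mul_inv (B ^ _)]
  congr 1
  rw [show 3 / (2 * varkappa δ) * -varkappa δ = -(1 + 1 / 2) by field_simp; norm_num,
    Real.rpow_neg hℓ.le, Real.rpow_add hℓ, Real.rpow_one, Real.sqrt_eq_rpow]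

lemma tendsto_log_natCast : Tendsto (fun N : ℕ => Real.log N) atTop atTop :=
  Real.tendsto_log_atTop.comp tendsto_natCast_atTop_atTop

lemma eventually_mul_log_le (A : ℝ) : ∀ᶠ N : ℕ in atTop, A * Real.log N ≤ N := by
  have h1 := (Real.isLittleO_log_id_atTop.bound (c := 1 / (|A| + 1)) (by positivity))
  have h2 := tendsto_natCast_atTop_atTop (R := ℝ) |>.eventually h1
  filter_upwards [h2, eventually_ge_atTop 1] with N hN h1N
  have h1R : (1 : ℝ) ≤ N := by exact_mod_cast h1N
  have hl : 0 ≤ Real.log N := Real.log_nonneg h1R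
  simp only [id, Real.norm_eq_abs, Nat.abs_cast, abs_of_nonneg hl] at hN
  rw [div_mul_eq_mul_div, le_div_iff₀ (by positivity)] at hN
  nlinarith [le_abs_self A]

lemma eventually_half_le_ratio {n : ℕ → ℕ} {y₀ : ℝ} (hy : 0 < y₀)
    (hn : Tendsto (fun N : ℕ => (n N : ℝ) / (N : ℝ)) atTop (𝓝 y₀)) :
    ∀ᶠ N : ℕ in atTop, y₀ / 2 * N ≤ n N := by
  filter_upwards [hn.eventually (lt_mem_nhds (show y₀ / 2 < y₀ by linarith)),
    eventually_ge_atTop 1] with N h1 h2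
  have h1R : (0 : ℝ) < N := by exact_mod_cast h2
  exact ((lt_div_iff₀ h1R).1 h1).le


set_option maxHeartbeats 1000000 in
/-- The operator norm of the sparse matrix is at most `1001 √(N p)` up to a superpolynomially small
probability. -/
theorem eventually_opNorm_le {δ μ B C₀ c y₀ : ℝ} (hδ : 0 < δ) (hB : 0 < B) (hC₀ : 0 < C₀)
    (hc : 0 < c) (hy₀ : 0 < y₀) {n : ℕ → ℕ}
    (hn : Tendsto (fun N : ℕ => (n N : ℝ) / (N : ℝ)) atTop (𝓝 y₀)) {Q : ℝ} (hQ : 0 ≤ Q) :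
    ∀ᶠ N : ℕ in atTop, 1 ≤ n N → n N < N →
      ∀ (p : ℝ) (Ω : Type u) [MeasurableSpace Ω] (P : Measure Ω) [IsProbabilityMeasure P]
        (ξ X : Fin N → Fin (n N) → Ω → ℝ), SparseAssumptions P δ μ B C₀ c p ξ X →
        P.real {ω | ¬ ∀ x : Fin (n N) → ℝ, x ⬝ᵥ x = 1 →
          (sparseMatrix ξ X ω *ᵥ x) ⬝ᵥ (sparseMatrix ξ X ω *ᵥ x) ≤ 1001 ^ 2 * (N * p)} ≤
          (N : ℝ) ^ (-Q) := by
  set A : ℝ := Q + 4 with hAdef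
  have hA : 4 ≤ A := by linarith
  set b : ℝ := B ^ (-varkappa δ) with hbdef
  have hb : 0 < b := Real.rpow_pos_of_pos hB _
  -- The second entry makes `2 C₀ m₁ √k D ^ (-ϰ) ≤ 1` for `m₁ = c' ℓ`, with `k ≤ A ℓ`.
  set c' : ℝ := min (c / 2) (1 / (2 * C₀ * √A * b))
  have hsA : 0 < √A := Real.sqrt_pos.2 (by linarith)
  have hc' : 0 < c' := lt_min (by positivity) (by positivity)
  have hc'1 : c' ≤ c / 2 := min_le_left _ _
  have hc'2 : 2 * C₀ * c' * √A * b ≤ 1 := by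
    have := min_le_right (c / 2) (1 / (2 * C₀ * √A * b))
    rw [le_div_iff₀ (by positivity)] at this
    calc _ = c' * (2 * C₀ * √A * b) := by ring
      _ ≤ 1 := this
  -- With `2 L = exp (-G)`, orders `m > c' ℓ` give `G m ≥ 6 A ℓ`. Half of it pays for `√k * exp (2k)
  -- ≤ exp (3k)`, the other half for the constants `2 + 2 G`.
  set G : ℝ := 6 * A / c' with hGdef
  have hG : 0 < G := by positivity
  set L : ℝ := Real.exp (-G) / 2 with hLdef
  have hL : 0 < L := by positivity
  -- Chosen so that `exp (-H)` raised to the power `q₁ = (c / 2) ℓ` is `N ^ (-(Q + 2))`.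
  set H : ℝ := 2 * (Q + 2) / c with hHdef
  clear_value H L G c' b A
  have hev := tendsto_log_natCast.eventually_ge_atTop
  filter_upwards [hev 1, hev (1 / B), hev (64 * (1 + |μ|) ^ 2 * A / B),
    hev ((1 + |μ|) / (B * L ^ 3)), hev (2 * (4 + δ) / c), hev (2 * Real.log (2 / y₀)),
    hev ((2 + 2 * G) / (3 * A)), hev (2 / c'),
    hev ((C₀ * (c / 2) * b / L * Real.exp H) ^ 2),
    eventually_mul_log_le A, eventually_half_le_ratio hy₀ hn, eventually_ge_atTop 5] with
    N l1 l2 l3 l4 l5 l6 l7 l8 l9 hAN hyN hN5 hn1 hnN p Ω _ P _ ξ X h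
  set ℓ := Real.log N with hℓdef
  have hℓ : 0 < ℓ := by linarith
  have hN5R : (5 : ℝ) ≤ N := by exact_mod_cast hN5
  have hN0 : (0 : ℝ) < N := by linarith
  set D : ℝ := N * p with hDdef
  have hD3 := mul_log_pow_three_le hδ hB l1 h.sparsity
  have hDκ := rpow_neg_varkappa_le hδ hB hℓ h.sparsity
  rw [← hDdef] at hD3 hDκ
  rw [← hbdef] at hDκ
  have hDℓ2 : B * ℓ * ℓ ≤ D := by
    refine le_trans ?_ hD3
    rw [mul_assoc, ← sq]
    exact mul_le_mul_of_nonneg_left (pow_le_pow_right₀ l1 (by norm_num)) hB.le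
  have hDℓ : B * ℓ ≤ D := by
    refine le_trans ?_ hDℓ2
    exact le_mul_of_one_le_right (by positivity) l1
  have hD0 : 0 ≤ D := le_trans (by positivity) hDℓ
  have hDκ0 : 0 ≤ D ^ (-varkappa δ) := Real.rpow_nonneg hD0 _
  clear_value D
  rw [div_le_iff₀ hB] at l2 l3
  rw [div_le_iff₀ (by positivity)] at l4 l5 l7 l8
  set k : ℕ := ⌈(Q + 3) * ℓ⌉₊
  have hkA : (k : ℝ) ≤ A * ℓ := by
    have := (Nat.ceil_lt_add_one (show 0 ≤ (Q + 3) * ℓ by positivity)).le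
    refine this.trans ?_
    rw [hAdef, show (Q + 4) * ℓ = (Q + 3) * ℓ + ℓ by ring]
    linarith
  have hkQ : (Q + 3) * ℓ ≤ k := Nat.le_ceil _
  have hk0 : (0 : ℝ) < k := lt_of_lt_of_le (by positivity) hkQ
  have hk : 1 ≤ k := by exact_mod_cast hk0
  clear_value k ℓ
  have hsk : √(k : ℝ) ≤ √A * √ℓ := by
    rw [← Real.sqrt_mul (by linarith)]; exact Real.sqrt_le_sqrt hkA
  have hsℓ : 0 < √ℓ := Real.sqrt_pos.2 hℓ
  have hsℓ2 : √ℓ ^ 2 = ℓ := Real.sq_sqrt hℓ.le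
  -- The moment hypothesis reaches up to `c log n`. Since `n` is comparable to `N`, the order `(c /
  -- 2) ℓ` is admissible.
  have hlogn : ℓ / 2 ≤ Real.log (n N) := by
    have h1 : Real.log (y₀ / 2 * N) ≤ Real.log (n N) := Real.log_le_log (by positivity) hyN
    rw [Real.log_mul (by positivity) hN0.ne', ← inv_div, Real.log_inv] at h1
    linarith
  have hmain := measureReal_opNorm_le h hδ hC₀ hn1 hnN.le hk
    (by exact_mod_cast hkA.trans hAN) (q₁ := c / 2 * ℓ) (m₁ := c' * ℓ) hL
    (by rw [← hDdef]; linarith) (by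
      rw [← hDdef]
      calc 64 * (1 + |μ|) ^ 2 * (k : ℝ) ≤ 64 * (1 + |μ|) ^ 2 * (A * ℓ) := by gcongr
        _ = 64 * (1 + |μ|) ^ 2 * A * ℓ := by ring
        _ ≤ ℓ * B * ℓ := by gcongr
        _ = B * ℓ * ℓ := by ring
        _ ≤ D := hDℓ2)
    (by
      rw [← hDdef]
      calc 1 + |μ| ≤ ℓ * (B * L ^ 3) := l4
        _ = B * ℓ * L ^ 3 := by ring
        _ ≤ D * L ^ 3 := by gcongr)
    (by linarith)
    (by
      calc c / 2 * ℓ = c * (ℓ / 2) := by ring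
        _ ≤ c * Real.log (n N) := by gcongr)
    (by gcongr)
    (by
      rw [← hDdef]
      calc 2 * C₀ * (c' * ℓ) * √k * D ^ (-varkappa δ)
          ≤ 2 * C₀ * (c' * ℓ) * (√A * √ℓ) * (b / (ℓ * √ℓ)) := by gcongr
        _ = 2 * C₀ * c' * √A * b := by field_simp
        _ ≤ 1 := hc'2)
    (by
      intro m hm
      have hm2 : 2 ≤ m := by
        have : (2 : ℝ) < m := by linarith
        exact_mod_cast this.le
      have h2m : (2 : ℝ) ^ m = 4 * 2 ^ (m - 2) := by
        rw [show (4 : ℝ) = 2 ^ 2 by norm_num, ← pow_add]; congr 1; omega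
      have e1 : (2 : ℝ) ^ m * L ^ (m - 2) = 4 * Real.exp (-(G * (m - 2))) := by
        rw [h2m, mul_assoc, ← mul_pow, show 2 * L = Real.exp (-G) by rw [hLdef]; ring,
          ← Real.exp_nat_mul, Nat.cast_sub hm2]
        congr 2; push_cast; ring
      have e2 : (4 : ℝ) ≤ Real.exp 2 := by
        rw [show (2 : ℝ) = (2 : ℕ) * 1 by norm_num, Real.exp_nat_mul]
        have := pow_le_pow_left₀ zero_le_two (Real.exp_one_gt_d9.le.trans' (by norm_num)) 2
        norm_num at this ⊢
        exact this
      have e3 : √(k : ℝ) ≤ Real.exp k := by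
        have h1 : √(k : ℝ) ≤ k := Real.sqrt_le_iff.2 ⟨hk0.le, by
          have : (1 : ℝ) ≤ k := by exact_mod_cast hk
          exact le_self_pow₀ this two_ne_zero⟩
        linarith [Real.add_one_le_exp (k : ℝ)]
      calc _ = 4 * Real.exp (-(G * (m - 2))) * √k * Real.exp (2 * k) := by rw [e1]
        _ ≤ Real.exp 2 * Real.exp (-(G * (m - 2))) * Real.exp k * Real.exp (2 * k) := by gcongr
        _ = Real.exp (2 + 3 * k - G * (m - 2)) := by
          rw [← Real.exp_add, ← Real.exp_add, ← Real.exp_add]; congr 1; ring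
        _ ≤ Real.exp 0 := by
          refine Real.exp_le_exp.2 ?_
          have h1 : G * (c' * ℓ) ≤ G * m := by gcongr
          have h2 : G * (c' * ℓ) = 6 * (A * ℓ) := by rw [hGdef]; field_simp
          have h3 : ℓ * (3 * A) = 3 * (A * ℓ) := by ring
          linarith
        _ = 1 := Real.exp_zero)
  rw [hDdef]
  refine hmain.trans ?_
  rw [← hDdef]
  have hbase : C₀ * (c / 2 * ℓ) * D ^ (-varkappa δ) / L ≤ Real.exp (-H) := by
    have h1 : C₀ * (c / 2) * b / L * Real.exp H ≤ √ℓ := Real.le_sqrt_of_sq_le l9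
    calc C₀ * (c / 2 * ℓ) * D ^ (-varkappa δ) / L
        ≤ C₀ * (c / 2 * ℓ) * (b / (ℓ * √ℓ)) / L := by gcongr
      _ = (C₀ * (c / 2) * b / L * Real.exp H) * Real.exp (-H) / √ℓ := by
          rw [Real.exp_neg]; field_simp
      _ ≤ √ℓ * Real.exp (-H) / √ℓ := by gcongr
      _ = Real.exp (-H) := by field_simp
  have hNexp : ∀ t : ℝ, (N : ℝ) ^ t = Real.exp (ℓ * t) := fun t => by
    rw [hℓdef]; exact Real.rpow_def_of_pos hN0 t
  have t1 : (C₀ * (c / 2 * ℓ) * D ^ (-varkappa δ) / L) ^ (c / 2 * ℓ) ≤ (N : ℝ) ^ (-(Q + 2)) := by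
    calc _ ≤ Real.exp (-H) ^ (c / 2 * ℓ) :=
          Real.rpow_le_rpow (by positivity) hbase (by positivity)
      _ = (N : ℝ) ^ (-(Q + 2)) := by
          rw [← Real.exp_mul, hNexp]; congr 1; rw [hHdef]; field_simp
  have t2 : Real.exp (-k) ≤ (N : ℝ) ^ (-(Q + 3)) := by
    rw [hNexp]; exact Real.exp_le_exp.2 (by linarith)
  have r1 : (N : ℝ) * (N : ℝ) ^ (-(Q + 2)) = (N : ℝ) ^ (-Q) * (1 / N) := by
    rw [show -(Q + 2) = -Q - 2 by ring, Real.rpow_sub hN0]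
    norm_num; field_simp
  have r2 : (N : ℝ) * (N : ℝ) ^ (-(Q + 3)) = (N : ℝ) ^ (-Q) * (1 / N ^ 2) := by
    rw [show -(Q + 3) = -Q - 3 by ring, Real.rpow_sub hN0]
    norm_num; field_simp
  have r3 : (1 : ℝ) / N + 4 * (1 / N ^ 2) ≤ 1 := by
    rw [div_add' _ _ _ hN0.ne', div_le_one hN0]
    have : 4 * (1 / (N : ℝ) ^ 2) * N ≤ 1 := by
      rw [show 4 * (1 / (N : ℝ) ^ 2) * N = 4 / N by field_simp, div_le_one hN0]; linarith
    linarith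
  calc _ ≤ (N : ℝ) * (N : ℝ) ^ (-(Q + 2)) + 4 * N * (N : ℝ) ^ (-(Q + 3)) := by gcongr
    _ = (N : ℝ) ^ (-Q) * (1 / N + 4 * (1 / N ^ 2)) := by
        rw [mul_assoc 4, r1, r2]; ring
    _ ≤ (N : ℝ) ^ (-Q) * 1 := by gcongr
    _ = _ := mul_one _

/-- A bound for large `N` gives a bound with a constant for all `N`. -/
lemma exists_const_of_eventually {Q : ℝ} {f : ℕ → ℝ → Prop} (hQ : 0 ≤ Q)
    (h : ∀ᶠ N : ℕ in atTop, ∀ x, f N x → x ≤ (N : ℝ) ^ (-Q)) :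
    ∃ C : ℝ, 0 < C ∧ ∀ N : ℕ, 1 ≤ N → ∀ x, x ≤ 1 → f N x → x ≤ C * (N : ℝ) ^ (-Q) := by
  obtain ⟨N₀, hN₀⟩ := eventually_atTop.1 h
  have hM : (1 : ℝ) ≤ (N₀ + 1 : ℝ) ^ Q := Real.one_le_rpow (by linarith [N₀.cast_nonneg (α := ℝ)]) hQ
  refine ⟨(N₀ + 1 : ℝ) ^ Q, by linarith, fun N hN x hx hf => ?_⟩
  have hN0 : (0 : ℝ) < N := by exact_mod_cast hN
  rcases le_total N₀ N with h1 | h1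
  · refine (hN₀ N h1 x hf).trans ?_
    exact le_mul_of_one_le_left (by positivity) hM
  · refine hx.trans ?_
    rw [Real.rpow_neg hN0.le, ← div_eq_mul_inv, one_le_div (by positivity)]
    refine Real.rpow_le_rpow hN0.le ?_ hQ
    have : (N : ℝ) ≤ N₀ := by exact_mod_cast h1
    linarith

theorem exists_const_singVal_one {δ μ : ℝ} (hδ : 0 < δ) {Q : ℝ} (hQ : 1 ≤ Q)
    {B C₀ c y₀ : ℝ} (hB : 0 < B) (hC₀ : 0 < C₀) (hc : 0 < c) (hy₀ : 0 < y₀)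
    {n : ℕ → ℕ} (hn : Tendsto (fun N : ℕ => (n N : ℝ) / (N : ℝ)) atTop (𝓝 y₀)) :
    ∃ C : ℝ, 0 < C ∧ ∀ N : ℕ, 1 ≤ n N → n N < N →
      ∀ (p : ℝ) (Ω : Type u) [MeasurableSpace Ω] (P : Measure Ω) [IsProbabilityMeasure P]
        (ξ X : Fin N → Fin (n N) → Ω → ℝ), SparseAssumptions P δ μ B C₀ c p ξ X →
        P.real {ω | 1002 * √(N * p) ≤ singVal (sparseMatrix ξ X ω) 1} ≤ C * (N : ℝ) ^ (-Q) := by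
  obtain ⟨C, hC, h⟩ := exists_const_of_eventually (Q := Q)
    -- The probability space and the variables are quantified inside `f`, so the constant covering
    -- the finitely many small `N` is uniform over all models.
    (f := fun N x => 1 ≤ n N ∧ n N < N ∧ ∃ (p : ℝ) (Ω : Type u) (_ : MeasurableSpace Ω)
      (P : Measure Ω) (_ : IsProbabilityMeasure P) (ξ X : Fin N → Fin (n N) → Ω → ℝ),
      SparseAssumptions P δ μ B C₀ c p ξ X ∧
      x = P.real {ω | 1002 * √(N * p) ≤ singVal (sparseMatrix ξ X ω) 1}) (by linarith) (by
    filter_upwards [eventually_opNorm_le (μ := μ) hδ hB hC₀ hc hy₀ hn (show 0 ≤ Q by linarith),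
      tendsto_log_natCast.eventually_ge_atTop 1] with N hN l1 x
    rintro ⟨h1, h2, p, Ω, _, P, _, ξ, X, hA, rfl⟩
    refine le_trans (measureReal_mono ?_) (hN h1 h2 p Ω P ξ X hA)
    intro ω hω hcon
    obtain ⟨x, hx, hxs⟩ := exists_unit_singVal (sparseMatrix ξ X ω) le_rfl h1
    have hD : 0 < N * p := lt_of_lt_of_le (by positivity)
      (mul_log_pow_three_le hδ hB l1 hA.sparsity)
    have hle := hcon x hx
    rw [hxs] at hle
    have h3 : (1002 * √(N * p)) ^ 2 ≤ singVal (sparseMatrix ξ X ω) 1 ^ 2 :=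
      pow_le_pow_left₀ (by positivity) hω 2
    rw [mul_pow, Real.sq_sqrt hD.le] at h3
    nlinarith)
  refine ⟨C, hC, fun N h1 h2 p Ω _ P _ ξ X hA => h N (by omega) _ measureReal_le_one
    ⟨h1, h2, p, Ω, _, P, inferInstance, ξ, X, hA, rfl⟩⟩

/-! ### Powers of inverses of positive definite matrices -/

section Resolvent

variable {n : Type*} [Fintype n] [DecidableEq n]

/-- `S` is symmetric and its quadratic form is at least `z |x|²`. -/
def FormGE (z : ℝ) (S : Matrix n n ℝ) : Prop :=
  S.IsHermitian ∧ ∀ x, z * (x ⬝ᵥ x) ≤ x ⬝ᵥ (S *ᵥ x)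

lemma FormGE.exists_spectral {z : ℝ} {S : Matrix n n ℝ} (h : FormGE z S) :
    ∃ (U : Matrix n n ℝ) (d : n → ℝ), Uᵀ * U = 1 ∧ U * Uᵀ = 1 ∧ S = conjDiag U d ∧
      ∀ i, z ≤ d i := by
  obtain ⟨U, d, hU, hU', hS⟩ := h.1.exists_conjDiag
  refine ⟨U, d, hU, hU', hS, fun i => ?_⟩
  have := h.2 (fun a => U a i)
  rwa [hS, dotProduct_conjDiag_col hU, dotProduct_col_self hU, mul_one] at this

/-- The spectral form of the powers of the inverse. -/
lemma FormGE.exists_spectral_inv {z : ℝ} (hz : 0 < z) {S : Matrix n n ℝ} (h : FormGE z S) :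
    ∃ (U : Matrix n n ℝ) (d : n → ℝ), Uᵀ * U = 1 ∧ U * Uᵀ = 1 ∧ S = conjDiag U d ∧
      (∀ i, z ≤ d i) ∧ ∀ k : ℕ, S⁻¹ ^ k = conjDiag U (fun i => (d i)⁻¹ ^ k) := by
  obtain ⟨U, d, hU, hU', hS, hd⟩ := h.exists_spectral
  refine ⟨U, d, hU, hU', hS, hd, fun k => ?_⟩
  rw [hS, conjDiag_inv hU hU' (fun i => (hz.trans_le (hd i)).ne'), conjDiag_pow hU hU']

lemma FormGE.inv_mul {z : ℝ} (hz : 0 < z) {S : Matrix n n ℝ} (h : FormGE z S) : S⁻¹ * S = 1 := by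
  obtain ⟨U, d, hU, hU', hS, hd⟩ := h.exists_spectral
  have h0 : ∀ i, d i ≠ 0 := fun i => (hz.trans_le (hd i)).ne'
  rw [hS, conjDiag_inv hU hU' h0, conjDiag_mul hU]
  simp only [inv_mul_cancel₀ (h0 _)]
  simpa using conjDiag_const hU' 1

lemma FormGE.mul_inv {z : ℝ} (hz : 0 < z) {S : Matrix n n ℝ} (h : FormGE z S) : S * S⁻¹ = 1 :=
  mul_eq_one_comm.1 (h.inv_mul hz)

lemma FormGE.transpose_inv_pow {z : ℝ} {S : Matrix n n ℝ} (h : FormGE z S) (k : ℕ) :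
    (S⁻¹ ^ k)ᵀ = S⁻¹ ^ k := by
  have h1 : Sᵀ = S := by simpa [Matrix.IsHermitian] using h.1
  rw [Matrix.transpose_pow, Matrix.transpose_nonsing_inv, h1]

lemma FormGE.dotProduct_inv_pow_comm {z : ℝ} {S : Matrix n n ℝ} (h : FormGE z S) (k : ℕ)
    (x y : n → ℝ) : x ⬝ᵥ (S⁻¹ ^ k *ᵥ y) = (S⁻¹ ^ k *ᵥ x) ⬝ᵥ y := by
  rw [Matrix.dotProduct_mulVec, ← Matrix.mulVec_transpose, h.transpose_inv_pow]

lemma FormGE.inv_pow_nonneg {z : ℝ} (hz : 0 < z) {S : Matrix n n ℝ} (h : FormGE z S) (k : ℕ)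
    (x : n → ℝ) : 0 ≤ x ⬝ᵥ (S⁻¹ ^ k *ᵥ x) := by
  obtain ⟨U, d, hU, hU', hS, hd, hk⟩ := h.exists_spectral_inv hz
  rw [hk, dotProduct_conjDiag_mulVec]
  exact Finset.sum_nonneg fun i _ => mul_nonneg
    (pow_nonneg (inv_nonneg.2 (hz.le.trans (hd i))) k) (sq_nonneg _)

lemma FormGE.inv_pow_succ_le {z : ℝ} (hz : 0 < z) {S : Matrix n n ℝ} (h : FormGE z S) (k : ℕ)
    (x : n → ℝ) : x ⬝ᵥ (S⁻¹ ^ (k + 1) *ᵥ x) ≤ z⁻¹ * (x ⬝ᵥ (S⁻¹ ^ k *ᵥ x)) := by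
  obtain ⟨U, d, hU, hU', hS, hd, hk⟩ := h.exists_spectral_inv hz
  rw [hk, hk, dotProduct_conjDiag_mulVec, dotProduct_conjDiag_mulVec, Finset.mul_sum]
  refine Finset.sum_le_sum fun i _ => ?_
  have h1 : (d i)⁻¹ ≤ z⁻¹ := inv_anti₀ hz (hd i)
  have h2 : 0 ≤ (d i)⁻¹ := inv_nonneg.2 (hz.le.trans (hd i))
  rw [pow_succ', mul_assoc]
  exact mul_le_mul_of_nonneg_right h1 (by positivity)

lemma FormGE.trace_inv_pow_nonneg {z : ℝ} (hz : 0 < z) {S : Matrix n n ℝ} (h : FormGE z S)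
    (k : ℕ) : 0 ≤ (S⁻¹ ^ k).trace := by
  obtain ⟨U, d, hU, hU', hS, hd, hk⟩ := h.exists_spectral_inv hz
  rw [hk, trace_conjDiag hU]
  exact Finset.sum_nonneg fun i _ => pow_nonneg (inv_nonneg.2 (hz.le.trans (hd i))) k

lemma FormGE.trace_inv_pow_le {z : ℝ} (hz : 0 < z) {S : Matrix n n ℝ} (h : FormGE z S)
    (k : ℕ) : (S⁻¹ ^ k).trace ≤ Fintype.card n * z⁻¹ ^ k := by
  obtain ⟨U, d, hU, hU', hS, hd, hk⟩ := h.exists_spectral_inv hz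
  rw [hk, trace_conjDiag hU]
  refine (Finset.sum_le_sum fun i _ => pow_le_pow_left₀ (inv_nonneg.2 (hz.le.trans (hd i)))
    (inv_anti₀ hz (hd i)) k).trans (le_of_eq ?_)
  simp

/-- The moments `x ⬝ S⁻ᵃ x` are log-convex. -/
lemma FormGE.inv_pow_mul_inv_pow_le {z : ℝ} (hz : 0 < z) {S : Matrix n n ℝ} (h : FormGE z S)
    (a b : ℕ) (x : n → ℝ) :
    (x ⬝ᵥ (S⁻¹ ^ (a + 1) *ᵥ x)) * (x ⬝ᵥ (S⁻¹ ^ (b + 1) *ᵥ x)) ≤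
      (x ⬝ᵥ (S⁻¹ ^ 1 *ᵥ x)) * (x ⬝ᵥ (S⁻¹ ^ (a + b + 1) *ᵥ x)) := by
  obtain ⟨U, d, hU, hU', hS, hd, hk⟩ := h.exists_spectral_inv hz
  simp only [hk, dotProduct_conjDiag_mulVec, Finset.sum_mul_sum]
  set e : n → ℝ := fun i => (d i)⁻¹
  set w : n → ℝ := fun i => (Uᵀ *ᵥ x) i ^ 2
  have he : ∀ i, 0 ≤ e i := fun i => inv_nonneg.2 (hz.le.trans (hd i))
  have hw : ∀ i, 0 ≤ w i := fun i => sq_nonneg _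
  have hsym : ∀ f : n → n → ℝ, 2 * ∑ i, ∑ j, f i j = ∑ i, ∑ j, (f i j + f j i) := fun f => by
    simp only [Finset.sum_add_distrib]
    rw [Finset.sum_comm (f := fun i j => f j i), two_mul]
  have key : 2 * ∑ i, ∑ j, e i ^ (a + 1) * w i * (e j ^ (b + 1) * w j) ≤
      2 * ∑ i, ∑ j, e i ^ 1 * w i * (e j ^ (a + b + 1) * w j) := by
    rw [hsym, hsym]
    refine Finset.sum_le_sum fun i _ => Finset.sum_le_sum fun j _ => ?_
    -- Chebyshev's sum inequality after symmetrization: both powers are monotone in the eigenvalue.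
    have h1 : 0 ≤ (e i ^ a - e j ^ a) * (e i ^ b - e j ^ b) := by
      rcases le_total (e i) (e j) with hij | hij
      · exact mul_nonneg_of_nonpos_of_nonpos (sub_nonpos.2 (pow_le_pow_left₀ (he i) hij a))
          (sub_nonpos.2 (pow_le_pow_left₀ (he i) hij b))
      · exact mul_nonneg (sub_nonneg.2 (pow_le_pow_left₀ (he j) hij a))
          (sub_nonneg.2 (pow_le_pow_left₀ (he j) hij b))
    have h2 : 0 ≤ w i * w j * (e i * e j) *
        ((e i ^ a - e j ^ a) * (e i ^ b - e j ^ b)) :=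
      mul_nonneg (mul_nonneg (mul_nonneg (hw i) (hw j)) (mul_nonneg (he i) (he j))) h1
    have h3 : e i ^ 1 * w i * (e j ^ (a + b + 1) * w j) + e j ^ 1 * w j * (e i ^ (a + b + 1) * w i)
        - (e i ^ (a + 1) * w i * (e j ^ (b + 1) * w j) + e j ^ (a + 1) * w j *
          (e i ^ (b + 1) * w i)) = w i * w j * (e i * e j) *
        ((e i ^ a - e j ^ a) * (e i ^ b - e j ^ b)) := by
      simp only [pow_succ, pow_add, pow_zero]; ring
    linarith
  linarith

/-- Expanding `(v - w) ⬝ S₀ (v - w) ≥ 0` with `v = S⁻¹ r` and `w = S₀⁻¹ r` gives the claim, once `v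
⬝ S₀ v ≤ v ⬝ S v = v ⬝ r` is inserted. -/
lemma FormGE.dotProduct_inv_le_of_le {z : ℝ} (hz : 0 < z) {S S₀ : Matrix n n ℝ} (h : FormGE z S)
    (h₀ : FormGE z S₀) (hle : ∀ x, x ⬝ᵥ (S₀ *ᵥ x) ≤ x ⬝ᵥ (S *ᵥ x)) (r : n → ℝ) :
    r ⬝ᵥ (S⁻¹ *ᵥ r) ≤ r ⬝ᵥ (S₀⁻¹ *ᵥ r) := by
  set v := S⁻¹ *ᵥ r
  set w := S₀⁻¹ *ᵥ r
  have hv : S *ᵥ v = r := by simp [v, Matrix.mulVec_mulVec, h.mul_inv hz]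
  have hw : S₀ *ᵥ w = r := by simp [w, Matrix.mulVec_mulVec, h₀.mul_inv hz]
  have h1 := hle v
  have h2 : 0 ≤ (v - w) ⬝ᵥ (S₀ *ᵥ (v - w)) :=
    le_trans (mul_nonneg hz.le (dotProduct_self_nonneg' _)) (h₀.2 (v - w))
  have h3 : w ⬝ᵥ (S₀ *ᵥ v) = r ⬝ᵥ v := by
    have hT : S₀ᵀ = S₀ := by simpa [Matrix.IsHermitian] using h₀.1
    rw [Matrix.dotProduct_mulVec, ← Matrix.mulVec_transpose, hT, hw]
  rw [Matrix.mulVec_sub, hw, sub_dotProduct, dotProduct_sub, dotProduct_sub, h3,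
    dotProduct_comm v r, dotProduct_comm w r] at h2
  rw [hv, dotProduct_comm v r] at h1
  linarith

/-- Tangent-line lower bound for the trace of a power of the inverse. -/
lemma FormGE.tangent_trace_inv_pow {z : ℝ} (hz : 0 < z) {S : Matrix n n ℝ} (h : FormGE z S)
    (m : ℕ) {x : ℝ} (hx : 0 < x) :
    (m + 1) * x * (S⁻¹ ^ m).trace - Fintype.card n * x ^ (m + 1) ≤
      m * (S⁻¹ ^ (m + 1)).trace := by
  obtain ⟨U, d, hU, hU', hS, hd, hk⟩ := h.exists_spectral_inv hz
  rw [hk, hk, trace_conjDiag hU, trace_conjDiag hU, Finset.mul_sum, Finset.mul_sum,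
    ← nsmul_eq_mul, ← Finset.card_univ, ← Finset.sum_const, ← Finset.sum_sub_distrib]
  refine Finset.sum_le_sum fun i _ => ?_
  have he : 0 < (d i)⁻¹ := inv_pos.2 (hz.trans_le (hd i))
  set e := (d i)⁻¹
  -- The scalar inequality is the tangent line of `x ^ (m + 1)` at `e`, that is, Bernoulli's
  -- inequality for `x / e`.
  have hb := one_add_mul_le_pow (a := x / e - 1) (by
    have : 0 < x / e := by positivity
    linarith) (m + 1)
  rw [add_sub_cancel, div_pow, le_div_iff₀ (by positivity)] at hb
  push_cast at hb
  have : (1 + ((m : ℝ) + 1) * (x / e - 1)) * e ^ (m + 1) = (m + 1) * x * e ^ m - m * e ^ (m + 1) := by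
    rw [pow_succ]; field_simp; ring
  linarith

/-! ### Rank-one updates -/

section RankOne

variable {S : Matrix n n ℝ} {z : ℝ} {r : n → ℝ}

lemma FormGE.add_vecMulVec (h : FormGE z S) (r : n → ℝ) :
    FormGE z (S + Matrix.vecMulVec r r) := by
  refine ⟨h.1.add ?_, fun x => ?_⟩
  · ext i j; simp [Matrix.vecMulVec_apply, mul_comm]
  · rw [Matrix.add_mulVec, dotProduct_add, Matrix.vecMulVec_mulVec]
    have : x ⬝ᵥ (MulOpposite.op (r ⬝ᵥ x) • r) = (r ⬝ᵥ x) ^ 2 := by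
      rw [op_smul_eq_smul, dotProduct_smul, smul_eq_mul, dotProduct_comm x r, sq]
    rw [this]
    linarith [h.2 x, sq_nonneg (r ⬝ᵥ x)]

/-- The resolvent identity for a rank-one update. -/
lemma FormGE.inv_mulVec_eq (hz : 0 < z) (h : FormGE z S) (r y : n → ℝ) :
    S⁻¹ *ᵥ y = (S + Matrix.vecMulVec r r)⁻¹ *ᵥ y +
      (r ⬝ᵥ ((S + Matrix.vecMulVec r r)⁻¹ *ᵥ y)) • (S⁻¹ *ᵥ r) := by
  have h' := h.add_vecMulVec r
  set S' := S + Matrix.vecMulVec r r with hS'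
  set v := S'⁻¹ *ᵥ y
  have hv : S *ᵥ v + (r ⬝ᵥ v) • r = y := by
    have h1 : S' *ᵥ v = y := by simp [v, Matrix.mulVec_mulVec, h'.mul_inv hz]
    rw [hS', Matrix.add_mulVec, Matrix.vecMulVec_mulVec, op_smul_eq_smul] at h1
    exact h1
  calc S⁻¹ *ᵥ y = S⁻¹ *ᵥ (S *ᵥ v + (r ⬝ᵥ v) • r) := by rw [hv]
    _ = _ := by
      rw [Matrix.mulVec_add, Matrix.mulVec_mulVec, h.inv_mul hz, Matrix.one_mulVec,
        Matrix.mulVec_smul]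

/-- Iterates the resolvent identity, exchanging one factor `S⁻¹` at a time for an updated inverse.
-/
lemma FormGE.inv_pow_mulVec_eq_sum (hz : 0 < z) (h : FormGE z S) (r : n → ℝ) (k : ℕ) :
    S⁻¹ ^ k *ᵥ r = (S + Matrix.vecMulVec r r)⁻¹ ^ k *ᵥ r +
      ∑ i ∈ Finset.range k, (r ⬝ᵥ ((S + Matrix.vecMulVec r r)⁻¹ ^ (k - i) *ᵥ r)) •
        (S⁻¹ ^ (i + 1) *ᵥ r) := by
  set S' := S + Matrix.vecMulVec r r
  induction k with
  | zero => simp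
  | succ k ih =>
    have h1 : S⁻¹ ^ (k + 1) *ᵥ r = S⁻¹ *ᵥ (S⁻¹ ^ k *ᵥ r) := by
      rw [pow_succ', Matrix.mulVec_mulVec]
    have hI : S⁻¹ *ᵥ (S'⁻¹ ^ k *ᵥ r) = S'⁻¹ *ᵥ (S'⁻¹ ^ k *ᵥ r) +
        (r ⬝ᵥ (S'⁻¹ *ᵥ (S'⁻¹ ^ k *ᵥ r))) • (S⁻¹ *ᵥ r) := h.inv_mulVec_eq hz r _
    rw [h1, ih, Matrix.mulVec_add, hI, Finset.sum_range_succ',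
      Matrix.mulVec_sum]
    simp only [Matrix.mulVec_smul, Matrix.mulVec_mulVec, ← pow_succ', Nat.reduceSubDiff,
      Nat.sub_zero, zero_add, pow_one]
    rw [add_assoc, add_comm (_ • (S⁻¹ *ᵥ r))]

/-- The quadratic form of powers of the inverse after a rank-one update. -/
lemma FormGE.inv_pow_eq_sum (hz : 0 < z) (h : FormGE z S) (r : n → ℝ) (k : ℕ) :
    r ⬝ᵥ (S⁻¹ ^ k *ᵥ r) = r ⬝ᵥ ((S + Matrix.vecMulVec r r)⁻¹ ^ k *ᵥ r) +
      ∑ i ∈ Finset.range k, (r ⬝ᵥ ((S + Matrix.vecMulVec r r)⁻¹ ^ (k - i) *ᵥ r)) *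
        (r ⬝ᵥ (S⁻¹ ^ (i + 1) *ᵥ r)) := by
  conv_lhs => rw [h.inv_pow_mulVec_eq_sum hz r k]
  rw [dotProduct_add, dotProduct_sum]
  simp only [dotProduct_smul, smul_eq_mul]

lemma FormGE.update_inv_pow_le (hz : 0 < z) (h : FormGE z S) (r : n → ℝ) (k : ℕ) :
    r ⬝ᵥ ((S + Matrix.vecMulVec r r)⁻¹ ^ k *ᵥ r) ≤ r ⬝ᵥ (S⁻¹ ^ k *ᵥ r) := by
  rw [h.inv_pow_eq_sum hz r k]
  have := Finset.sum_nonneg fun i (_ : i ∈ Finset.range k) =>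
    mul_nonneg ((h.add_vecMulVec r).inv_pow_nonneg hz (k - i) r) (h.inv_pow_nonneg hz (i + 1) r)
  linarith

/-- In the expansion of `μ = r ⬝ S^{-(k+1)} r` the term with the first power of `S⁻¹` is `s μ'`,
where `s = r ⬝ S⁻¹ r` and `μ'` is the updated quantity. By monotonicity and log-convexity each of
the other `k` terms is at most `s μ`. Hence `μ ≤ (1 + s) μ' + k s μ ≤ (3/2) μ' + μ / 2`. -/
lemma FormGE.third_le_update_inv_pow (hz : 0 < z) (h : FormGE z S) {r : n → ℝ} {k : ℕ}
    (hs : (k + 1) * (r ⬝ᵥ (S⁻¹ *ᵥ r)) ≤ 1 / 2) :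
    (r ⬝ᵥ (S⁻¹ ^ (k + 1) *ᵥ r)) / 3 ≤
      r ⬝ᵥ ((S + Matrix.vecMulVec r r)⁻¹ ^ (k + 1) *ᵥ r) := by
  have h1 := h.inv_pow_eq_sum hz r (k + 1)
  rw [Finset.sum_range_succ'] at h1
  set s := r ⬝ᵥ (S⁻¹ *ᵥ r)
  have hs0 : 0 ≤ s := by simpa using h.inv_pow_nonneg hz 1 r
  have hμ := h.inv_pow_nonneg hz (k + 1) r
  set μ := r ⬝ᵥ (S⁻¹ ^ (k + 1) *ᵥ r)
  have h2 : ∑ i ∈ Finset.range k, (r ⬝ᵥ ((S + Matrix.vecMulVec r r)⁻¹ ^ (k + 1 - (i + 1)) *ᵥ r)) *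
      (r ⬝ᵥ (S⁻¹ ^ (i + 1 + 1) *ᵥ r)) ≤ k * (s * μ) := by
    refine (Finset.sum_le_sum (g := fun _ => s * μ) fun i hi => ?_).trans (by simp)
    have hi' : i < k := Finset.mem_range.1 hi
    obtain ⟨l, rfl⟩ : ∃ l, k = i + 1 + l := ⟨k - (i + 1), by omega⟩
    have e : i + 1 + l + 1 - (i + 1) = l + 1 := by omega
    rw [e]
    refine (mul_le_mul_of_nonneg_right (h.update_inv_pow_le hz r (l + 1))
      (h.inv_pow_nonneg hz _ r)).trans ?_
    refine (h.inv_pow_mul_inv_pow_le hz l (i + 1) r).trans (le_of_eq ?_)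
    simp only [pow_one, s, μ]
    rw [show l + (i + 1) + 1 = i + 1 + l + 1 by omega]
  simp only [Nat.sub_zero, zero_add, pow_one] at h1
  change μ = _ + (_ + _ * s) at h1
  set μ' := r ⬝ᵥ ((S + Matrix.vecMulVec r r)⁻¹ ^ (k + 1) *ᵥ r)
  have hks : (k : ℝ) * s ≤ 1 / 2 := by nlinarith
  have hk0 : (0 : ℝ) ≤ k := by positivity
  have hs2 : s ≤ 1 / 2 := by nlinarith
  have h3 : k * (s * μ) ≤ 1 / 2 * μ := by rw [← mul_assoc]; gcongr
  have hμ' : 0 ≤ μ' := (h.add_vecMulVec r).inv_pow_nonneg hz (k + 1) r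
  nlinarith

/-- Sherman–Morrison in the direction of the update. -/
lemma FormGE.update_inv_mulVec (hz : 0 < z) (h : FormGE z S) (r : n → ℝ) :
    S⁻¹ *ᵥ r = (1 + r ⬝ᵥ (S⁻¹ *ᵥ r)) • ((S + Matrix.vecMulVec r r)⁻¹ *ᵥ r) := by
  have h1 := h.inv_mulVec_eq hz r r
  have h2 := congrArg (fun v => r ⬝ᵥ v) h1
  simp only [dotProduct_add, dotProduct_smul, smul_eq_mul] at h2
  set s := r ⬝ᵥ (S⁻¹ *ᵥ r)
  set s' := r ⬝ᵥ ((S + Matrix.vecMulVec r r)⁻¹ *ᵥ r)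
  have h3 : (1 + s) * (1 - s') = 1 := by linear_combination h2
  have h4 : (1 - s') • (S⁻¹ *ᵥ r) = (S + Matrix.vecMulVec r r)⁻¹ *ᵥ r := by
    rw [sub_smul, one_smul]
    nth_rewrite 1 [h1]
    rw [add_sub_cancel_right]
  rw [← h4, smul_smul, h3, one_smul]

/-- Mixed products of the two inverses dominate powers of the updated one. -/
lemma FormGE.update_inv_pow_le_mixed (hz : 0 < z) (h : FormGE z S) (r : n → ℝ) (a b : ℕ) :
    r ⬝ᵥ ((S + Matrix.vecMulVec r r)⁻¹ ^ (a + b) *ᵥ r) ≤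
      r ⬝ᵥ ((S + Matrix.vecMulVec r r)⁻¹ ^ b *ᵥ (S⁻¹ ^ a *ᵥ r)) := by
  have h' := h.add_vecMulVec r
  induction a generalizing b with
  | zero => simp
  | succ a ih =>
    set S' := S + Matrix.vecMulVec r r
    have e : S⁻¹ ^ (a + 1) *ᵥ r = S'⁻¹ *ᵥ (S⁻¹ ^ a *ᵥ r) +
        ((r ⬝ᵥ (S'⁻¹ ^ 1 *ᵥ (S⁻¹ ^ a *ᵥ r))) * (1 + r ⬝ᵥ (S⁻¹ *ᵥ r))) • (S'⁻¹ *ᵥ r) := by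
      rw [pow_succ', ← Matrix.mulVec_mulVec, pow_one, mul_smul]
      refine (h.inv_mulVec_eq hz r _).trans ?_
      exact congrArg (fun v => S'⁻¹ *ᵥ (S⁻¹ ^ a *ᵥ r) +
        (r ⬝ᵥ (S'⁻¹ *ᵥ (S⁻¹ ^ a *ᵥ r))) • v) (h.update_inv_mulVec hz r)
    have e2 : ∀ y, S'⁻¹ ^ b *ᵥ (S'⁻¹ *ᵥ y) = S'⁻¹ ^ (b + 1) *ᵥ y := fun y => by
      rw [Matrix.mulVec_mulVec, ← pow_succ]
    rw [e, Matrix.mulVec_add, Matrix.mulVec_smul, dotProduct_add, dotProduct_smul, smul_eq_mul,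
      e2, e2]
    have h1 := ih (b + 1)
    have h2 := (h'.inv_pow_nonneg hz (a + 1) r).trans (ih 1)
    have h3 : 0 ≤ r ⬝ᵥ (S⁻¹ *ᵥ r) := by simpa using h.inv_pow_nonneg hz 1 r
    have h4 := h'.inv_pow_nonneg hz (b + 1) r
    rw [show a + 1 + b = a + (b + 1) by omega]
    have : 0 ≤ (r ⬝ᵥ (S'⁻¹ ^ 1 *ᵥ (S⁻¹ ^ a *ᵥ r))) * (1 + r ⬝ᵥ (S⁻¹ *ᵥ r)) *
        (r ⬝ᵥ (S'⁻¹ ^ (b + 1) *ᵥ r)) := mul_nonneg (mul_nonneg h2 (by linarith)) h4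
    linarith

lemma FormGE.inv_sub_update_inv (hz : 0 < z) (h : FormGE z S) (r : n → ℝ) :
    S⁻¹ = (S + Matrix.vecMulVec r r)⁻¹ +
      Matrix.vecMulVec (S⁻¹ *ᵥ r) ((S + Matrix.vecMulVec r r)⁻¹ *ᵥ r) := by
  have h' := h.add_vecMulVec r
  refine Matrix.ext_of_mulVec_single fun i => ?_
  rw [h.inv_mulVec_eq hz r, Matrix.add_mulVec, Matrix.vecMulVec_mulVec, op_smul_eq_smul]
  have := h'.dotProduct_inv_pow_comm 1 r (Pi.single i 1)
  rw [pow_one] at this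
  rw [this]

/-- Factors `S⁻¹` are exchanged for the updated inverse one by one. Each exchange releases a mixed
quadratic form, which is at least the corresponding pure power of the updated inverse. -/
lemma FormGE.trace_mixed_le (hz : 0 < z) (h : FormGE z S) (r : n → ℝ) (a b : ℕ) :
    ((S + Matrix.vecMulVec r r)⁻¹ ^ (a + b)).trace +
      a * (r ⬝ᵥ ((S + Matrix.vecMulVec r r)⁻¹ ^ (a + b + 1) *ᵥ r)) ≤
      (S⁻¹ ^ a * (S + Matrix.vecMulVec r r)⁻¹ ^ b).trace := by
  have h' := h.add_vecMulVec r
  induction a generalizing b with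
  | zero => simp
  | succ a ih =>
    have hI := h.inv_sub_update_inv hz r
    have hm := h.update_inv_pow_le_mixed hz r (a + 1) (b + 1)
    set S' := S + Matrix.vecMulVec r r
    have e : (S⁻¹ ^ (a + 1) * S'⁻¹ ^ b).trace = (S⁻¹ ^ a * S'⁻¹ ^ (b + 1)).trace +
        r ⬝ᵥ (S'⁻¹ ^ (b + 1) *ᵥ (S⁻¹ ^ (a + 1) *ᵥ r)) := by
      calc (S⁻¹ ^ (a + 1) * S'⁻¹ ^ b).trace = (S⁻¹ ^ a * S⁻¹ * S'⁻¹ ^ b).trace := by rw [pow_succ]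
        _ = (S⁻¹ ^ a * (S'⁻¹ + Matrix.vecMulVec (S⁻¹ *ᵥ r) (S'⁻¹ *ᵥ r)) * S'⁻¹ ^ b).trace := by
            rw [← hI]
        _ = _ := by
            rw [mul_add, add_mul, Matrix.trace_add, mul_assoc, ← pow_succ', Matrix.mul_vecMulVec,
              Matrix.vecMulVec_mul, Matrix.trace_vecMulVec, Matrix.mulVec_mulVec, ← pow_succ,
              ← Matrix.mulVec_transpose, h'.transpose_inv_pow, Matrix.mulVec_mulVec, ← pow_succ,
              h'.dotProduct_inv_pow_comm, dotProduct_comm]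
    rw [e]
    have h1 := ih (b + 1)
    rw [show a + 1 + (b + 1) = a + (b + 1) + 1 by omega] at hm
    rw [show a + 1 + b = a + (b + 1) by omega]
    push_cast
    linarith

/-- Decrease of `tr S⁻ᵐ` under a rank-one update. -/
lemma FormGE.trace_update_inv_pow_le (hz : 0 < z) (h : FormGE z S) (r : n → ℝ) (m : ℕ) :
    ((S + Matrix.vecMulVec r r)⁻¹ ^ m).trace +
      m * (r ⬝ᵥ ((S + Matrix.vecMulVec r r)⁻¹ ^ (m + 1) *ᵥ r)) ≤ (S⁻¹ ^ m).trace := by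
  simpa using h.trace_mixed_le hz r m 0

/-- With `v` the updated inverse applied to `r`, the difference is `(1 + s) |v|²`, while `(1 + s)²
|v|² = r ⬝ S⁻² r ≤ s / z`. The bound does not involve the size of `r`, so no truncation of rows is
needed for bounded differences. -/
lemma FormGE.trace_inv_sub_le (hz : 0 < z) (h : FormGE z S) (r : n → ℝ) :
    0 ≤ S⁻¹.trace - (S + Matrix.vecMulVec r r)⁻¹.trace ∧
      S⁻¹.trace - (S + Matrix.vecMulVec r r)⁻¹.trace ≤ z⁻¹ := by
  have h' := h.add_vecMulVec r
  have e : S⁻¹.trace - (S + Matrix.vecMulVec r r)⁻¹.trace =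
      (S⁻¹ *ᵥ r) ⬝ᵥ ((S + Matrix.vecMulVec r r)⁻¹ *ᵥ r) := by
    conv_lhs => rw [h.inv_sub_update_inv hz r]
    rw [Matrix.trace_add, Matrix.trace_vecMulVec]; ring
  rw [e]
  have hs0 : 0 ≤ r ⬝ᵥ (S⁻¹ *ᵥ r) := by simpa using h.inv_pow_nonneg hz 1 r
  have hu := h.update_inv_mulVec hz r
  set v := (S + Matrix.vecMulVec r r)⁻¹ *ᵥ r
  have h2 : (S⁻¹ *ᵥ r) ⬝ᵥ (S⁻¹ *ᵥ r) ≤ z⁻¹ * (r ⬝ᵥ (S⁻¹ *ᵥ r)) := by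
    have := h.inv_pow_succ_le hz 1 r
    rw [pow_succ, ← Matrix.mulVec_mulVec, h.dotProduct_inv_pow_comm, pow_one] at this
    exact this
  set s := r ⬝ᵥ (S⁻¹ *ᵥ r)
  have hvv : 0 ≤ v ⬝ᵥ v := dotProduct_self_nonneg' v
  rw [hu, smul_dotProduct, smul_eq_mul] at *
  rw [dotProduct_smul, smul_eq_mul] at h2
  refine ⟨by positivity, ?_⟩
  have h4 : (1 + s) * ((1 + s) * (v ⬝ᵥ v)) ≤ (1 + s) * z⁻¹ := by
    have : 0 < z⁻¹ := inv_pos.2 hz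
    linarith
  exact le_of_mul_le_mul_left h4 (by linarith)

end RankOne

end Resolvent

/-- A random vector with independent centred unit-variance coordinates and bounded fourth
moments. -/
structure IsUnitRow {n : ℕ} (ν : Measure (Fin n → ℝ)) (H : ℝ) : Prop where
  prob : IsProbabilityMeasure ν
  indep : iIndepFun (fun (i : Fin n) (r : Fin n → ℝ) => r i) ν
  mean_zero : ∀ i, ∫ r, r i ∂ν = 0
  variance_one : ∀ i, ∫ r, r i ^ 2 ∂ν = 1
  integrable_four : ∀ i, Integrable (fun r => r i ^ 4) ν
  four_le : ∀ i, ∫ r, r i ^ 4 ∂ν ≤ H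

/-! ### Mixed moments of a random row and of its quadratic forms -/

section UnitRow

variable {n : ℕ} {ν : Measure (Fin n → ℝ)} {H : ℝ}

lemma IsUnitRow.integrable_pow (h : IsUnitRow ν H) (i : Fin n) {m : ℕ} (hm : m ≤ 4) :
    Integrable (fun r => r i ^ m) ν := by
  have := h.prob
  refine Integrable.mono' ((integrable_const (1 : ℝ)).add (h.integrable_four i))
    ((measurable_pi_apply i).pow_const m).aestronglyMeasurable (ae_of_all _ fun r => ?_)
  simp only [Pi.add_apply, Real.norm_eq_abs, abs_pow]
  rw [← Even.pow_abs (by decide : Even 4)]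
  rcases le_total |r i| 1 with h1 | h1
  · have := pow_le_one₀ (n := m) (abs_nonneg _) h1
    have h' : 0 ≤ |r i| ^ 4 := by positivity
    linarith
  · have := pow_le_pow_right₀ h1 hm
    linarith

/-- Expectation of a monomial in the coordinates. -/
lemma IsUnitRow.integral_prod_pow (h : IsUnitRow ν H) (c : Fin n → ℕ) :
    ∫ r, ∏ i, r i ^ c i ∂ν = ∏ i, ∫ r, r i ^ c i ∂ν := by
  have := h.prob
  exact h.indep.integral_fun_prod_comp (f := fun i x => x ^ c i)
    (fun i => (measurable_pi_apply i).aemeasurable)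
    (fun i => (measurable_id.pow_const _).aestronglyMeasurable)

lemma IsUnitRow.integrable_mul_four (h : IsUnitRow ν H) (i j k l : Fin n) :
    Integrable (fun r => r i * r j * (r k * r l)) ν := by
  have := h.prob
  refine Integrable.mono' (((h.integrable_four i).add (h.integrable_four j)).add
    ((h.integrable_four k).add (h.integrable_four l)))
    (by fun_prop) (ae_of_all _ fun r => ?_)
  simp only [Pi.add_apply, Real.norm_eq_abs, abs_le]
  constructor <;>
  nlinarith [sq_nonneg (r i - r j), sq_nonneg (r i + r j), sq_nonneg (r k - r l),
    sq_nonneg (r k + r l), sq_nonneg (r i ^ 2 - r j ^ 2), sq_nonneg (r k ^ 2 - r l ^ 2),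
    sq_nonneg (r i * r j - r k * r l), sq_nonneg (r i * r j + r k * r l)]

lemma IsUnitRow.integral_mul_two (h : IsUnitRow ν H) (i j : Fin n) :
    ∫ r, r i * r j ∂ν = if i = j then 1 else 0 := by
  have := h.prob
  by_cases hij : i = j
  · subst hij
    simpa [sq] using h.variance_one i
  · rw [if_neg hij]
    have h1 := (h.indep.indepFun hij).integral_fun_mul_eq_mul_integral
      (measurable_pi_apply i).aestronglyMeasurable (measurable_pi_apply j).aestronglyMeasurable
    rw [h1, h.mean_zero, zero_mul]

/-- Fourth mixed moments of the coordinates. -/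
lemma IsUnitRow.integral_mul_four (h : IsUnitRow ν H) (i j k l : Fin n) :
    ∫ r, r i * r j * (r k * r l) ∂ν =
      (if i = j then 1 else 0) * (if k = l then 1 else 0) +
      (if i = k then 1 else 0) * (if j = l then 1 else 0) +
      (if i = l then 1 else 0) * (if j = k then 1 else 0) +
      (if i = j then 1 else 0) * (if k = l then 1 else 0) * (if i = k then 1 else 0) *
        ((∫ r, r i ^ 4 ∂ν) - 3) := by
  have := h.prob
  -- The multiplicity of each coordinate in the monomial. A coordinate occurring exactly once
  -- annihilates the expectation, and if only multiplicities 0 and 2 occur the expectation is one.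
  let c : Fin n → ℕ := fun a => (if i = a then 1 else 0) + (if j = a then 1 else 0) +
    (if k = a then 1 else 0) + (if l = a then 1 else 0)
  have e : ∀ r : Fin n → ℝ, r i * r j * (r k * r l) = ∏ a, r a ^ c a := by
    intro r
    simp only [c, pow_add, Finset.prod_mul_distrib]
    simp [pow_ite, mul_assoc]
  have hzero : ∀ a, c a = 1 → ∏ a, ∫ r, r a ^ c a ∂ν = 0 := fun a ha =>
    Finset.prod_eq_zero (Finset.mem_univ a) (by rw [ha]; simpa using h.mean_zero a)
  have hone : (∀ a, c a = 0 ∨ c a = 2) → ∏ a, ∫ r, r a ^ c a ∂ν = 1 := fun hc =>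
    Finset.prod_eq_one fun a _ => by
      rcases hc a with ha | ha
      · rw [ha]; simp
      · rw [ha]; exact h.variance_one a
  simp_rw [e]
  rw [h.integral_prod_pow]
  by_cases hij : i = j
  · by_cases hkl : k = l
    · by_cases hik : i = k
      · subst hij hkl hik
        rw [Finset.prod_eq_single i]
        · simp [c]; ring
        · intro b _ hb
          simp [c, hb.symm]
        · simp
      · rw [hone]
        · subst hij hkl; simp [hik]
        · intro a
          simp only [c]
          subst hij hkl
          by_cases h1 : i = a <;> by_cases h2 : k = a <;> simp_all
    · subst hij
      by_cases hik : i = k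
      · rw [hzero l (by subst hik; simp [c, hkl])]
        subst hik; simp [hkl]
      · rw [hzero k (by simp [c, hik, Ne.symm hkl])]
        simp [hkl, hik]
  · by_cases hkl : k = l
    · subst hkl
      by_cases hik : i = k
      · rw [hzero j (by subst hik; simp [c, hij])]
        subst hik; simp [hij, Ne.symm hij]
      · rw [hzero i (by simp [c, Ne.symm hij, Ne.symm hik])]
        simp [hij, hik]
    · by_cases hik : i = k
      · subst hik
        by_cases hjl : j = l
        · rw [hone]
          · subst hjl; simp [hij]
          · intro a
            simp only [c]
            subst hjl
            by_cases h1 : i = a <;> by_cases h2 : j = a <;> simp_all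
        · rw [hzero j (by simp [c, hij, Ne.symm hjl])]
          simp [hij, hkl, hjl]
      · by_cases hil : i = l
        · subst hil
          by_cases hjk : j = k
          · rw [hone]
            · subst hjk; simp [hij]
            · intro a
              simp only [c]
              subst hjk
              by_cases h1 : i = a <;> by_cases h2 : j = a <;> simp_all
          · rw [hzero j (by simp [c, hij, Ne.symm hjk])]
            simp [hij, hik, hjk]
        · rw [hzero i (by simp [c, Ne.symm hij, Ne.symm hik, Ne.symm hil])]
          simp [hij, hik, hil]

lemma dotProduct_mulVec_eq_sum (A : Matrix (Fin n) (Fin n) ℝ) (r : Fin n → ℝ) :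
    r ⬝ᵥ (A *ᵥ r) = ∑ i, ∑ j, A i j * (r i * r j) := by
  simp only [dotProduct, Matrix.mulVec, Finset.mul_sum]
  exact Finset.sum_congr rfl fun i _ => Finset.sum_congr rfl fun j _ => by ring

lemma IsUnitRow.integrable_mul_two (h : IsUnitRow ν H) (i j : Fin n) :
    Integrable (fun r => r i * r j) ν := by
  have := h.prob
  refine Integrable.mono' ((h.integrable_pow i (m := 2) (by norm_num)).add
    (h.integrable_pow j (m := 2) (by norm_num))) (by fun_prop) (ae_of_all _ fun r => ?_)
  simp only [Pi.add_apply, Real.norm_eq_abs, abs_le]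
  constructor <;> nlinarith [sq_nonneg (r i - r j), sq_nonneg (r i + r j)]

lemma IsUnitRow.integrable_quad (h : IsUnitRow ν H) (A : Matrix (Fin n) (Fin n) ℝ) :
    Integrable (fun r => r ⬝ᵥ (A *ᵥ r)) ν := by
  simp only [dotProduct_mulVec_eq_sum]
  exact integrable_finsetSum _ fun i _ => integrable_finsetSum _ fun j _ =>
    (h.integrable_mul_two i j).const_mul _

lemma IsUnitRow.integral_quad (h : IsUnitRow ν H) (A : Matrix (Fin n) (Fin n) ℝ) :
    ∫ r, r ⬝ᵥ (A *ᵥ r) ∂ν = A.trace := by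
  have hi : ∀ i j, Integrable (fun r => A i j * (r i * r j)) ν := fun i j =>
    (h.integrable_mul_two i j).const_mul _
  have e : (fun r : Fin n → ℝ => r ⬝ᵥ (A *ᵥ r)) = fun r => ∑ i, ∑ j, A i j * (r i * r j) :=
    funext fun r => dotProduct_mulVec_eq_sum A r
  rw [e, integral_finsetSum _ fun i _ => integrable_finsetSum _ fun j _ => hi i j]
  simp_rw [integral_finsetSum _ fun j _ => hi _ j, integral_const_mul, h.integral_mul_two]
  simp [Matrix.trace]

lemma IsUnitRow.integrable_quad_mul (h : IsUnitRow ν H) (A B : Matrix (Fin n) (Fin n) ℝ) :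
    Integrable (fun r => (r ⬝ᵥ (A *ᵥ r)) * (r ⬝ᵥ (B *ᵥ r))) ν := by
  have : (fun r : Fin n → ℝ => (r ⬝ᵥ (A *ᵥ r)) * (r ⬝ᵥ (B *ᵥ r))) =
      fun r => ∑ i, ∑ j, ∑ k, ∑ l, A i j * B k l * (r i * r j * (r k * r l)) := by
    ext r
    rw [mul_comm]
    simp only [dotProduct_mulVec_eq_sum, Finset.sum_mul, Finset.mul_sum]
    exact Finset.sum_congr rfl fun i _ => Finset.sum_congr rfl fun j _ =>
      Finset.sum_congr rfl fun k _ => Finset.sum_congr rfl fun l _ => by ring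
  rw [this]
  exact integrable_finsetSum _ fun i _ => integrable_finsetSum _ fun j _ =>
    integrable_finsetSum _ fun k _ => integrable_finsetSum _ fun l _ =>
    (h.integrable_mul_four i j k l).const_mul _

/-- Covariance of two quadratic forms. -/
lemma IsUnitRow.integral_quad_mul (h : IsUnitRow ν H) (A B : Matrix (Fin n) (Fin n) ℝ)
    (hB : Bᵀ = B) :
    ∫ r, (r ⬝ᵥ (A *ᵥ r)) * (r ⬝ᵥ (B *ᵥ r)) ∂ν =
      A.trace * B.trace + 2 * (A * B).trace +
        ∑ i, A i i * B i i * ((∫ r, r i ^ 4 ∂ν) - 3) := by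
  have e : (fun r : Fin n → ℝ => (r ⬝ᵥ (A *ᵥ r)) * (r ⬝ᵥ (B *ᵥ r))) =
      fun r => ∑ i, ∑ j, ∑ k, ∑ l, A i j * B k l * (r i * r j * (r k * r l)) := by
    ext r
    rw [mul_comm]
    simp only [dotProduct_mulVec_eq_sum, Finset.sum_mul, Finset.mul_sum]
    exact Finset.sum_congr rfl fun i _ => Finset.sum_congr rfl fun j _ =>
      Finset.sum_congr rfl fun k _ => Finset.sum_congr rfl fun l _ => by ring
  have hi : ∀ i j k l, Integrable (fun r => A i j * B k l * (r i * r j * (r k * r l))) ν :=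
    fun i j k l => (h.integrable_mul_four i j k l).const_mul _
  rw [e, integral_finsetSum _ fun i _ => integrable_finsetSum _ fun j _ =>
    integrable_finsetSum _ fun k _ => integrable_finsetSum _ fun l _ => hi i j k l]
  simp_rw [integral_finsetSum _ fun j _ => integrable_finsetSum _ fun k _ =>
    integrable_finsetSum _ fun l _ => hi _ j k l,
    integral_finsetSum _ fun k _ => integrable_finsetSum _ fun l _ => hi _ _ k l,
    integral_finsetSum _ fun l _ => hi _ _ _ l, integral_const_mul, h.integral_mul_four]
  simp only [mul_add, Finset.sum_add_distrib]
  have hBs : ∀ i j, B i j = B j i := fun i j => congrFun (congrFun hB.symm i) j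
  have t1 : ∑ i, ∑ j, ∑ k, ∑ l, A i j * B k l *
      ((if i = j then 1 else 0) * (if k = l then 1 else 0)) = A.trace * B.trace := by
    simp only [Matrix.trace, Matrix.diag]
    rw [Finset.sum_mul_sum]
    simp
  have t2 : ∑ i, ∑ j, ∑ k, ∑ l, A i j * B k l *
      ((if i = k then 1 else 0) * (if j = l then 1 else 0)) = (A * B).trace := by
    simp only [Matrix.trace, Matrix.diag, Matrix.mul_apply]
    refine Finset.sum_congr rfl fun i _ => Finset.sum_congr rfl fun j _ => ?_
    simp [hBs j i]
  have t3 : ∑ i, ∑ j, ∑ k, ∑ l, A i j * B k l *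
      ((if i = l then 1 else 0) * (if j = k then 1 else 0)) = (A * B).trace := by
    simp only [Matrix.trace, Matrix.diag, Matrix.mul_apply]
    refine Finset.sum_congr rfl fun i _ => Finset.sum_congr rfl fun j _ => ?_
    simp
  have t4 : ∑ i, ∑ j, ∑ k, ∑ l, A i j * B k l *
      ((if i = j then 1 else 0) * (if k = l then 1 else 0) * (if i = k then 1 else 0) *
        ((∫ r, r i ^ 4 ∂ν) - 3)) = ∑ i, A i i * B i i * ((∫ r, r i ^ 4 ∂ν) - 3) := by
    refine Finset.sum_congr rfl fun i _ => ?_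
    simp
  rw [t1, t2, t3, t4]
  ring

end UnitRow

/-! ### Quadratic forms of resolvents in a random row -/

section QuadraticForms

variable {n : ℕ} {ν : Measure (Fin n → ℝ)} {H : ℝ}

lemma apply_self_eq_dotProduct (A : Matrix (Fin n) (Fin n) ℝ) (i : Fin n) :
    A i i = Pi.single i 1 ⬝ᵥ (A *ᵥ Pi.single i 1) := by
  simp

lemma sum_sq_diag_le_trace {A : Matrix (Fin n) (Fin n) ℝ} (hA : Aᵀ = A) :
    ∑ i, A i i ^ 2 ≤ (A * A).trace := by
  simp only [Matrix.trace, Matrix.diag, Matrix.mul_apply]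
  refine Finset.sum_le_sum fun i _ => ?_
  have hs : ∀ i j, A i j = A j i := fun i j => congrFun (congrFun hA.symm i) j
  refine le_trans (le_of_eq (sq _)) (Finset.single_le_sum (f := fun j => A i j * A j i)
    (fun j _ => ?_) (Finset.mem_univ i))
  simp only [hs j i]
  exact mul_self_nonneg _

/-- `L¹` concentration of the quadratic form of a resolvent. -/
lemma IsUnitRow.integral_abs_quad_sub_le (h : IsUnitRow ν H) (hH : 0 ≤ H)
    {S : Matrix (Fin n) (Fin n) ℝ} {z : ℝ} (hz : 0 < z) (hS : FormGE z S) :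
    ∫ r, |r ⬝ᵥ (S⁻¹ *ᵥ r) - S⁻¹.trace| ∂ν ≤ √((H + 2) * n) / z := by
  have := h.prob
  have hsym : S⁻¹ᵀ = S⁻¹ := by simpa using hS.transpose_inv_pow 1
  set R := S⁻¹
  have hi := h.integrable_quad R
  have hi2 := h.integrable_quad_mul R R
  have hfi : Integrable (fun r => r ⬝ᵥ (R *ᵥ r) - R.trace) ν := hi.sub (integrable_const _)
  have hvar : ∫ r, |r ⬝ᵥ (R *ᵥ r) - R.trace| ^ 2 ∂ν ≤ (H + 2) * (R * R).trace := by
    have e : ∫ r, |r ⬝ᵥ (R *ᵥ r) - R.trace| ^ 2 ∂ν =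
        2 * (R * R).trace + ∑ i, R i i * R i i * ((∫ r, r i ^ 4 ∂ν) - 3) := by
      have : (fun r : Fin n → ℝ => |r ⬝ᵥ (R *ᵥ r) - R.trace| ^ 2) = fun r =>
          (r ⬝ᵥ (R *ᵥ r)) * (r ⬝ᵥ (R *ᵥ r)) - 2 * R.trace * (r ⬝ᵥ (R *ᵥ r)) + R.trace ^ 2 := by
        ext r; rw [sq_abs]; ring
      have hA : Integrable (fun r : Fin n → ℝ => (r ⬝ᵥ (R *ᵥ r)) * (r ⬝ᵥ (R *ᵥ r)) -
          2 * R.trace * (r ⬝ᵥ (R *ᵥ r))) ν := hi2.sub (hi.const_mul _)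
      rw [this, integral_add hA (integrable_const _),
        integral_sub hi2 (hi.const_mul _), integral_const_mul, h.integral_quad_mul R R hsym,
        h.integral_quad]
      simp; ring
    rw [e]
    have h1 : ∑ i, R i i * R i i * ((∫ r, r i ^ 4 ∂ν) - 3) ≤ H * ∑ i, R i i ^ 2 := by
      rw [Finset.mul_sum]
      refine Finset.sum_le_sum fun i _ => ?_
      have := h.four_le i
      nlinarith [mul_self_nonneg (R i i)]
    have h2 := mul_le_mul_of_nonneg_left (sum_sq_diag_le_trace hsym) hH
    linarith
  have htr : (R * R).trace ≤ n * z⁻¹ ^ 2 := by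
    have := hS.trace_inv_pow_le hz 2
    rwa [sq, Fintype.card_fin] at this
  have hJ : (∫ r, |r ⬝ᵥ (R *ᵥ r) - R.trace| ∂ν) ^ 2 ≤ ∫ r, |r ⬝ᵥ (R *ᵥ r) - R.trace| ^ 2 ∂ν := by
    refine (convexOn_pow 2).map_integral_le (continuous_pow 2).continuousOn isClosed_Ici
      (ae_of_all _ fun ω => Set.mem_Ici.2 (abs_nonneg _)) hfi.abs ?_
    have : (fun r : Fin n → ℝ => |r ⬝ᵥ (R *ᵥ r) - R.trace| ^ 2) = fun r =>
          (r ⬝ᵥ (R *ᵥ r)) * (r ⬝ᵥ (R *ᵥ r)) - 2 * R.trace * (r ⬝ᵥ (R *ᵥ r)) + R.trace ^ 2 := by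
        ext r; rw [sq_abs]; ring
    simp only [Function.comp_def]
    rw [this]
    exact (hi2.sub (hi.const_mul _)).add (integrable_const _)
  rw [le_div_iff₀ hz]
  refine Real.le_sqrt_of_sq_le ?_
  rw [mul_pow]
  calc _ ≤ ((H + 2) * (n * z⁻¹ ^ 2)) * z ^ 2 := by
        gcongr
        exact hJ.trans (hvar.trans (by gcongr))
    _ = (H + 2) * n := by field_simp

/-- Joint bound for two quadratic forms of resolvents. -/
lemma IsUnitRow.integral_quad_mul_le (h : IsUnitRow ν H)
    {S S₀ : Matrix (Fin n) (Fin n) ℝ} {z : ℝ} (hz : 0 < z) (hS : FormGE z S) (hS₀ : FormGE z S₀)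
    (hH : 0 ≤ H) (k : ℕ) :
    ∫ r, (r ⬝ᵥ (S⁻¹ ^ k *ᵥ r)) * (r ⬝ᵥ (S₀⁻¹ *ᵥ r)) ∂ν ≤
      (S⁻¹ ^ k).trace * (S₀⁻¹.trace + (2 + H) / z) := by
  have := h.prob
  have hsym : S₀⁻¹ᵀ = S₀⁻¹ := by simpa using hS₀.transpose_inv_pow 1
  rw [h.integral_quad_mul _ _ hsym]
  have hle : ∀ x, x ⬝ᵥ (S₀⁻¹ *ᵥ x) ≤ z⁻¹ * (x ⬝ᵥ x) := fun x => by
    simpa using hS₀.inv_pow_succ_le hz 0 x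
  have h0 : ∀ x, 0 ≤ x ⬝ᵥ (S₀⁻¹ *ᵥ x) := fun x => by
    simpa using hS₀.inv_pow_nonneg hz 1 x
  have h1 : (S⁻¹ ^ k * S₀⁻¹).trace ≤ (S⁻¹ ^ k).trace * z⁻¹ := by
    obtain ⟨U, d, hU, hU', hSd, hd, hk⟩ := hS.exists_spectral_inv hz
    rw [hk, trace_conjDiag hU]
    have e : (conjDiag U (fun i => (d i)⁻¹ ^ k) * S₀⁻¹).trace =
        ∑ i, (d i)⁻¹ ^ k * ((fun a => U a i) ⬝ᵥ (S₀⁻¹ *ᵥ (fun a => U a i))) := by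
      unfold conjDiag
      rw [mul_assoc, mul_assoc, Matrix.trace_mul_comm, mul_assoc, Matrix.trace]
      refine Finset.sum_congr rfl fun i _ => ?_
      rw [Matrix.diag_apply, Matrix.diagonal_mul, mul_assoc, Matrix.mul_apply]
      rfl
    rw [e, Finset.sum_mul]
    refine Finset.sum_le_sum fun i _ => mul_le_mul_of_nonneg_left ?_
      (pow_nonneg (inv_nonneg.2 (hz.le.trans (hd i))) k)
    refine (hle _).trans ?_
    rw [dotProduct_col_self hU, mul_one]
  have h2 : ∑ i, (S⁻¹ ^ k) i i * S₀⁻¹ i i * ((∫ r, r i ^ 4 ∂ν) - 3) ≤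
      (S⁻¹ ^ k).trace * z⁻¹ * H := by
    rw [Matrix.trace, Finset.sum_mul, Finset.sum_mul]
    refine Finset.sum_le_sum fun i _ => ?_
    have hp : 0 ≤ (S⁻¹ ^ k) i i := by
      rw [apply_self_eq_dotProduct (S⁻¹ ^ k)]; exact hS.inv_pow_nonneg hz k _
    have hr0 : 0 ≤ S₀⁻¹ i i := by
      rw [apply_self_eq_dotProduct S₀⁻¹]; exact h0 _
    have hr1 : S₀⁻¹ i i ≤ z⁻¹ := by
      rw [apply_self_eq_dotProduct S₀⁻¹]; refine (hle _).trans (by simp)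
    have h4 := h.four_le i
    rw [Matrix.diag_apply]
    calc (S⁻¹ ^ k) i i * S₀⁻¹ i i * ((∫ r, r i ^ 4 ∂ν) - 3)
        ≤ (S⁻¹ ^ k) i i * S₀⁻¹ i i * H := by gcongr; linarith
      _ ≤ (S⁻¹ ^ k) i i * z⁻¹ * H := by gcongr
  have e3 : (S⁻¹ ^ k).trace * (S₀⁻¹.trace + (2 + H) / z) = (S⁻¹ ^ k).trace * S₀⁻¹.trace +
      2 * ((S⁻¹ ^ k).trace * z⁻¹) + (S⁻¹ ^ k).trace * z⁻¹ * H := by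
    rw [div_eq_mul_inv]; ring
  linarith

/-- Expected decrease of `tr S⁻ᵐ` under a random rank-one update. -/
lemma IsUnitRow.integral_trace_update_le (h : IsUnitRow ν H) (hH : 0 ≤ H)
    {S S₀ : Matrix (Fin n) (Fin n) ℝ} {z : ℝ} (hz : 0 < z) (hS : FormGE z S) (hS₀ : FormGE z S₀)
    (hle : ∀ x, x ⬝ᵥ (S₀ *ᵥ x) ≤ x ⬝ᵥ (S *ᵥ x)) {m : ℕ} {σ : ℝ} (hσ : 0 < σ)
    (hσ1 : 2 * (S₀⁻¹.trace + (2 + H) / z) ≤ σ) (hσ2 : (m + 1) * σ ≤ 1 / 2) {x : ℝ} (hx : 0 < x) :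
    ∫ r, ((S + Matrix.vecMulVec r r)⁻¹ ^ m).trace ∂ν ≤
      (1 - (m + 1) * x / 6) * (S⁻¹ ^ m).trace + n * x ^ (m + 1) / 6 := by
  have := h.prob
  set g : (Fin n → ℝ) → ℝ := fun r => (S⁻¹ ^ m).trace - m / 3 *
    (r ⬝ᵥ (S⁻¹ ^ (m + 1) *ᵥ r) - (r ⬝ᵥ (S⁻¹ ^ (m + 1) *ᵥ r)) * (r ⬝ᵥ (S₀⁻¹ *ᵥ r)) / σ)
  have hq := h.integrable_quad (S⁻¹ ^ (m + 1))
  have hq2 := (h.integrable_quad_mul (S⁻¹ ^ (m + 1)) S₀⁻¹).div_const σ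
  have hgi : Integrable g ν := (integrable_const _).sub ((hq.sub hq2).const_mul _)
  have hfg : ∀ r, ((S + Matrix.vecMulVec r r)⁻¹ ^ m).trace ≤ g r := by
    intro r
    have h1 := hS.trace_update_inv_pow_le hz r m
    have h2 := hS.inv_pow_nonneg hz (m + 1) r
    have h3 := (hS.add_vecMulVec r).inv_pow_nonneg hz (m + 1) r
    have h4 := hS.dotProduct_inv_le_of_le hz hS₀ hle r
    have h5 : 0 ≤ r ⬝ᵥ (S⁻¹ *ᵥ r) := by simpa using hS.inv_pow_nonneg hz 1 r
    simp only [g]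
    set q := r ⬝ᵥ (S⁻¹ ^ (m + 1) *ᵥ r)
    set q' := r ⬝ᵥ ((S + Matrix.vecMulVec r r)⁻¹ ^ (m + 1) *ᵥ r)
    set s₀ := r ⬝ᵥ (S₀⁻¹ *ᵥ r)
    have hm0 : (0 : ℝ) ≤ m := Nat.cast_nonneg m
    -- If `s₀ ≤ σ`, the update keeps a third of `q`; otherwise the left side is not positive. This
    -- linear substitute for the indicator of `s₀ ≤ σ` has an expectation computable from fourth
    -- moments, and using the fixed `S₀` in place of `S` keeps `σ` the same at all steps.
    have key : (q - q * s₀ / σ) / 3 ≤ q' := by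
      rcases le_or_gt s₀ σ with hs | hs
      · have h6 := hS.third_le_update_inv_pow hz (r := r) (k := m)
          (le_trans (by gcongr; exact h4.trans hs) hσ2)
        have h7 : 0 ≤ q * s₀ / σ := div_nonneg (mul_nonneg h2 (h5.trans h4)) hσ.le
        linarith
      · have : q ≤ q * s₀ / σ := by
          rw [le_div_iff₀ hσ]; gcongr
        linarith
    have := mul_le_mul_of_nonneg_left key hm0
    linarith
  have hint : ∫ r, g r ∂ν ≤ (S⁻¹ ^ m).trace - m / 6 * (S⁻¹ ^ (m + 1)).trace := by
    have h1 := h.integral_quad_mul_le hz hS hS₀ hH (m + 1)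
    have h2 := hS.trace_inv_pow_nonneg hz (m + 1)
    simp only [g]
    have hB : Integrable (fun r => m / 3 * (r ⬝ᵥ (S⁻¹ ^ (m + 1) *ᵥ r) -
        (r ⬝ᵥ (S⁻¹ ^ (m + 1) *ᵥ r)) * (r ⬝ᵥ (S₀⁻¹ *ᵥ r)) / σ)) ν := (hq.sub hq2).const_mul _
    rw [integral_sub (integrable_const _) hB, integral_const_mul,
      integral_sub hq hq2, h.integral_quad, integral_div]
    simp only [integral_const, probReal_univ, one_smul]
    have h3 : (∫ r, (r ⬝ᵥ (S⁻¹ ^ (m + 1) *ᵥ r)) * (r ⬝ᵥ (S₀⁻¹ *ᵥ r)) ∂ν) / σ ≤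
        (S⁻¹ ^ (m + 1)).trace / 2 := by
      rw [div_le_iff₀ hσ]
      nlinarith
    have hm0 : (0 : ℝ) ≤ m / 3 := by positivity
    nlinarith
  -- At this point the expected loss is at least `m / 6` times the trace of the next power. The
  -- tangent line turns it into a recursion that is linear in the potential itself.
  have htan := hS.tangent_trace_inv_pow hz m hx
  rw [Fintype.card_fin] at htan
  refine (integral_mono_of_nonneg (ae_of_all _ fun r =>
    (hS.add_vecMulVec r).trace_inv_pow_nonneg hz m) hgi (ae_of_all _ hfg)).trans
    (hint.trans ?_)
  nlinarith

end QuadraticForms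

/-! ### Resampling of coordinates and bounded differences -/

section Resampling

variable {ι E : Type*} [Fintype ι] [DecidableEq ι] [MeasurableSpace E]

lemma measurable_piecewise_prod (s : Finset ι) :
    Measurable fun z : (ι → E) × (ι → E) => s.piecewise z.2 z.1 := by
  refine measurable_pi_iff.2 fun i => ?_
  by_cases hi : i ∈ s
  · simp only [Finset.piecewise_eq_of_mem _ _ _ hi]; fun_prop
  · simp only [Finset.piecewise_eq_of_notMem _ _ _ hi]; fun_prop

variable (ν : ι → Measure E) [∀ i, IsProbabilityMeasure (ν i)]

/-- Resampling the coordinates in `s` preserves a product measure. -/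
lemma measurePreserving_piecewise (s : Finset ι) :
    MeasurePreserving (fun z : (ι → E) × (ι → E) => s.piecewise z.2 z.1)
      ((Measure.pi ν).prod (Measure.pi ν)) (Measure.pi ν) := by
  refine ⟨measurable_piecewise_prod s, (Measure.pi_eq fun t ht => ?_).symm⟩
  rw [Measure.map_apply (measurable_piecewise_prod s) (MeasurableSet.univ_pi ht)]
  have : (fun z : (ι → E) × (ι → E) => s.piecewise z.2 z.1) ⁻¹' (Set.univ.pi t) =
      (Set.univ.pi fun i => if i ∈ s then Set.univ else t i) ×ˢ
        (Set.univ.pi fun i => if i ∈ s then t i else Set.univ) := by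
    ext z
    simp only [Set.mem_preimage, Set.mem_pi, Set.mem_univ, true_implies, Set.mem_prod]
    rw [← forall_and]
    refine forall_congr' fun i => ?_
    by_cases hi : i ∈ s <;> simp [hi]
  rw [this, Measure.prod_prod, Measure.pi_pi, Measure.pi_pi, ← Finset.prod_mul_distrib]
  refine Finset.prod_congr rfl fun i _ => ?_
  by_cases hi : i ∈ s <;> simp [hi]

lemma measurable_update_prod (j : ι) :
    Measurable fun z : (ι → E) × E => Function.update z.1 j z.2 := by
  refine measurable_pi_iff.2 fun i => ?_
  by_cases hi : i = j
  · subst hi; simp only [Function.update_self]; fun_prop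
  · simp only [Function.update_of_ne hi]; fun_prop

lemma measurePreserving_update (j : ι) :
    MeasurePreserving (fun z : (ι → E) × E => Function.update z.1 j z.2)
      ((Measure.pi ν).prod (ν j)) (Measure.pi ν) := by
  have h1 := measurePreserving_piecewise ν {j}
  have h2 : MeasurePreserving (fun z : (ι → E) × (ι → E) => (z.1, z.2 j))
      ((Measure.pi ν).prod (Measure.pi ν)) ((Measure.pi ν).prod (ν j)) :=
    (MeasurePreserving.id _).prod (measurePreserving_eval ν j)
  refine ⟨measurable_update_prod j, ?_⟩
  calc _ = Measure.map (fun z : (ι → E) × E => Function.update z.1 j z.2)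
        (Measure.map (fun z : (ι → E) × (ι → E) => (z.1, z.2 j))
          ((Measure.pi ν).prod (Measure.pi ν))) := by rw [h2.map_eq]
    _ = Measure.map (fun z : (ι → E) × (ι → E) => ({j} : Finset ι).piecewise z.2 z.1)
        ((Measure.pi ν).prod (Measure.pi ν)) := by
      rw [Measure.map_map (measurable_update_prod j) h2.measurable]
      congr 1
      ext z : 1
      simp [Finset.piecewise_singleton]
    _ = _ := h1.map_eq

/-- Integrating out one coordinate of a product measure. -/
lemma integral_pi_update (j : ι) {f : (ι → E) → ℝ} (hf : Integrable f (Measure.pi ν)) :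
    ∫ x, f x ∂(Measure.pi ν) = ∫ x, ∫ r, f (Function.update x j r) ∂(ν j) ∂(Measure.pi ν) := by
  have h := measurePreserving_update ν j
  rw [← integral_prod (f := fun z : (ι → E) × E => f (Function.update z.1 j z.2))
    (h.integrable_comp_of_integrable hf)]
  conv_lhs => rw [← h.map_eq]
  exact integral_map h.aemeasurable (by rw [h.map_eq]; exact hf.aestronglyMeasurable)

/-- Resampling one further coordinate amounts to integrating over its new value last. This is the
step of the martingale argument, in the form of an induction on finite sets. -/
lemma integral_piecewise_insert {s : Finset ι} {j : ι} (hj : j ∉ s) {f : (ι → E) → ℝ}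
    (hf : Measurable f) {C : ℝ} (hC : ∀ x, |f x| ≤ C) (x : ι → E) :
    ∫ y, f ((insert j s).piecewise y x) ∂(Measure.pi ν) =
      ∫ r, ∫ y, f (s.piecewise y (Function.update x j r)) ∂(Measure.pi ν) ∂(ν j) := by
  have e : ∀ (y : ι → E) (r : E), (insert j s).piecewise (Function.update y j r) x =
      s.piecewise y (Function.update x j r) := by
    intro y r
    ext i
    by_cases hi : i = j
    · subst hi; simp [hj]
    · by_cases his : i ∈ s <;> simp [hi, his]
  have hm : Measurable fun y => f ((insert j s).piecewise y x) :=
    hf.comp ((measurable_piecewise_prod (insert j s)).comp (measurable_const.prodMk measurable_id))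
  rw [integral_pi_update ν j (integrable_of_abs_le hm fun y => hC _)]
  simp_rw [e]
  rw [integral_integral_swap]
  have hm2 : Measurable fun z : (ι → E) × E => f (s.piecewise z.1 (Function.update x j z.2)) :=
    hf.comp ((measurable_piecewise_prod s).comp
      (((measurable_update_prod j).comp (measurable_const.prodMk measurable_snd)).prodMk
        measurable_fst))
  exact integrable_of_abs_le hm2 fun z => hC _

/-- The range is enclosed in the interval of radius `d` about one value. Its length `2 d` makes the
constant worse than optimal by a factor of four, which is harmless here. -/
lemma hoeffding_exp {G : E → ℝ} {P : Measure E} [IsProbabilityMeasure P] (hG : Measurable G)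
    {d : ℝ} (hd : ∀ r r', |G r - G r'| ≤ d) (θ : ℝ) :
    ∫ r, Real.exp (θ * G r) ∂P ≤ Real.exp (θ * (∫ r, G r ∂P) + θ ^ 2 * d ^ 2 / 2) := by
  obtain ⟨r₀⟩ := nonempty_of_isProbabilityMeasure P
  have hd0 : 0 ≤ d := (abs_nonneg _).trans (hd r₀ r₀)
  have h := (hasSubgaussianMGF_of_mem_Icc (μ := P) (X := G) (a := G r₀ - d) (b := G r₀ + d)
    hG.aemeasurable (ae_of_all _ fun r => by
      have := abs_le.1 (hd r r₀)
      constructor <;> linarith)).mgf_le θ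
  simp only [mgf, mul_sub, Real.exp_sub] at h
  rw [integral_div, div_le_iff₀ (Real.exp_pos _), ← Real.exp_add] at h
  refine h.trans (Real.exp_le_exp.2 (le_of_eq ?_))
  have : ((‖G r₀ + d - (G r₀ - d)‖₊ / 2) ^ 2 : NNReal).toReal = d ^ 2 := by
    push_cast
    rw [Real.norm_eq_abs, show G r₀ + d - (G r₀ - d) = 2 * d by ring, abs_of_nonneg (by linarith)]
    ring
  rw [this]; ring

/-- Exponential moments of functions with bounded differences. -/
lemma integral_exp_piecewise_le {F : (ι → E) → ℝ} (hF : Measurable F) {C : ℝ}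
    (hC : ∀ x, |F x| ≤ C) {d : ℝ}
    (hd : ∀ j x r r', |F (Function.update x j r) - F (Function.update x j r')| ≤ d) (θ : ℝ)
    (s : Finset ι) (x : ι → E) :
    ∫ y, Real.exp (θ * F (s.piecewise y x)) ∂(Measure.pi ν) ≤
      Real.exp (θ * (∫ y, F (s.piecewise y x) ∂(Measure.pi ν)) + s.card * (θ ^ 2 * d ^ 2 / 2)) := by
  induction s using Finset.induction_on generalizing x with
  | empty => simp
  | insert j s hj ih =>
    have hEm : Measurable fun x => Real.exp (θ * F x) := (hF.const_mul θ).exp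
    have hEC : ∀ x, |Real.exp (θ * F x)| ≤ Real.exp (|θ| * C) := fun x => by
      rw [Real.abs_exp]
      refine Real.exp_le_exp.2 ((le_abs_self _).trans ?_)
      rw [abs_mul]; gcongr; exact hC x
    rw [integral_piecewise_insert ν hj hEm hEC, integral_piecewise_insert ν hj hF hC]
    set G : E → ℝ := fun r => ∫ y, F (s.piecewise y (Function.update x j r)) ∂(Measure.pi ν)
    have hm2 : Measurable fun z : E × (ι → E) => F (s.piecewise z.2 (Function.update x j z.1)) :=
      hF.comp ((measurable_piecewise_prod s).comp
        (((measurable_update_prod j).comp (measurable_const.prodMk measurable_fst)).prodMk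
          measurable_snd))
    have hGm : Measurable G := hm2.stronglyMeasurable.integral_prod_right.measurable
    have hFi : ∀ r, Integrable (fun y => F (s.piecewise y (Function.update x j r)))
        (Measure.pi ν) := fun r =>
      integrable_of_abs_le (hm2.comp (measurable_const.prodMk measurable_id)) fun y => hC _
    have hGd : ∀ r r', |G r - G r'| ≤ d := by
      intro r r'
      simp only [G]
      rw [← integral_sub (hFi r) (hFi r')]
      refine abs_integral_le_integral_abs.trans ?_
      have e : ∀ (y : ι → E) (r : E), s.piecewise y (Function.update x j r) =
          Function.update (s.piecewise y x) j r := by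
        intro y r
        ext i
        by_cases hi : i = j
        · subst hi; simp [hj]
        · by_cases his : i ∈ s <;> simp [hi, his]
      refine (integral_mono ((hFi r).sub (hFi r')).abs (integrable_const d) fun y => ?_).trans
        (by simp)
      simp only [e]
      exact hd j _ r r'
    have hGC : ∀ r, |G r| ≤ C := fun r =>
      abs_integral_le_integral_abs.trans ((integral_mono (hFi r).abs (integrable_const C)
        fun y => hC _).trans (by simp))
    have h1 := hoeffding_exp (P := ν j) hGm hGd θ
    rw [Finset.card_insert_of_notMem hj]
    calc _ ≤ ∫ r, Real.exp (θ * G r) * Real.exp (s.card * (θ ^ 2 * d ^ 2 / 2)) ∂(ν j) := by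
          refine integral_mono_of_nonneg
            (ae_of_all _ fun r => integral_nonneg fun y => (Real.exp_pos _).le)
            (Integrable.mul_const (integrable_of_abs_le (hGm.const_mul θ).exp
              (C := Real.exp (|θ| * C)) fun r => ?_) _) (ae_of_all _ fun r => ?_)
          · rw [Real.abs_exp]
            refine Real.exp_le_exp.2 ((le_abs_self _).trans ?_)
            rw [abs_mul]; gcongr; exact hGC r
          · simp only [← Real.exp_add]
            exact ih _
      _ = (∫ r, Real.exp (θ * G r) ∂(ν j)) * Real.exp (s.card * (θ ^ 2 * d ^ 2 / 2)) :=
          integral_mul_const _ _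
      _ ≤ Real.exp (θ * (∫ r, G r ∂(ν j)) + θ ^ 2 * d ^ 2 / 2) *
          Real.exp (s.card * (θ ^ 2 * d ^ 2 / 2)) := by gcongr
      _ = _ := by
          rw [← Real.exp_add]; congr 1; push_cast; ring

/-- McDiarmid's bounded differences inequality. -/
theorem measureReal_ge_le_of_bounded_differences {F : (ι → E) → ℝ} (hF : Measurable F) {C : ℝ}
    (hC : ∀ x, |F x| ≤ C) {d : ℝ} (hd0 : 0 < d) (hι : 0 < Fintype.card ι)
    (hd : ∀ j x r r', |F (Function.update x j r) - F (Function.update x j r')| ≤ d)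
    {t : ℝ} (ht : 0 ≤ t) :
    (Measure.pi ν).real {x | (∫ y, F y ∂(Measure.pi ν)) + t ≤ F x} ≤
      Real.exp (-(t ^ 2 / (2 * Fintype.card ι * d ^ 2))) := by
  obtain ⟨x₀⟩ := nonempty_of_isProbabilityMeasure (Measure.pi ν)
  set K : ℝ := ((Fintype.card ι : ℕ) : ℝ) with hK
  have hK0 : 0 < K := by rw [hK]; exact_mod_cast hι
  -- Minimizer of `-θ t + K θ² d² / 2`.
  set θ : ℝ := t / (K * d ^ 2) with hθ
  have hθ0 : 0 ≤ θ := by positivity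
  set a := ∫ y, F y ∂(Measure.pi ν)
  have h1 := integral_exp_piecewise_le ν hF hC hd θ Finset.univ x₀
  simp only [Finset.piecewise_univ, Finset.card_univ, ← hK] at h1
  change _ ≤ Real.exp (θ * a + _) at h1
  have hEi : Integrable (fun x => Real.exp (θ * F x)) (Measure.pi ν) :=
    integrable_of_abs_le (hF.const_mul θ).exp (C := Real.exp (|θ| * C)) fun x => by
      rw [Real.abs_exp]
      refine Real.exp_le_exp.2 ((le_abs_self _).trans ?_)
      rw [abs_mul]; gcongr; exact hC x
  have h2 := mul_meas_ge_le_integral_of_nonneg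
    (ae_of_all (Measure.pi ν) fun x => (Real.exp_pos (θ * F x)).le) hEi (Real.exp (θ * (a + t)))
  have hsub : (Measure.pi ν).real {x | a + t ≤ F x} ≤
      (Measure.pi ν).real {x | Real.exp (θ * (a + t)) ≤ Real.exp (θ * F x)} :=
    measureReal_mono fun x hx => Real.exp_le_exp.2 (mul_le_mul_of_nonneg_left hx hθ0)
  have h3 : Real.exp (θ * (a + t)) * (Measure.pi ν).real {x | a + t ≤ F x} ≤
      Real.exp (θ * a + K * (θ ^ 2 * d ^ 2 / 2)) :=
    (mul_le_mul_of_nonneg_left hsub (Real.exp_pos _).le).trans (h2.trans h1)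
  rw [← le_div_iff₀' (Real.exp_pos _), ← Real.exp_sub] at h3
  refine h3.trans (Real.exp_le_exp.2 (le_of_eq ?_))
  rw [hθ]; field_simp; ring

end Resampling

/-! ### Measurability of inverses and traces -/

section MatrixMeasurability

variable {α : Type*} [MeasurableSpace α] {n : ℕ}

/-- Entrywise measurability of a matrix-valued function. -/
def EntriesMeasurable (A : α → Matrix (Fin n) (Fin n) ℝ) : Prop :=
  ∀ i j, Measurable fun a => A a i j

namespace EntriesMeasurable

variable {A B : α → Matrix (Fin n) (Fin n) ℝ}

lemma mul (hA : EntriesMeasurable A) (hB : EntriesMeasurable B) :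
    EntriesMeasurable fun a => A a * B a := fun i j => by
  simp only [Matrix.mul_apply]
  exact Finset.measurable_fun_sum _ fun k _ => (hA i k).mul (hB k j)

lemma pow (hA : EntriesMeasurable A) (k : ℕ) : EntriesMeasurable fun a => A a ^ k := by
  induction k with
  | zero => intro i j; simp only [pow_zero]; exact measurable_const
  | succ k ih => simp only [pow_succ]; exact ih.mul hA

lemma trace (hA : EntriesMeasurable A) : Measurable fun a => (A a).trace :=
  Finset.measurable_fun_sum _ fun i _ => hA i i

/-- The adjugate formula for the inverse also holds at singular matrices, where both sides vanish by
convention. -/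
lemma inv (hA : EntriesMeasurable A) : EntriesMeasurable fun a => (A a)⁻¹ := fun i j => by
  have hA' : Measurable (fun a i j => A a i j) :=
    measurable_pi_iff.2 fun i => measurable_pi_iff.2 fun j => hA i j
  have hdet : Measurable fun a => (A a).det := by
    have hc : Continuous fun M : Fin n → Fin n → ℝ => (Matrix.of M).det := by
      have : Continuous fun M : Matrix (Fin n) (Fin n) ℝ => M.det := Continuous.matrix_det continuous_id
      exact this
    exact hc.measurable.comp hA'
  have hadj : Measurable fun a => (A a).adjugate i j := by
    have hc : Continuous fun M : Fin n → Fin n → ℝ => (Matrix.of M).adjugate i j := by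
      have : Continuous fun M : Matrix (Fin n) (Fin n) ℝ => M.adjugate i j :=
        (Continuous.matrix_adjugate continuous_id).matrix_elem i j
      exact this
    exact hc.measurable.comp hA'
  have e : (fun a => (A a)⁻¹ i j) = fun a => ((A a).det)⁻¹ * (A a).adjugate i j := by
    ext a
    rw [Matrix.inv_def, Ring.inverse_eq_inv', Matrix.smul_apply, smul_eq_mul]
  rw [e]
  exact hdet.inv.mul hadj

end EntriesMeasurable

end MatrixMeasurability

/-! ### Decay of the inverse-power potential as rows are added -/

section RowGram

variable {ι : Type*} {n : ℕ}

/-- The sum of the rank-one matrices of the rows in `s`. -/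
def rowGram (s : Finset ι) (x : ι → Fin n → ℝ) : Matrix (Fin n) (Fin n) ℝ :=
  ∑ j ∈ s, Matrix.vecMulVec (x j) (x j)

lemma entriesMeasurable_add_rowGram (S₀ : Matrix (Fin n) (Fin n) ℝ) (s : Finset ι) :
    EntriesMeasurable fun x : ι → Fin n → ℝ => S₀ + rowGram s x := fun i j => by
  simp only [rowGram, Matrix.add_apply, Matrix.sum_apply, Matrix.vecMulVec_apply]
  fun_prop

lemma dotProduct_rowGram_mulVec (s : Finset ι) (x : ι → Fin n → ℝ) (v : Fin n → ℝ) :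
    v ⬝ᵥ (rowGram s x *ᵥ v) = ∑ j ∈ s, (x j ⬝ᵥ v) ^ 2 := by
  rw [rowGram, Matrix.sum_mulVec, dotProduct_sum]
  refine Finset.sum_congr rfl fun j _ => ?_
  rw [Matrix.vecMulVec_mulVec, op_smul_eq_smul, dotProduct_smul, smul_eq_mul,
    dotProduct_comm v, sq]

lemma isHermitian_rowGram (s : Finset ι) (x : ι → Fin n → ℝ) : (rowGram s x).IsHermitian := by
  ext i j
  simp [rowGram, Matrix.sum_apply, Matrix.vecMulVec_apply, mul_comm]

lemma FormGE.add_rowGram {z : ℝ} {S₀ : Matrix (Fin n) (Fin n) ℝ} (h : FormGE z S₀)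
    (s : Finset ι) (x : ι → Fin n → ℝ) : FormGE z (S₀ + rowGram s x) := by
  refine ⟨h.1.add (isHermitian_rowGram s x), fun v => ?_⟩
  rw [Matrix.add_mulVec, dotProduct_add, dotProduct_rowGram_mulVec]
  have := Finset.sum_nonneg fun j (_ : j ∈ s) => sq_nonneg (x j ⬝ᵥ v)
  linarith [h.2 v]

lemma le_add_rowGram (S₀ : Matrix (Fin n) (Fin n) ℝ) (s : Finset ι) (x : ι → Fin n → ℝ)
    (v : Fin n → ℝ) : v ⬝ᵥ (S₀ *ᵥ v) ≤ v ⬝ᵥ ((S₀ + rowGram s x) *ᵥ v) := by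
  rw [Matrix.add_mulVec, dotProduct_add, dotProduct_rowGram_mulVec]
  have := Finset.sum_nonneg fun j (_ : j ∈ s) => sq_nonneg (x j ⬝ᵥ v)
  linarith

lemma rowGram_insert_update [DecidableEq ι] {s : Finset ι} {j : ι} (hj : j ∉ s)
    (x : ι → Fin n → ℝ) (r : Fin n → ℝ) :
    rowGram (insert j s) (Function.update x j r) = rowGram s x + Matrix.vecMulVec r r := by
  rw [rowGram, Finset.sum_insert hj, Function.update_self, add_comm]
  congr 1
  refine Finset.sum_congr rfl fun i hi => ?_
  rw [Function.update_of_ne (ne_of_mem_of_not_mem hi hj)]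

/-- Some eigenvalue is at most `t`, because the quadratic form is an average of eigenvalues; its
term alone gives the bound. -/
lemma FormGE.le_trace_inv_pow {z t : ℝ} (hz : 0 < z) {S : Matrix (Fin n) (Fin n) ℝ}
    (h : FormGE z S) (m : ℕ) {v : Fin n → ℝ} (hv : v ⬝ᵥ v = 1) (ht : v ⬝ᵥ (S *ᵥ v) ≤ t) :
    t⁻¹ ^ m ≤ (S⁻¹ ^ m).trace := by
  obtain ⟨U, d, hU, hU', hS, hd, hk⟩ := h.exists_spectral_inv hz
  have hex : ∃ i, d i ≤ t := by
    by_contra! hcon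
    have h1 : ∑ i, t * (Uᵀ *ᵥ v) i ^ 2 < ∑ i, d i * (Uᵀ *ᵥ v) i ^ 2 := by
      have hs := sum_sq_transpose_mulVec hU' v
      rw [hv] at hs
      obtain ⟨i, -, hi⟩ := Finset.exists_ne_zero_of_sum_ne_zero (hs.trans_ne one_ne_zero)
      refine Finset.sum_lt_sum (fun j _ => mul_le_mul_of_nonneg_right (hcon j).le (sq_nonneg _))
        ⟨i, Finset.mem_univ i, mul_lt_mul_of_pos_right (hcon i) ?_⟩
      exact lt_of_le_of_ne (sq_nonneg _) hi.symm
    rw [← Finset.mul_sum, sum_sq_transpose_mulVec hU', hv, ← dotProduct_conjDiag_mulVec, ← hS] at h1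
    linarith
  obtain ⟨i, hi⟩ := hex
  have hdi : 0 < d i := hz.trans_le (hd i)
  rw [hk, trace_conjDiag hU]
  calc t⁻¹ ^ m ≤ (d i)⁻¹ ^ m := by gcongr; exact inv_nonneg.2 (hdi.le.trans hi)
    _ ≤ _ := Finset.single_le_sum (f := fun i => (d i)⁻¹ ^ m)
      (fun j _ => pow_nonneg (inv_nonneg.2 (hz.le.trans (hd j))) m) (Finset.mem_univ i)

variable [Fintype ι] [DecidableEq ι] {ν : ι → Measure (Fin n → ℝ)}
  [∀ i, IsProbabilityMeasure (ν i)] {H : ℝ}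

lemma FormGE.integrable_trace_inv_pow {L : ℝ} (hL : 0 < L) {S₀ : Matrix (Fin n) (Fin n) ℝ}
    (hS₀ : FormGE L S₀) (m : ℕ) (s : Finset ι) :
    Integrable (fun x => ((S₀ + rowGram s x)⁻¹ ^ m).trace) (Measure.pi ν) :=
  integrable_of_abs_le ((entriesMeasurable_add_rowGram S₀ s).inv.pow m).trace
    (C := n * L⁻¹ ^ m) fun x => by
      have h := hS₀.add_rowGram s x
      rw [abs_of_nonneg (h.trace_inv_pow_nonneg hL m)]
      simpa using h.trace_inv_pow_le hL m

/-- Decay of the potential `tr S⁻ᵐ` as random rows are added. -/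
lemma integral_trace_inv_pow_le (hν : ∀ j, IsUnitRow (ν j) H) (hH : 0 ≤ H)
    {S₀ : Matrix (Fin n) (Fin n) ℝ} {L σ : ℝ} {m : ℕ} (hL : 0 < L) (hS₀ : FormGE L S₀)
    (hσ : 0 < σ) (hσ1 : 2 * (S₀⁻¹.trace + (2 + H) / L) ≤ σ) (hσ2 : (m + 1) * σ ≤ 1 / 2)
    (hmL : (m + 1) / 6 ≤ L) (s : Finset ι) :
    ∫ x, ((S₀ + rowGram s x)⁻¹ ^ m).trace ∂(Measure.pi ν) ≤
      n * ((L + s.card / 6)⁻¹) ^ m := by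
  induction s using Finset.induction_on with
  | empty =>
    simp only [rowGram, Finset.sum_empty, add_zero, integral_const, probReal_univ, one_smul,
      Finset.card_empty, Nat.cast_zero, zero_div]
    simpa using hS₀.trace_inv_pow_le hL m
  | insert j s hj ih =>
    rw [integral_pi_update ν j (hS₀.integrable_trace_inv_pow hL m _)]
    simp_rw [rowGram_insert_update hj, ← add_assoc]
    set y : ℝ := L + s.card / 6
    have hy : 0 < y := by positivity
    have hy1 : 1 / 6 * y⁻¹ ≤ 1 := by
      rw [← div_eq_mul_inv, div_le_one hy]
      have : (0 : ℝ) ≤ m := by positivity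
      have : (0 : ℝ) ≤ s.card / 6 := by positivity
      simp only [y]; linarith
    have hcoef : 0 ≤ 1 - (m + 1) * y⁻¹ / 6 := by
      rw [sub_nonneg, mul_div_right_comm, ← div_eq_mul_inv, div_le_one hy]
      have : (0 : ℝ) ≤ s.card / 6 := by positivity
      simp only [y]; linarith
    have hVi := hS₀.integrable_trace_inv_pow (ν := ν) hL m s
    -- The tangent point `1 / y` is the reciprocal of the current predicted least eigenvalue. The
    -- rest is `(1 - m / (6y)) ≤ (1 - 1 / (6y)) ^ m ≤ (y / (y + 1/6)) ^ m`.
    calc _ ≤ ∫ x, ((1 - (m + 1) * y⁻¹ / 6) * ((S₀ + rowGram s x)⁻¹ ^ m).trace +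
            n * y⁻¹ ^ (m + 1) / 6) ∂(Measure.pi ν) := by
          refine integral_mono_of_nonneg (ae_of_all _ fun x => integral_nonneg fun r => ?_)
            ((hVi.const_mul _).add (integrable_const _)) (ae_of_all _ fun x => ?_)
          · exact ((hS₀.add_rowGram s x).add_vecMulVec r).trace_inv_pow_nonneg hL m
          · exact (hν j).integral_trace_update_le hH hL (hS₀.add_rowGram s x) hS₀
              (le_add_rowGram S₀ s x) hσ hσ1 hσ2 (inv_pos.2 hy)
      _ = (1 - (m + 1) * y⁻¹ / 6) * (∫ x, ((S₀ + rowGram s x)⁻¹ ^ m).trace ∂(Measure.pi ν)) +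
            n * y⁻¹ ^ (m + 1) / 6 := by
          rw [integral_add (hVi.const_mul _) (integrable_const _), integral_const_mul]; simp
      _ ≤ (1 - (m + 1) * y⁻¹ / 6) * (n * y⁻¹ ^ m) + n * y⁻¹ ^ (m + 1) / 6 := by gcongr
      _ = n * (y⁻¹ ^ m * (1 + m * (-(1 / 6 * y⁻¹)))) := by rw [pow_succ]; ring
      _ ≤ n * (y⁻¹ ^ m * (1 + -(1 / 6 * y⁻¹)) ^ m) := by
          gcongr
          exact one_add_mul_le_pow (by linarith) m
      _ ≤ n * ((L + (insert j s).card / 6)⁻¹) ^ m := by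
          rw [← mul_pow, Finset.card_insert_of_notMem hj]
          have e : L + ((s.card + 1 : ℕ) : ℝ) / 6 = y + 1 / 6 := by
            simp only [y]; push_cast; ring
          rw [e]
          gcongr
          · exact mul_nonneg (inv_nonneg.2 hy.le) (by linarith)
          · rw [← one_div (y + 1 / 6), le_div_iff₀ (by positivity)]
            have h1 : y⁻¹ * (1 + -(1 / 6 * y⁻¹)) * (y + 1 / 6) = 1 - (1 / 6 * y⁻¹) ^ 2 := by
              field_simp; ring
            rw [h1]; nlinarith [sq_nonneg (1 / 6 * y⁻¹)]

/-- Lower tail of the smallest eigenvalue after adding random rows to `S₀`. -/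
theorem measureReal_exists_form_le (hν : ∀ j, IsUnitRow (ν j) H) (hH : 0 ≤ H)
    {S₀ : Matrix (Fin n) (Fin n) ℝ} {L σ t : ℝ} {m : ℕ} (hL : 0 < L) (hS₀ : FormGE L S₀)
    (hσ : 0 < σ) (hσ1 : 2 * (S₀⁻¹.trace + (2 + H) / L) ≤ σ) (hσ2 : (m + 1) * σ ≤ 1 / 2)
    (hmL : (m + 1) / 6 ≤ L) (s : Finset ι) (ht : 0 < t) :
    (Measure.pi ν).real {x | ∃ v : Fin n → ℝ, v ⬝ᵥ v = 1 ∧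
      v ⬝ᵥ ((S₀ + rowGram s x) *ᵥ v) ≤ t} ≤ n * (t / (L + s.card / 6)) ^ m := by
  have h1 := mul_meas_ge_le_integral_of_nonneg
    (ae_of_all (Measure.pi ν) fun x => (hS₀.add_rowGram s x).trace_inv_pow_nonneg hL m)
    (hS₀.integrable_trace_inv_pow (ν := ν) hL m s) (t⁻¹ ^ m)
  have hsub : (Measure.pi ν).real {x | ∃ v : Fin n → ℝ, v ⬝ᵥ v = 1 ∧
      v ⬝ᵥ ((S₀ + rowGram s x) *ᵥ v) ≤ t} ≤
      (Measure.pi ν).real {x | t⁻¹ ^ m ≤ ((S₀ + rowGram s x)⁻¹ ^ m).trace} := by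
    refine measureReal_mono ?_
    rintro x ⟨v, hv, hvt⟩
    exact (hS₀.add_rowGram s x).le_trace_inv_pow hL m hv hvt
  have h2 := (mul_le_mul_of_nonneg_left hsub (show 0 ≤ t⁻¹ ^ m by positivity)).trans
    (h1.trans (integral_trace_inv_pow_le hν hH hL hS₀ hσ hσ1 hσ2 hmL s))
  rw [div_eq_mul_inv, mul_pow]
  calc _ = t ^ m * (t⁻¹ ^ m * (Measure.pi ν).real {x | ∃ v : Fin n → ℝ, v ⬝ᵥ v = 1 ∧
      v ⬝ᵥ ((S₀ + rowGram s x) *ᵥ v) ≤ t}) := by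
        rw [← mul_assoc, ← mul_pow, mul_inv_cancel₀ ht.ne', one_pow, one_mul]
    _ ≤ t ^ m * (n * (L + s.card / 6)⁻¹ ^ m) := by gcongr
    _ = _ := by ring

end RowGram

/-! ### The self-consistent equation for the trace of the resolvent -/

section SelfConsistent

variable {ι : Type*} {n : ℕ}

lemma formGE_smul_one (z : ℝ) : FormGE z (z • (1 : Matrix (Fin n) (Fin n) ℝ)) := by
  refine ⟨?_, fun x => ?_⟩
  · ext i j
    simp [Matrix.one_apply, eq_comm]
  · rw [Matrix.smul_mulVec, Matrix.one_mulVec, dotProduct_smul, smul_eq_mul]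

/-- The trace of the resolvent of `rowGram s x` at `-z`. -/
noncomputable def resolventTrace (z : ℝ) (s : Finset ι) (x : ι → Fin n → ℝ) : ℝ :=
  ((z • (1 : Matrix (Fin n) (Fin n) ℝ) + rowGram s x)⁻¹).trace

lemma resolventTrace_nonneg {z : ℝ} (hz : 0 < z) (s : Finset ι) (x : ι → Fin n → ℝ) :
    0 ≤ resolventTrace z s x := by
  simpa [resolventTrace] using ((formGE_smul_one z).add_rowGram s x).trace_inv_pow_nonneg hz 1

lemma resolventTrace_le {z : ℝ} (hz : 0 < z) (s : Finset ι) (x : ι → Fin n → ℝ) :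
    resolventTrace z s x ≤ n * z⁻¹ := by
  simpa [resolventTrace] using ((formGE_smul_one z).add_rowGram s x).trace_inv_pow_le hz 1

lemma measurable_resolventTrace (z : ℝ) (s : Finset ι) :
    Measurable fun x : ι → Fin n → ℝ => resolventTrace z s x :=
  (entriesMeasurable_add_rowGram _ s).inv.trace

lemma integrable_resolventTrace [Fintype ι] {ν : ι → Measure (Fin n → ℝ)}
    [∀ i, IsProbabilityMeasure (ν i)] {z : ℝ} (hz : 0 < z) (s : Finset ι) :
    Integrable (fun x => resolventTrace z s x) (Measure.pi ν) :=
  integrable_of_abs_le (measurable_resolventTrace z s) (C := n * z⁻¹) fun x => by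
    rw [abs_of_nonneg (resolventTrace_nonneg hz s x)]; exact resolventTrace_le hz s x

variable [DecidableEq ι]

lemma rowGram_erase_add {s : Finset ι} {j : ι} (hj : j ∈ s) (x : ι → Fin n → ℝ) :
    rowGram s x = rowGram (s.erase j) x + Matrix.vecMulVec (x j) (x j) := by
  simp only [rowGram]
  rw [Finset.sum_erase_add _ _ hj]

/-- Changing one row changes the trace of the resolvent by at most `1 / z`. -/
lemma abs_resolventTrace_update_sub_le {z : ℝ} (hz : 0 < z) (s : Finset ι) (j : ι)
    (x : ι → Fin n → ℝ) (r r' : Fin n → ℝ) :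
    |resolventTrace z s (Function.update x j r) - resolventTrace z s (Function.update x j r')| ≤
      z⁻¹ := by
  by_cases hj : j ∈ s
  · have h0 := (formGE_smul_one (n := n) z).add_rowGram (s.erase j) x
    have h1 := h0.trace_inv_sub_le hz r
    have h2 := h0.trace_inv_sub_le hz r'
    have e : ∀ r, resolventTrace z s (Function.update x j r) =
        ((z • (1 : Matrix (Fin n) (Fin n) ℝ) + rowGram (s.erase j) x +
          Matrix.vecMulVec r r)⁻¹).trace := fun r => by
      rw [resolventTrace, add_assoc, ← rowGram_insert_update (Finset.notMem_erase j s),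
        Finset.insert_erase hj]
    rw [e, e, abs_le]
    constructor <;> linarith
  · have e : ∀ r, rowGram s (Function.update x j r) = rowGram s x := fun r =>
      Finset.sum_congr rfl fun i hi => by
        rw [Function.update_of_ne (ne_of_mem_of_not_mem hi hj)]
    simp only [resolventTrace, e, sub_self, abs_zero]
    exact inv_nonneg.2 hz.le

lemma abs_div_one_add_sub_le {a b : ℝ} (ha : 0 ≤ a) (hb : 0 ≤ b) :
    |a / (1 + a) - b / (1 + b)| ≤ |a - b| := by
  have e : a / (1 + a) - b / (1 + b) = (a - b) / ((1 + a) * (1 + b)) := by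
    field_simp; ring
  rw [e, abs_div]
  refine div_le_self (abs_nonneg _) ?_
  rw [abs_of_nonneg (by positivity)]
  nlinarith [mul_nonneg ha hb]

/-- The approximate self-consistent equation, pointwise. -/
lemma abs_selfConsistent_le {z : ℝ} (hz : 0 < z) (s : Finset ι) (x : ι → Fin n → ℝ) :
    |z * resolventTrace z s x + s.card * (resolventTrace z s x / (1 + resolventTrace z s x)) - n| ≤
      ∑ j ∈ s, (z⁻¹ + |x j ⬝ᵥ ((z • (1 : Matrix (Fin n) (Fin n) ℝ) +
        rowGram (s.erase j) x)⁻¹ *ᵥ x j) - resolventTrace z (s.erase j) x|) := by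
  set φ := resolventTrace z s x with hφ
  have hφ0 : 0 ≤ φ := resolventTrace_nonneg hz s x
  have hS := (formGE_smul_one (n := n) z).add_rowGram s x
  set S := z • (1 : Matrix (Fin n) (Fin n) ℝ) + rowGram s x with hSdef
  let q : ι → ℝ := fun j => x j ⬝ᵥ ((z • (1 : Matrix (Fin n) (Fin n) ℝ) +
        rowGram (s.erase j) x)⁻¹ *ᵥ x j)
  have hq0 : ∀ j, 0 ≤ q j := fun j => by
    simpa using ((formGE_smul_one (n := n) z).add_rowGram (s.erase j) x).inv_pow_nonneg hz 1 (x j)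
  -- Take the trace of `S S⁻¹ = 1` and remove row `j` from the resolvent by Sherman–Morrison.
  have hid : (n : ℝ) - z * φ = ∑ j ∈ s, q j / (1 + q j) := by
    have h1 : (S * S⁻¹).trace = n := by rw [hS.mul_inv hz]; simp
    rw [hSdef, add_mul, Matrix.trace_add, smul_mul_assoc, one_mul, Matrix.trace_smul,
      smul_eq_mul, ← hSdef] at h1
    have h2 : (rowGram s x * S⁻¹).trace = ∑ j ∈ s, q j / (1 + q j) := by
      rw [rowGram, Finset.sum_mul, Matrix.trace_sum]
      refine Finset.sum_congr rfl fun j hj => ?_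
      have h0 := (formGE_smul_one (n := n) z).add_rowGram (s.erase j) x
      have hu := h0.update_inv_mulVec hz (x j)
      rw [add_assoc, ← rowGram_erase_add hj, ← hSdef] at hu
      have hu2 : q j = (1 + q j) * (x j ⬝ᵥ (S⁻¹ *ᵥ x j)) := by
        have := congrArg (fun v => x j ⬝ᵥ v) hu
        simpa [dotProduct_smul, q] using this
      have h1q : 1 + q j ≠ 0 := by linarith [hq0 j]
      rw [Matrix.trace_mul_comm, Matrix.mul_vecMulVec, Matrix.trace_vecMulVec, dotProduct_comm,
        eq_div_iff h1q, mul_comm]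
      exact hu2.symm
    have h3 : S⁻¹.trace = φ := rfl
    rw [h2, h3] at h1
    linarith
  have e : z * φ + s.card * (φ / (1 + φ)) - n = ∑ j ∈ s, (φ / (1 + φ) - q j / (1 + q j)) := by
    rw [Finset.sum_sub_distrib, ← hid, Finset.sum_const, nsmul_eq_mul]; ring
  rw [e]
  refine (Finset.abs_sum_le_sum_abs _ _).trans (Finset.sum_le_sum fun j hj => ?_)
  refine (abs_div_one_add_sub_le hφ0 (hq0 j)).trans ?_
  have h0 := (formGE_smul_one (n := n) z).add_rowGram (s.erase j) x
  have h1 := h0.trace_inv_sub_le hz (x j)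
  rw [add_assoc, ← rowGram_erase_add hj, ← hSdef] at h1
  have h2 : |φ - resolventTrace z (s.erase j) x| ≤ z⁻¹ := by
    rw [abs_sub_comm, resolventTrace, hφ, resolventTrace, ← hSdef, abs_of_nonneg h1.1]
    exact h1.2
  calc |φ - q j| ≤ |φ - resolventTrace z (s.erase j) x| + |resolventTrace z (s.erase j) x - q j| :=
        abs_sub_le _ _ _
    _ ≤ _ := by
        rw [abs_sub_comm (resolventTrace z (s.erase j) x)]
        gcongr

variable [Fintype ι] {ν : ι → Measure (Fin n → ℝ)} [∀ i, IsProbabilityMeasure (ν i)] {H : ℝ}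

/-- Without row `j` the resolvent does not depend on that row, so the row can be integrated out
first with the others fixed. -/
lemma integral_abs_quad_sub_resolventTrace_le (hν : ∀ j, IsUnitRow (ν j) H) (hH : 0 ≤ H) {z : ℝ}
    (hz : 0 < z) (s : Finset ι) (j : ι) :
    Integrable (fun x => |x j ⬝ᵥ ((z • (1 : Matrix (Fin n) (Fin n) ℝ) +
        rowGram (s.erase j) x)⁻¹ *ᵥ x j) - resolventTrace z (s.erase j) x|) (Measure.pi ν) ∧
    ∫ x, |x j ⬝ᵥ ((z • (1 : Matrix (Fin n) (Fin n) ℝ) +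
        rowGram (s.erase j) x)⁻¹ *ᵥ x j) - resolventTrace z (s.erase j) x| ∂(Measure.pi ν) ≤
      √((H + 2) * n) / z := by
  set t := s.erase j with ht
  have hjt : j ∉ t := Finset.notMem_erase j s
  have hR : ∀ x : ι → Fin n → ℝ, FormGE z (z • (1 : Matrix (Fin n) (Fin n) ℝ) + rowGram t x) :=
    fun x => (formGE_smul_one z).add_rowGram t x
  have hinv := (entriesMeasurable_add_rowGram (ι := ι) (z • (1 : Matrix (Fin n) (Fin n) ℝ)) t).inv
  have hqm : Measurable fun x : ι → Fin n → ℝ => x j ⬝ᵥ ((z • (1 : Matrix (Fin n) (Fin n) ℝ) +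
        rowGram t x)⁻¹ *ᵥ x j) := by
    simp only [dotProduct_mulVec_eq_sum]
    refine Finset.measurable_fun_sum _ fun a _ => Finset.measurable_fun_sum _ fun b _ => ?_
    exact (hinv a b).mul (by fun_prop)
  have hxi : Integrable (fun x : ι → Fin n → ℝ => x j ⬝ᵥ x j) (Measure.pi ν) := by
    have h1 := (hν j).integrable_quad 1
    simp only [Matrix.one_mulVec] at h1
    exact (measurePreserving_eval ν j).integrable_comp_of_integrable h1
  have hqi : Integrable (fun x : ι → Fin n → ℝ => x j ⬝ᵥ ((z • (1 : Matrix (Fin n) (Fin n) ℝ) +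
        rowGram t x)⁻¹ *ᵥ x j)) (Measure.pi ν) := by
    refine Integrable.mono' (hxi.const_mul z⁻¹) hqm.aestronglyMeasurable (ae_of_all _ fun x => ?_)
    have h0 : 0 ≤ x j ⬝ᵥ ((z • (1 : Matrix (Fin n) (Fin n) ℝ) + rowGram t x)⁻¹ *ᵥ x j) := by
      simpa using (hR x).inv_pow_nonneg hz 1 (x j)
    rw [Real.norm_eq_abs, abs_of_nonneg h0]
    simpa using (hR x).inv_pow_succ_le hz 0 (x j)
  have hi := (hqi.sub (integrable_resolventTrace (ν := ν) hz t)).abs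
  refine ⟨hi, ?_⟩
  have hu : ∀ (x : ι → Fin n → ℝ) (r : Fin n → ℝ),
      rowGram t (Function.update x j r) = rowGram t x := fun x r =>
    Finset.sum_congr rfl fun i hi => by
      rw [Function.update_of_ne (ne_of_mem_of_not_mem hi hjt)]
  have e := integral_pi_update ν j hi
  simp only [Pi.sub_apply] at e
  rw [e]
  simp only [resolventTrace, hu, Function.update_self]
  refine (integral_mono_of_nonneg (ae_of_all _ fun x => integral_nonneg fun r => abs_nonneg _)
    (integrable_const (√((H + 2) * n) / z)) (ae_of_all _ fun x => ?_)).trans (by simp)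
  exact (hν j).integral_abs_quad_sub_le hH hz (hR x)

/-- The trace of the resolvent is close in mean to the root of the limiting equation. -/
theorem integral_abs_resolventTrace_sub_le (hν : ∀ j, IsUnitRow (ν j) H) (hH : 0 ≤ H) {κ : ℝ}
    (hκ : 0 < κ) {s : Finset ι} (hs : 0 < s.card) {y φ : ℝ} (hφ : 0 ≤ φ)
    (hφy : κ * φ + φ / (1 + φ) = y) :
    ∫ x, |resolventTrace (κ * s.card) s x - φ| ∂(Measure.pi ν) ≤
      ((1 + √((H + 2) * n)) / (κ * s.card) + |(n : ℝ) / s.card - y|) / κ := by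
  have hsR : (0 : ℝ) < s.card := by exact_mod_cast hs
  set z : ℝ := κ * s.card
  have hz : 0 < z := by positivity
  set q : ι → (ι → Fin n → ℝ) → ℝ := fun j x => |x j ⬝ᵥ ((z • (1 : Matrix (Fin n) (Fin n) ℝ) +
        rowGram (s.erase j) x)⁻¹ *ᵥ x j) - resolventTrace z (s.erase j) x|
  have hq : ∀ j, Integrable (q j) (Measure.pi ν) ∧
      ∫ x, q j x ∂(Measure.pi ν) ≤ √((H + 2) * n) / z :=
    fun j => integral_abs_quad_sub_resolventTrace_le hν hH hz s j
  have hqi : ∀ j, Integrable (fun x => z⁻¹ + q j x) (Measure.pi ν) :=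
    fun j => (integrable_const _).add (hq j).1
  have hpt : ∀ x : ι → Fin n → ℝ, |resolventTrace z s x - φ| ≤
      (1 / (κ * s.card)) * (∑ j ∈ s, (z⁻¹ + q j x)) + |(n : ℝ) / s.card - y| / κ := by
    intro x
    have h1 := abs_selfConsistent_le hz s x
    have hf0 := resolventTrace_nonneg hz s x
    set f := resolventTrace z s x
    -- The equation is stable: its left side increases in `φ` with slope at least `κ`.
    have h2 : κ * |f - φ| ≤ |κ * f + f / (1 + f) - y| := by
      rw [← hφy]
      have e : κ * f + f / (1 + f) - (κ * φ + φ / (1 + φ)) =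
          (f - φ) * (κ + 1 / ((1 + f) * (1 + φ))) := by
        field_simp; ring
      rw [e, abs_mul, mul_comm]
      gcongr
      rw [abs_of_nonneg (by positivity)]
      have : 0 ≤ 1 / ((1 + f) * (1 + φ)) := by positivity
      linarith
    have h3 : |κ * f + f / (1 + f) - y| ≤
        (∑ j ∈ s, (z⁻¹ + q j x)) / s.card + |(n : ℝ) / s.card - y| := by
      have e : κ * f + f / (1 + f) - y = (z * f + s.card * (f / (1 + f)) - n) / s.card +
          ((n : ℝ) / s.card - y) := by
        simp only [z]; field_simp; ring
      rw [e]
      refine (abs_add_le _ _).trans ?_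
      rw [abs_div, abs_of_pos hsR]
      gcongr
    have h4 : κ * |f - φ| ≤ κ * ((1 / (κ * s.card)) * (∑ j ∈ s, (z⁻¹ + q j x)) +
        |(n : ℝ) / s.card - y| / κ) := by
      refine (h2.trans h3).trans (le_of_eq ?_)
      field_simp
    exact le_of_mul_le_mul_left h4 hκ
  have hsumi : Integrable (fun x => ∑ j ∈ s, (z⁻¹ + q j x)) (Measure.pi ν) :=
    integrable_finsetSum _ fun j _ => hqi j
  have hsum : ∫ x, ∑ j ∈ s, (z⁻¹ + q j x) ∂(Measure.pi ν) ≤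
      s.card * ((1 + √((H + 2) * n)) / z) := by
    rw [integral_finsetSum _ fun j _ => hqi j]
    refine (Finset.sum_le_card_nsmul _ _ _ fun j _ => ?_).trans (le_of_eq (nsmul_eq_mul _ _))
    rw [integral_add (integrable_const _) (hq j).1, integral_const, probReal_univ, one_smul,
      add_div, one_div]
    gcongr
    exact (hq j).2
  refine (integral_mono_of_nonneg (ae_of_all _ fun x => abs_nonneg _)
    ((hsumi.const_mul _).add (integrable_const _)) (ae_of_all _ hpt)).trans ?_
  simp only [Pi.add_apply]
  rw [integral_add (hsumi.const_mul _) (integrable_const _), integral_const_mul, integral_const,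
    probReal_univ, one_smul, add_div]
  gcongr
  calc _ ≤ (1 / (κ * s.card)) * (s.card * ((1 + √((H + 2) * n)) / z)) := by gcongr
    _ = _ := by simp only [z]; field_simp

end SelfConsistent

/-! ### A rational test function built from finite differences -/

section PartialFractions

/-- Alternating binomial sums are iterated differences. -/
lemma sum_alternating_choose_eq_fwdDiff (g : ℝ → ℝ) (m : ℕ) (y h : ℝ) :
    ∑ i ∈ Finset.range (m + 1), (-1) ^ i * (m.choose i) * g (y + i * h) =
      (-1) ^ m * (fwdDiff h)^[m] g y := by
  rw [fwdDiff_iter_eq_sum_shift, Finset.mul_sum]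
  refine Finset.sum_congr rfl fun i hi => ?_
  have hi' : i ≤ m := Nat.lt_succ_iff.1 (Finset.mem_range.1 hi)
  obtain ⟨l, rfl⟩ := Nat.exists_eq_add_of_le hi'
  rw [zsmul_eq_mul, nsmul_eq_mul, Nat.add_sub_cancel_left]
  push_cast
  have : ((-1 : ℝ) ^ l) * (-1) ^ l = 1 := by rw [← mul_pow]; simp
  rw [pow_add]
  linear_combination (-((-1) ^ i * ((i + l).choose i) * g (y + i * h))) * this

lemma fwdDiff_iter_inv {h : ℝ} (hh : 0 < h) (m : ℕ) {y : ℝ} (hy : 0 < y) :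
    (fwdDiff h)^[m] (fun x : ℝ => x⁻¹) y =
      (-1) ^ m * (m.factorial * h ^ m) / ∏ i ∈ Finset.range (m + 1), (y + i * h) := by
  induction m generalizing y with
  | zero => simp
  | succ m ih =>
    rw [Function.iterate_succ_apply', fwdDiff, ih hy, ih (show 0 < y + h by positivity)]
    have e1 : ∏ i ∈ Finset.range (m + 1 + 1), (y + i * h) =
        (∏ i ∈ Finset.range (m + 1), (y + h + i * h)) * y := by
      rw [Finset.prod_range_succ']
      simp only [Nat.cast_add, Nat.cast_one, Nat.cast_zero, zero_mul, add_zero]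
      congr 1
      exact Finset.prod_congr rfl fun i _ => by ring
    have e2 : ∏ i ∈ Finset.range (m + 1 + 1), (y + i * h) =
        (∏ i ∈ Finset.range (m + 1), (y + i * h)) * (y + (m + 1) * h) := by
      rw [Finset.prod_range_succ]; push_cast; rfl
    have hp0 : 0 < ∏ i ∈ Finset.range (m + 1), (y + i * h) :=
      Finset.prod_pos fun i _ => by positivity
    have hp1 : 0 < ∏ i ∈ Finset.range (m + 1), (y + h + i * h) :=
      Finset.prod_pos fun i _ => by positivity
    set P := ∏ i ∈ Finset.range (m + 1), (y + i * h)
    set P1 := ∏ i ∈ Finset.range (m + 1), (y + h + i * h)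
    rw [e2, Nat.factorial_succ]
    have e3 : P1 = P * (y + (m + 1) * h) / y := by
      rw [eq_div_iff hy.ne', ← e1, e2]
    rw [e3]
    have h3 : 0 < y + (m + 1) * h := by positivity
    push_cast
    field_simp
    ring

/-- The nodes of the partial fraction expansion. -/
noncomputable def pfNode (κ : ℝ) (m i : ℕ) : ℝ := κ + i * (κ / m)

lemma pfNode_mem {κ : ℝ} (hκ : 0 < κ) {m i : ℕ} (hm : 0 < m) (hi : i ∈ Finset.range (m + 1)) :
    κ ≤ pfNode κ m i ∧ pfNode κ m i ≤ 2 * κ := by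
  have hi' : (i : ℝ) ≤ m := by exact_mod_cast Nat.lt_succ_iff.1 (Finset.mem_range.1 hi)
  have hm' : (0 : ℝ) < m := by exact_mod_cast hm
  have h1 : (i : ℝ) * (κ / m) ≤ κ := by
    rw [mul_div_assoc', div_le_iff₀ hm']; nlinarith
  have h2 : 0 ≤ (i : ℝ) * (κ / m) := by positivity
  constructor <;> simp only [pfNode] <;> linarith

/-- The coefficients of the partial fraction expansion. -/
noncomputable def pfCoeff (κ : ℝ) (m i : ℕ) : ℝ :=
  κ ^ (m + 1) / (m.factorial * (κ / m) ^ m) * ((-1) ^ i * m.choose i)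

lemma pf_prefactor_eq {κ : ℝ} (hκ : 0 < κ) {m : ℕ} (hm : 0 < m) :
    κ ^ (m + 1) / (m.factorial * (κ / m) ^ m) = κ * (m ^ m / m.factorial) := by
  have hm' : (0 : ℝ) < m := by exact_mod_cast hm
  rw [div_pow, pow_succ]; field_simp

/-- The factor `e ^ m` bounds `m ^ m / m!`, and `2 ^ m` is the sum of the binomial coefficients. -/
lemma sum_abs_pfCoeff_le {κ : ℝ} (hκ : 0 < κ) {m : ℕ} (hm : 0 < m) :
    ∑ i ∈ Finset.range (m + 1), |pfCoeff κ m i| ≤ κ * (2 * Real.exp 1) ^ m := by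
  have h1 : ∀ i, |pfCoeff κ m i| = κ * (m ^ m / m.factorial) * m.choose i := fun i => by
    rw [pfCoeff, pf_prefactor_eq hκ hm, abs_mul, abs_mul ((-1) ^ i), abs_pow, abs_neg, abs_one,
      one_pow, one_mul, abs_of_nonneg (by positivity), Nat.abs_cast]
  simp_rw [h1]
  rw [← Finset.mul_sum]
  have h2 : ∑ i ∈ Finset.range (m + 1), ((m.choose i : ℕ) : ℝ) = 2 ^ m := by
    exact_mod_cast Nat.sum_range_choose m
  have h3 : (m : ℝ) ^ m / m.factorial ≤ Real.exp m :=
    Real.pow_div_factorial_le_exp _ (Nat.cast_nonneg m) m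
  rw [h2, mul_assoc, mul_pow, ← Real.exp_nat_mul, mul_one, mul_comm (2 ^ m)]
  gcongr

/-- The partial fraction expansion. -/
lemma sum_pfCoeff_mul_inv {κ : ℝ} (hκ : 0 < κ) {m : ℕ} (hm : 0 < m) {x : ℝ} (hx : 0 ≤ x) :
    ∑ i ∈ Finset.range (m + 1), pfCoeff κ m i * (x + pfNode κ m i)⁻¹ =
      κ ^ (m + 1) / ∏ i ∈ Finset.range (m + 1), (x + pfNode κ m i) := by
  have hm' : (0 : ℝ) < m := by exact_mod_cast hm
  have h1 := sum_alternating_choose_eq_fwdDiff (fun x => x⁻¹) m (x + κ) (κ / m)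
  rw [fwdDiff_iter_inv (by positivity) m (by positivity)] at h1
  have e : ∀ i : ℕ, x + pfNode κ m i = x + κ + i * (κ / m) := fun i => by rw [pfNode]; ring
  simp_rw [e, pfCoeff, mul_assoc _ ((-1 : ℝ) ^ _ * _)]
  rw [← Finset.mul_sum, h1]
  have hs : ((-1 : ℝ) ^ m) * (-1) ^ m = 1 := by rw [← mul_pow]; simp
  have hf : (0 : ℝ) < m.factorial * (κ / m) ^ m := by positivity
  rw [mul_div_assoc', ← mul_assoc ((-1 : ℝ) ^ m), hs, one_mul, div_mul_div_comm,
    mul_comm (_ * _) (∏ i ∈ _, _), mul_div_mul_right _ _ hf.ne']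

/-- All the `m + 1` factors `x + pfNode` lie below `3 κ` when `x ≤ κ`. -/
lemma le_sum_pfCoeff_mul_inv {κ : ℝ} (hκ : 0 < κ) {m : ℕ} (hm : 0 < m) {x : ℝ} (hx : 0 ≤ x)
    (hxκ : x ≤ κ) :
    (3 ^ (m + 1))⁻¹ ≤ ∑ i ∈ Finset.range (m + 1), pfCoeff κ m i * (x + pfNode κ m i)⁻¹ := by
  rw [sum_pfCoeff_mul_inv hκ hm hx]
  have hpos : 0 < ∏ i ∈ Finset.range (m + 1), (x + pfNode κ m i) :=
    Finset.prod_pos fun i hi => by linarith [(pfNode_mem hκ hm hi).1]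
  have hle : ∏ i ∈ Finset.range (m + 1), (x + pfNode κ m i) ≤ (3 * κ) ^ (m + 1) := by
    calc _ ≤ ∏ _i ∈ Finset.range (m + 1), 3 * κ :=
          Finset.prod_le_prod (fun i hi => by linarith [(pfNode_mem hκ hm hi).1])
            fun i hi => by linarith [(pfNode_mem hκ hm hi).2]
      _ = _ := by simp
  rw [le_div_iff₀ hpos, inv_mul_le_iff₀ (by positivity), ← mul_pow]
  exact hle

lemma sum_pfCoeff_mul_inv_nonneg {κ : ℝ} (hκ : 0 < κ) {m : ℕ} (hm : 0 < m) {x : ℝ} (hx : 0 ≤ x) :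
    0 ≤ ∑ i ∈ Finset.range (m + 1), pfCoeff κ m i * (x + pfNode κ m i)⁻¹ := by
  rw [sum_pfCoeff_mul_inv hκ hm hx]
  exact div_nonneg (by positivity)
    (Finset.prod_nonneg fun i hi => by linarith [(pfNode_mem hκ hm hi).1])

/-- Analytic functions are nearly annihilated by the partial fraction coefficients. -/
lemma exists_abs_sum_pfCoeff_le {φ : ℝ → ℝ} (hφ : AnalyticAt ℝ φ 0) :
    ∃ ρ C : ℝ, 0 < ρ ∧ 0 < C ∧ ∀ (κ : ℝ) (m : ℕ), 0 < κ → 0 < m → 2 * κ < ρ →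
      |∑ i ∈ Finset.range (m + 1), pfCoeff κ m i * φ (pfNode κ m i)| ≤
        κ * (2 * Real.exp 1) ^ m * (C * (2 * κ / ρ) ^ m) := by
  obtain ⟨p, r, hp⟩ := hφ
  obtain ⟨r', hr'0, hr'r⟩ := ENNReal.lt_iff_exists_nnreal_btwn.1 hp.r_pos
  obtain ⟨a, ha, C, hC, happ⟩ := hp.uniform_geometric_approx' hr'r
  have hr'0' : (0 : ℝ) < r' := by exact_mod_cast hr'0
  refine ⟨r', C, hr'0', hC, fun κ m hκ hm hκr => ?_⟩
  have hm' : (0 : ℝ) < m := by exact_mod_cast hm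
  -- The nodes are equally spaced and the coefficients are those of an `m`-th difference, which
  -- vanishes on polynomials of degree below `m`. Only the Taylor remainder of `φ` survives.
  have hzero : ∑ i ∈ Finset.range (m + 1), pfCoeff κ m i * p.partialSum m (pfNode κ m i) = 0 := by
    let q : Polynomial ℝ := ∑ k ∈ Finset.range m, Polynomial.C (p.coeff k) * Polynomial.X ^ k
    let q' := q.comp (Polynomial.C (κ / m) * Polynomial.X + Polynomial.C κ)
    have hq : ∀ y, p.partialSum m y = q.eval y := fun y => by
      simp only [FormalMultilinearSeries.partialSum, q, Polynomial.eval_finsetSum,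
        FormalMultilinearSeries.apply_eq_pow_smul_coeff]
      exact Finset.sum_congr rfl fun k _ => by
        simp only [Polynomial.eval_mul, Polynomial.eval_C, Polynomial.eval_pow, Polynomial.eval_X,
          smul_eq_mul]
        ring
    have hqd : q'.natDegree < m := by
      refine lt_of_le_of_lt (Polynomial.natDegree_comp_le) ?_
      have h1 : q.natDegree < m := by
        refine lt_of_le_of_lt (Polynomial.natDegree_sum_le_of_forall_le (n := m - 1) _ _
          fun k hk => ?_) (by omega)
        refine (Polynomial.natDegree_C_mul_X_pow_le _ _).trans ?_
        have := Finset.mem_range.1 hk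
        omega
      have h2 : (Polynomial.C (κ / m) * Polynomial.X + Polynomial.C κ : Polynomial ℝ).natDegree
          ≤ 1 := Polynomial.natDegree_linear_le
      calc _ ≤ q.natDegree * 1 := Nat.mul_le_mul_left _ h2
        _ < m := by simpa using h1
    have h0 := sum_alternating_choose_eq_fwdDiff (fun x => q'.eval x) m 0 1
    have h00 : (fwdDiff 1)^[m] (fun x => q'.eval x) 0 = 0 := by
      have := congrFun (Polynomial.fwdDiff_iter_eq_zero_of_degree_lt hqd) 0
      simpa using this
    rw [h00, mul_zero] at h0
    have e : ∀ i : ℕ, p.partialSum m (pfNode κ m i) = q'.eval (0 + (i : ℝ) * 1) := fun i => by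
      rw [hq, Polynomial.eval_comp]
      simp only [Polynomial.eval_add, Polynomial.eval_mul, Polynomial.eval_C, Polynomial.eval_X,
        pfNode]
      congr 1; ring
    simp_rw [e, pfCoeff, mul_assoc _ ((-1 : ℝ) ^ _ * _)]
    rw [← Finset.mul_sum, h0, mul_zero]
  have e2 : ∑ i ∈ Finset.range (m + 1), pfCoeff κ m i * φ (pfNode κ m i) =
      ∑ i ∈ Finset.range (m + 1), pfCoeff κ m i *
        (φ (pfNode κ m i) - p.partialSum m (pfNode κ m i)) := by
    simp only [mul_sub, Finset.sum_sub_distrib, hzero, sub_zero]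
  rw [e2]
  refine (Finset.abs_sum_le_sum_abs _ _).trans ?_
  calc _ ≤ ∑ i ∈ Finset.range (m + 1), |pfCoeff κ m i| * (C * (2 * κ / r') ^ m) := by
        refine Finset.sum_le_sum fun i hi => ?_
        rw [abs_mul]
        obtain ⟨h1, h2⟩ := pfNode_mem hκ hm hi
        have hb := happ (pfNode κ m i) (by
          rw [Metric.mem_ball, dist_zero_right, Real.norm_eq_abs, abs_of_nonneg (by linarith)]
          linarith) m
        rw [zero_add, Real.norm_eq_abs, Real.norm_eq_abs, abs_of_nonneg (a := pfNode κ m i)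
          (by linarith)] at hb
        gcongr
        refine hb.trans ?_
        have ha0 := ha.1.le
        have hn0 : 0 ≤ pfNode κ m i := by linarith
        gcongr
        calc a * (pfNode κ m i / r') ≤ 1 * (pfNode κ m i / r') := by gcongr; exact ha.2.le
          _ = pfNode κ m i / r' := one_mul _
          _ ≤ 2 * κ / r' := by gcongr
    _ = (∑ i ∈ Finset.range (m + 1), |pfCoeff κ m i|) * (C * (2 * κ / r') ^ m) := by
        rw [Finset.sum_mul]
    _ ≤ _ := by gcongr; exact sum_abs_pfCoeff_le hκ hm

end PartialFractions

/-! ### Counting small eigenvalues -/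

section LowCount

/-- The limiting equation for the normalized trace of the resolvent has a solution that is analytic
at the hard edge. -/
lemma exists_analyticAt_selfConsistent {y : ℝ} (hy0 : 0 < y) (hy1 : y < 1) :
    ∃ φ : ℝ → ℝ, AnalyticAt ℝ φ 0 ∧
      ∀ κ, 0 < κ → 0 ≤ φ κ ∧ κ * φ κ + φ κ / (1 + φ κ) = y := by
  -- The positive root of `κ f² + (κ + 1 - y) f = y`, rationalized so that its denominator at `κ =
  -- 0` is `2 (1 - y) > 0`.
  refine ⟨fun κ => 2 * y / (κ + 1 - y + √((κ + 1 - y) ^ 2 + 4 * κ * y)), ?_, fun κ hκ => ?_⟩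
  · have h1 : AnalyticAt ℝ (fun κ : ℝ => √((κ + 1 - y) ^ 2 + 4 * κ * y)) 0 := by
      have h0 : ((0 : ℝ) + 1 - y) ^ 2 + 4 * 0 * y ≠ 0 := by
        have : 0 < 1 - y := by linarith
        simpa using this.ne'
      have h2 : AnalyticAt ℝ (fun κ : ℝ => (κ + 1 - y) ^ 2 + 4 * κ * y) 0 := by fun_prop
      have h3 : AnalyticAt ℝ Real.sqrt (((0 : ℝ) + 1 - y) ^ 2 + 4 * 0 * y) :=
        (Real.contDiffAt_sqrt (n := ⊤) h0).analyticAt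
      exact AnalyticAt.fun_comp h3 h2
    refine AnalyticAt.div analyticAt_const (by fun_prop) ?_
    have := Real.sqrt_nonneg (((0 : ℝ) + 1 - y) ^ 2 + 4 * 0 * y)
    linarith
  · have hb : 0 < κ + 1 - y := by linarith
    have hR := Real.sqrt_nonneg ((κ + 1 - y) ^ 2 + 4 * κ * y)
    have hR2 := Real.sq_sqrt (show 0 ≤ (κ + 1 - y) ^ 2 + 4 * κ * y by positivity)
    simp only
    generalize √((κ + 1 - y) ^ 2 + 4 * κ * y) = R at hR hR2 ⊢
    have hD : 0 < κ + 1 - y + R := by linarith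
    have hφ : 0 ≤ 2 * y / (κ + 1 - y + R) := by positivity
    refine ⟨hφ, ?_⟩
    have hq : κ * (2 * y / (κ + 1 - y + R)) ^ 2 + (κ + 1 - y) * (2 * y / (κ + 1 - y + R)) = y := by
      field_simp
      linear_combination -hR2
    generalize 2 * y / (κ + 1 - y + R) = f at hφ hq
    have h1 : 1 + f ≠ 0 := by linarith
    field_simp
    linear_combination hq

variable {ι : Type*} {n : ℕ}

lemma resolventTrace_eq_sum {z : ℝ} (hz : 0 < z) (s : Finset ι) (x : ι → Fin n → ℝ)
    {U : Matrix (Fin n) (Fin n) ℝ} {d : Fin n → ℝ} (hU : Uᵀ * U = 1) (hU' : U * Uᵀ = 1)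
    (hd : ∀ l, 0 ≤ d l) (h : rowGram s x = conjDiag U d) :
    resolventTrace z s x = ∑ l, (z + d l)⁻¹ := by
  have e : z • (1 : Matrix (Fin n) (Fin n) ℝ) + rowGram s x = conjDiag U (fun l => z + d l) := by
    rw [h, ← conjDiag_const hU' z, conjDiag_add]
  rw [resolventTrace, e, conjDiag_inv hU hU' fun l => (add_pos_of_pos_of_nonneg hz (hd l)).ne',
    trace_conjDiag hU]

/-- A smooth statistic of the spectrum of `rowGram s x` that dominates the number of small
eigenvalues. -/
noncomputable def lowStat (κ : ℝ) (m : ℕ) (s : Finset ι) (x : ι → Fin n → ℝ) : ℝ :=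
  s.card * ∑ i ∈ Finset.range (m + 1), pfCoeff κ m i * resolventTrace (pfNode κ m i * s.card) s x

/-- On the spectrum the statistic is a sum of a nonnegative test function, and each eigenvalue below
`κ |s|` contributes at least `3 ^ (-(m + 1))`. -/
lemma card_low_le_lowStat {κ : ℝ} (hκ : 0 < κ) {m : ℕ} (hm : 0 < m) {s : Finset ι}
    (hs : 0 < s.card) (x : ι → Fin n → ℝ)
    {U : Matrix (Fin n) (Fin n) ℝ} {d : Fin n → ℝ} (hU : Uᵀ * U = 1) (hU' : U * Uᵀ = 1)
    (hd : ∀ l, 0 ≤ d l) (h : rowGram s x = conjDiag U d) :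
    ((Finset.univ.filter fun l => d l ≤ κ * s.card).card : ℝ) ≤ 3 ^ (m + 1) * lowStat κ m s x := by
  have hs' : (0 : ℝ) < s.card := by exact_mod_cast hs
  have e : lowStat κ m s x = ∑ l, ∑ i ∈ Finset.range (m + 1),
      pfCoeff κ m i * (d l / s.card + pfNode κ m i)⁻¹ := by
    rw [lowStat, Finset.mul_sum, Finset.sum_comm]
    refine Finset.sum_congr rfl fun i hi => ?_
    have hp : 0 < pfNode κ m i := hκ.trans_le (pfNode_mem hκ hm hi).1
    rw [resolventTrace_eq_sum (by positivity) s x hU hU' hd h, Finset.mul_sum, Finset.mul_sum]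
    refine Finset.sum_congr rfl fun l _ => ?_
    have h1 := hd l
    have h2 : 0 < pfNode κ m i * s.card + d l := by positivity
    have h3 : 0 < d l / s.card + pfNode κ m i := by positivity
    field_simp
    ring
  have h1 : ∑ l ∈ Finset.univ.filter (fun l => d l ≤ κ * s.card), ((3 : ℝ) ^ (m + 1))⁻¹ ≤
      lowStat κ m s x := by
    rw [e]
    refine (Finset.sum_le_sum fun l hl => ?_).trans (Finset.sum_le_sum_of_subset_of_nonneg
      (Finset.filter_subset _ _) fun l _ _ =>
        sum_pfCoeff_mul_inv_nonneg hκ hm (div_nonneg (hd l) hs'.le))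
    refine le_sum_pfCoeff_mul_inv hκ hm (div_nonneg (hd l) hs'.le) ?_
    rw [div_le_iff₀ hs']
    exact (Finset.mem_filter.1 hl).2
  rw [Finset.sum_const, nsmul_eq_mul, ← div_eq_mul_inv, div_le_iff₀ (by positivity)] at h1
  linarith

lemma measurable_lowStat (κ : ℝ) (m : ℕ) (s : Finset ι) :
    Measurable fun x : ι → Fin n → ℝ => lowStat κ m s x :=
  (Finset.measurable_sum _ fun _ _ => (measurable_resolventTrace _ s).const_mul _).const_mul _

lemma abs_lowStat_le {κ : ℝ} (hκ : 0 < κ) {m : ℕ} (hm : 0 < m) {s : Finset ι} (hs : 0 < s.card)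
    (x : ι → Fin n → ℝ) : |lowStat κ m s x| ≤ n * (2 * Real.exp 1) ^ m := by
  have hs' : (0 : ℝ) < s.card := by exact_mod_cast hs
  rw [lowStat, abs_mul, Nat.abs_cast]
  calc _ ≤ (s.card : ℝ) * ∑ i ∈ Finset.range (m + 1), |pfCoeff κ m i| * (n * (κ * s.card)⁻¹) := by
        gcongr
        refine (Finset.abs_sum_le_sum_abs _ _).trans (Finset.sum_le_sum fun i hi => ?_)
        obtain ⟨h1, -⟩ := pfNode_mem hκ hm hi
        have h2 : 0 < pfNode κ m i * s.card := mul_pos (hκ.trans_le h1) hs'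
        rw [abs_mul, abs_of_nonneg (resolventTrace_nonneg h2 s x)]
        gcongr
        refine (resolventTrace_le h2 s x).trans ?_
        gcongr
    _ ≤ s.card * (κ * (2 * Real.exp 1) ^ m * (n * (κ * s.card)⁻¹)) := by
        rw [← Finset.sum_mul]; gcongr; exact sum_abs_pfCoeff_le hκ hm
    _ = _ := by field_simp

variable [DecidableEq ι]

/-- Each resolvent trace moves by at most `1 / (κ |s|)`. The factor `|s|` and the `κ` in the
coefficient sum cancel this, leaving only the exponential in `m`. -/
lemma abs_lowStat_update_sub_le {κ : ℝ} (hκ : 0 < κ) {m : ℕ} (hm : 0 < m) {s : Finset ι}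
    (hs : 0 < s.card) (j : ι) (x : ι → Fin n → ℝ) (r r' : Fin n → ℝ) :
    |lowStat κ m s (Function.update x j r) - lowStat κ m s (Function.update x j r')| ≤
      (2 * Real.exp 1) ^ m := by
  have hs' : (0 : ℝ) < s.card := by exact_mod_cast hs
  rw [lowStat, lowStat, ← mul_sub, abs_mul, Nat.abs_cast, ← Finset.sum_sub_distrib]
  calc _ ≤ (s.card : ℝ) * ∑ i ∈ Finset.range (m + 1), |pfCoeff κ m i| * (κ * s.card)⁻¹ := by
        gcongr
        refine (Finset.abs_sum_le_sum_abs _ _).trans (Finset.sum_le_sum fun i hi => ?_)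
        obtain ⟨h1, -⟩ := pfNode_mem hκ hm hi
        have h2 : 0 < pfNode κ m i * s.card := mul_pos (hκ.trans_le h1) hs'
        rw [← mul_sub, abs_mul]
        gcongr
        refine (abs_resolventTrace_update_sub_le h2 s j x r r').trans ?_
        gcongr
    _ ≤ s.card * (κ * (2 * Real.exp 1) ^ m * (κ * s.card)⁻¹) := by
        rw [← Finset.sum_mul]; gcongr; exact sum_abs_pfCoeff_le hκ hm
    _ = _ := by field_simp

variable [Fintype ι] {ν : ι → Measure (Fin n → ℝ)} [∀ i, IsProbabilityMeasure (ν i)] {H : ℝ}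

/-- Replacing every mean resolvent trace by `φ` costs the error of the self-consistent equation
times the coefficient sum; what remains is the combination of the values of `φ`, bounded through
`η`. -/
lemma integral_lowStat_le (hν : ∀ j, IsUnitRow (ν j) H) (hH : 0 ≤ H) {y : ℝ} {φ : ℝ → ℝ}
    (hφ : ∀ κ, 0 < κ → 0 ≤ φ κ ∧ κ * φ κ + φ κ / (1 + φ κ) = y)
    {κ : ℝ} (hκ : 0 < κ) {m : ℕ} (hm : 0 < m) {s : Finset ι} (hs : 0 < s.card) {η : ℝ}
    (hη : |∑ i ∈ Finset.range (m + 1), pfCoeff κ m i * φ (pfNode κ m i)| ≤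
      κ * (2 * Real.exp 1) ^ m * η) :
    ∫ x, lowStat κ m s x ∂Measure.pi ν ≤ s.card * (κ * (2 * Real.exp 1) ^ m *
      (((1 + √((H + 2) * n)) / (κ * s.card) + |(n : ℝ) / s.card - y|) / κ + η)) := by
  have hs' : (0 : ℝ) < s.card := by exact_mod_cast hs
  set ε := ((1 + √((H + 2) * n)) / (κ * s.card) + |(n : ℝ) / s.card - y|) / κ with hε
  have hint : ∀ i ∈ Finset.range (m + 1),
      Integrable (fun x => resolventTrace (pfNode κ m i * s.card) s x) (Measure.pi ν) :=
    fun i hi => integrable_resolventTrace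
      (mul_pos (hκ.trans_le (pfNode_mem hκ hm hi).1) hs') s
  have hε0 : 0 ≤ ε := by positivity
  have h1 : ∀ i ∈ Finset.range (m + 1),
      |∫ x, resolventTrace (pfNode κ m i * s.card) s x ∂Measure.pi ν - φ (pfNode κ m i)| ≤ ε :=
    fun i hi => by
      obtain ⟨hk, -⟩ := pfNode_mem hκ hm hi
      have hk0 := hκ.trans_le hk
      have h2 := integral_abs_resolventTrace_sub_le hν hH hk0 hs (hφ _ hk0).1 (hφ _ hk0).2
      have e : ∫ x, resolventTrace (pfNode κ m i * s.card) s x ∂Measure.pi ν - φ (pfNode κ m i) =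
          ∫ x, (resolventTrace (pfNode κ m i * s.card) s x - φ (pfNode κ m i)) ∂Measure.pi ν := by
        rw [integral_sub (hint i hi) (integrable_const _)]; simp
      rw [e]
      refine (abs_integral_le_integral_abs).trans (h2.trans ?_)
      rw [hε]
      gcongr
  have e : ∫ x, lowStat κ m s x ∂Measure.pi ν = s.card * ∑ i ∈ Finset.range (m + 1),
      pfCoeff κ m i * ∫ x, resolventTrace (pfNode κ m i * s.card) s x ∂Measure.pi ν := by
    simp only [lowStat]
    rw [integral_const_mul, integral_finsetSum _ fun i hi => (hint i hi).const_mul _]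
    simp only [integral_const_mul]
  rw [e]
  gcongr
  calc _ = ∑ i ∈ Finset.range (m + 1), pfCoeff κ m i *
          (∫ x, resolventTrace (pfNode κ m i * s.card) s x ∂Measure.pi ν - φ (pfNode κ m i)) +
        ∑ i ∈ Finset.range (m + 1), pfCoeff κ m i * φ (pfNode κ m i) := by
        rw [← Finset.sum_add_distrib]
        exact Finset.sum_congr rfl fun i _ => by ring
    _ ≤ ∑ i ∈ Finset.range (m + 1), |pfCoeff κ m i| * ε + κ * (2 * Real.exp 1) ^ m * η := by
        refine add_le_add (Finset.sum_le_sum fun i hi => ?_) ((le_abs_self _).trans hη)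
        refine (le_abs_self _).trans ?_
        rw [abs_mul]
        exact mul_le_mul_of_nonneg_left (h1 i hi) (abs_nonneg _)
    _ ≤ κ * (2 * Real.exp 1) ^ m * ε + κ * (2 * Real.exp 1) ^ m * η := by
        rw [← Finset.sum_mul]; gcongr; exact sum_abs_pfCoeff_le hκ hm
    _ = _ := by ring

end LowCount

/-! ### Passing from a small eigenvalue of the sum to the low spectral subspace -/

section Gluing

variable {ι : Type*} {n : ℕ}

lemma dotProduct_mulVec_le_of_unit {M : Matrix (Fin n) (Fin n) ℝ} {K : ℝ}
    (h : ∀ w : Fin n → ℝ, w ⬝ᵥ w = 1 → w ⬝ᵥ (M *ᵥ w) ≤ K) (w : Fin n → ℝ) :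
    w ⬝ᵥ (M *ᵥ w) ≤ K * (w ⬝ᵥ w) := by
  rcases (show 0 ≤ w ⬝ᵥ w from Finset.sum_nonneg fun i _ => mul_self_nonneg _).eq_or_lt with h0 | h0
  · have : w = 0 := dotProduct_self_eq_zero.1 h0.symm
    simp [this]
  · have hs : √(w ⬝ᵥ w) ^ 2 = w ⬝ᵥ w := Real.sq_sqrt h0.le
    have hs0 : 0 < √(w ⬝ᵥ w) := Real.sqrt_pos.2 h0
    have h1 := h ((√(w ⬝ᵥ w))⁻¹ • w) (by
      rw [smul_dotProduct, dotProduct_smul, smul_eq_mul, smul_eq_mul, ← mul_assoc, ← mul_inv,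
        ← sq, hs, inv_mul_cancel₀ h0.ne'])
    rw [Matrix.mulVec_smul, smul_dotProduct, dotProduct_smul, smul_eq_mul, smul_eq_mul,
      ← mul_assoc, ← mul_inv, ← sq, hs, inv_mul_le_iff₀ h0] at h1
    linarith

lemma exists_unit_form_le {M : Matrix (Fin n) (Fin n) ℝ} {K : ℝ} {u : Fin n → ℝ}
    (hu : 0 < u ⬝ᵥ u) (h : u ⬝ᵥ (M *ᵥ u) ≤ K * (u ⬝ᵥ u)) :
    ∃ w, w ⬝ᵥ w = 1 ∧ w ⬝ᵥ (M *ᵥ w) ≤ K := by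
  have hs : √(u ⬝ᵥ u) ^ 2 = u ⬝ᵥ u := Real.sq_sqrt hu.le
  refine ⟨(√(u ⬝ᵥ u))⁻¹ • u, ?_, ?_⟩
  · rw [smul_dotProduct, dotProduct_smul, smul_eq_mul, smul_eq_mul, ← mul_assoc, ← mul_inv,
      ← sq, hs, inv_mul_cancel₀ hu.ne']
  · rw [Matrix.mulVec_smul, smul_dotProduct, dotProduct_smul, smul_eq_mul, smul_eq_mul,
      ← mul_assoc, ← mul_inv, ← sq, hs, inv_mul_le_iff₀ hu]
    linarith

lemma rowGram_form_sub_le (t : Finset ι) (x : ι → Fin n → ℝ) (v h : Fin n → ℝ) :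
    (v - h) ⬝ᵥ (rowGram t x *ᵥ (v - h)) ≤
      2 * (v ⬝ᵥ (rowGram t x *ᵥ v)) + 2 * (h ⬝ᵥ (rowGram t x *ᵥ h)) := by
  simp only [dotProduct_rowGram_mulVec, Finset.mul_sum, ← Finset.sum_add_distrib, dotProduct_sub]
  exact Finset.sum_le_sum fun j _ => by nlinarith [sq_nonneg (x j ⬝ᵥ v + x j ⬝ᵥ h)]

lemma rowGram_form_nonneg (t : Finset ι) (x : ι → Fin n → ℝ) (v : Fin n → ℝ) :
    0 ≤ v ⬝ᵥ (rowGram t x *ᵥ v) := by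
  rw [dotProduct_rowGram_mulVec]; positivity

/-- If a sum of two Gram matrices has a small eigenvalue, then so does the second one on the
spectral subspace of the first one that belongs to small eigenvalues. -/
lemma exists_unit_form_le_of_split {s t : Finset ι} {x : ι → Fin n → ℝ}
    {U : Matrix (Fin n) (Fin n) ℝ} {d : Fin n → ℝ} (hU : Uᵀ * U = 1) (hU' : U * Uᵀ = 1)
    (hd : ∀ l, 0 ≤ d l) (hs : rowGram s x = conjDiag U d) {a T K : ℝ} (ha : 0 < a)
    (hTa : 2 * T ≤ a)
    (hK : ∀ w : Fin n → ℝ, w ⬝ᵥ w = 1 → w ⬝ᵥ (rowGram t x *ᵥ w) ≤ K) (hK0 : 0 ≤ K)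
    {v : Fin n → ℝ} (hv : v ⬝ᵥ v = 1)
    (hvT : v ⬝ᵥ (rowGram s x *ᵥ v) + v ⬝ᵥ (rowGram t x *ᵥ v) ≤ T) (L G : ℝ) :
    ∃ u, u ⬝ᵥ u = 1 ∧
      u ⬝ᵥ ((conjDiag U (fun l => if d l ≤ a then L else L + G) + rowGram t x) *ᵥ u) ≤
        L + 4 * (T + K * T / a) := by
  have hv1 := rowGram_form_nonneg s x v
  have hv2 := rowGram_form_nonneg t x v
  have hT : 0 ≤ T := by linarith
  have hnorm : ∀ w : Fin n → ℝ, (U *ᵥ w) ⬝ᵥ (U *ᵥ w) = w ⬝ᵥ w := fun w => by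
    rw [Matrix.dotProduct_mulVec, Matrix.vecMul_mulVec, ← Matrix.dotProduct_mulVec, hU,
      Matrix.one_mulVec]
  set w := Uᵀ *ᵥ v with hw
  have hUw : U *ᵥ w = v := by rw [hw, Matrix.mulVec_mulVec, hU', Matrix.one_mulVec]
  set wl : Fin n → ℝ := fun l => if d l ≤ a then w l else 0 with hwl
  set wh : Fin n → ℝ := fun l => if d l ≤ a then 0 else w l with hwh
  have hsum : w = wl + wh := by
    ext l; simp only [hwl, hwh, Pi.add_apply]; split_ifs <;> simp
  have hw1 : w ⬝ᵥ w = 1 := by rw [← hnorm, hUw, hv]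
  have hpy : wl ⬝ᵥ wl + wh ⬝ᵥ wh = 1 := by
    rw [← hw1]
    simp only [dotProduct, ← Finset.sum_add_distrib]
    refine Finset.sum_congr rfl fun l _ => ?_
    simp only [hwl, hwh]; split_ifs <;> simp
  -- The part of `v` on eigenvalues above `a` is small, since the form of `v` is at most `T`. With
  -- `2 T ≤ a`, the low part keeps at least half of the squared norm.
  have hh : a * (wh ⬝ᵥ wh) ≤ T := by
    have h1 : a * (wh ⬝ᵥ wh) ≤ v ⬝ᵥ (rowGram s x *ᵥ v) := by
      rw [hs, dotProduct_conjDiag_mulVec, dotProduct, Finset.mul_sum]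
      refine Finset.sum_le_sum fun l _ => ?_
      simp only [hwh, ← hw]
      split_ifs with hl
      · simpa using mul_nonneg (hd l) (sq_nonneg _)
      · rw [← sq]; exact mul_le_mul_of_nonneg_right (not_le.1 hl).le (sq_nonneg _)
    linarith
  have hh' : wh ⬝ᵥ wh ≤ T / a := by rw [le_div_iff₀ ha]; linarith
  have hl2 : 1 / 2 ≤ wl ⬝ᵥ wl := by
    have : T / a ≤ 1 / 2 := by rw [div_le_iff₀ ha]; linarith
    linarith
  have hu : U *ᵥ wl = v - U *ᵥ wh := by rw [← hUw, hsum, Matrix.mulVec_add]; simp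
  refine exists_unit_form_le (u := U *ᵥ wl) (by rw [hnorm]; linarith) ?_
  rw [Matrix.add_mulVec, dotProduct_add, hnorm]
  have e1 : (U *ᵥ wl) ⬝ᵥ (conjDiag U (fun l => if d l ≤ a then L else L + G) *ᵥ (U *ᵥ wl)) =
      L * (wl ⬝ᵥ wl) := by
    rw [dotProduct_conjDiag_mulVec, Matrix.mulVec_mulVec, hU, Matrix.one_mulVec, dotProduct,
      Finset.mul_sum]
    refine Finset.sum_congr rfl fun l _ => ?_
    simp only [hwl]; split_ifs <;> ring
  -- The low part is `v` minus the high part, whose contribution is at most `K T / a`. Normalizing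
  -- the low part doubles the factor 2 to the 4 of the statement.
  have e2 : (U *ᵥ wl) ⬝ᵥ (rowGram t x *ᵥ (U *ᵥ wl)) ≤ 2 * (T + K * T / a) := by
    rw [hu]
    refine (rowGram_form_sub_le t x _ _).trans ?_
    have h2 := dotProduct_mulVec_le_of_unit hK (U *ᵥ wh)
    rw [hnorm] at h2
    have h3 : K * (wh ⬝ᵥ wh) ≤ K * T / a := by
      rw [mul_div_assoc]; exact mul_le_mul_of_nonneg_left hh' hK0
    linarith
  have h4 : 0 ≤ T + K * T / a := by positivity
  rw [e1]
  nlinarith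

lemma isCompact_unitVectors : IsCompact {v : Fin n → ℝ | v ⬝ᵥ v = 1} := by
  refine Metric.isCompact_of_isClosed_isBounded (isClosed_eq ?_ continuous_const) ?_
  · simp only [dotProduct]; fun_prop
  · refine (Metric.isBounded_closedBall (x := (0 : Fin n → ℝ)) (r := 1)).subset fun v hv => ?_
    rw [mem_closedBall_zero_iff, pi_norm_le_iff_of_nonneg zero_le_one]
    intro i
    rw [Real.norm_eq_abs, ← sq_le_one_iff_abs_le_one]
    have hv' : ∑ i, v i * v i = 1 := hv
    rw [← hv', sq]
    exact Finset.single_le_sum (f := fun i => v i * v i) (fun i _ => mul_self_nonneg _)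
      (Finset.mem_univ i)

/-- A projection of a closed set along the compact unit sphere; it provides the measurability needed
for Fubini. -/
lemma isClosed_exists_unit_form_le (t : Finset ι) (T : ℝ) :
    IsClosed {x : ι → Fin n → ℝ | ∃ v : Fin n → ℝ, v ⬝ᵥ v = 1 ∧ v ⬝ᵥ (rowGram t x *ᵥ v) ≤ T} := by
  have : CompactSpace {v : Fin n → ℝ | v ⬝ᵥ v = 1} :=
    isCompact_iff_compactSpace.1 isCompact_unitVectors
  have h := isClosedMap_fst_of_compactSpace (X := ι → Fin n → ℝ)
    (Y := {v : Fin n → ℝ | v ⬝ᵥ v = 1})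
    {z | (z.2 : Fin n → ℝ) ⬝ᵥ (rowGram t z.1 *ᵥ z.2) ≤ T} (by
      refine isClosed_le ?_ continuous_const
      simp_rw [dotProduct_rowGram_mulVec]
      simp only [dotProduct]
      exact continuous_finsetSum _ fun j _ => (continuous_finsetSum _ fun i _ =>
        ((continuous_apply i).comp ((continuous_apply j).comp continuous_fst)).mul
          ((continuous_apply i).comp (continuous_subtype_val.comp continuous_snd))).pow 2)
  convert h using 1
  ext x
  constructor
  · rintro ⟨v, hv, hT⟩
    exact ⟨(x, ⟨v, hv⟩), hT, rfl⟩
  · rintro ⟨⟨x', v⟩, hT, rfl⟩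
    exact ⟨v, v.2, hT⟩

lemma isClosed_forall_unit_form_le (t : Finset ι) (T : ℝ) :
    IsClosed {x : ι → Fin n → ℝ | ∀ v : Fin n → ℝ, v ⬝ᵥ v = 1 → v ⬝ᵥ (rowGram t x *ᵥ v) ≤ T} := by
  have e : {x : ι → Fin n → ℝ | ∀ v : Fin n → ℝ, v ⬝ᵥ v = 1 → v ⬝ᵥ (rowGram t x *ᵥ v) ≤ T} =
      ⋂ v : {v : Fin n → ℝ | v ⬝ᵥ v = 1}, {x | (v : Fin n → ℝ) ⬝ᵥ (rowGram t x *ᵥ v) ≤ T} := by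
    ext x; simp
  rw [e]
  refine isClosed_iInter fun v => isClosed_le ?_ continuous_const
  simp_rw [dotProduct_rowGram_mulVec]
  simp only [dotProduct]
  fun_prop

end Gluing

/-! ### Conditioning on the first group of rows -/

section Splitting

variable {ι : Type*} {n : ℕ}

lemma rowGram_congr {s : Finset ι} {x x' : ι → Fin n → ℝ} (h : ∀ j ∈ s, x j = x' j) :
    rowGram s x = rowGram s x' :=
  Finset.sum_congr rfl fun j hj => by rw [h j hj]

lemma formGE_zero_rowGram (s : Finset ι) (x : ι → Fin n → ℝ) : FormGE 0 (rowGram s x) :=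
  ⟨isHermitian_rowGram s x, fun v => by rw [zero_mul]; exact rowGram_form_nonneg s x v⟩

lemma isHermitian_conjDiag (U : Matrix (Fin n) (Fin n) ℝ) (d : Fin n → ℝ) :
    (conjDiag U d).IsHermitian := by
  rw [Matrix.IsHermitian, Matrix.conjTranspose_eq_transpose_of_trivial, conjDiag]
  simp only [Matrix.transpose_mul, Matrix.transpose_transpose, Matrix.diagonal_transpose, mul_assoc]

lemma formGE_conjDiag {U : Matrix (Fin n) (Fin n) ℝ} (hU' : U * Uᵀ = 1) {d : Fin n → ℝ} {z : ℝ}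
    (hd : ∀ l, z ≤ d l) : FormGE z (conjDiag U d) := by
  refine ⟨isHermitian_conjDiag U d, fun x => ?_⟩
  have h1 : z * (x ⬝ᵥ x) = x ⬝ᵥ (conjDiag U (fun _ => z) *ᵥ x) := by
    rw [conjDiag_const hU', Matrix.smul_mulVec, Matrix.one_mulVec, dotProduct_smul, smul_eq_mul]
  rw [h1, dotProduct_conjDiag_mulVec, dotProduct_conjDiag_mulVec]
  exact Finset.sum_le_sum fun l _ => mul_le_mul_of_nonneg_right (hd l) (sq_nonneg _)

variable [Fintype ι] [DecidableEq ι] {ν : ι → Measure (Fin n → ℝ)}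
  [∀ i, IsProbabilityMeasure (ν i)] {H : ℝ}

/-- If with the rows in `s` alone there are few small eigenvalues, then adding the other rows makes
the least eigenvalue large with high probability. -/
theorem measureReal_split_le (hν : ∀ j, IsUnitRow (ν j) H) (hH : 0 ≤ H) {s : Finset ι}
    {A : Set (ι → Fin n → ℝ)} (hA : MeasurableSet A)
    (hAs : ∀ x x' : ι → Fin n → ℝ, (∀ j ∈ s, x j = x' j) → x ∈ A → x' ∈ A)
    {a b T K L G σ : ℝ} {m : ℕ} (ha : 0 < a) (hT : 0 ≤ T) (hTa : 2 * T ≤ a) (hK : 0 ≤ K)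
    (hL : 0 < L) (hG : 0 ≤ G)
    (hb : ∀ x ∈ A, ∀ (U : Matrix (Fin n) (Fin n) ℝ) (d : Fin n → ℝ), Uᵀ * U = 1 → U * Uᵀ = 1 →
      (∀ l, 0 ≤ d l) → rowGram s x = conjDiag U d →
      ((Finset.univ.filter fun l => d l ≤ a).card : ℝ) ≤ b)
    (hσ : 0 < σ) (hσ1 : 2 * (b / L + n / (L + G) + (2 + H) / L) ≤ σ)
    (hσ2 : (m + 1) * σ ≤ 1 / 2) (hmL : ((m : ℝ) + 1) / 6 ≤ L) :
    (Measure.pi ν).real {x | x ∈ A ∧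
      (∀ v : Fin n → ℝ, v ⬝ᵥ v = 1 → v ⬝ᵥ (rowGram Finset.univ x *ᵥ v) ≤ K) ∧
      ∃ v : Fin n → ℝ, v ⬝ᵥ v = 1 ∧ v ⬝ᵥ (rowGram Finset.univ x *ᵥ v) ≤ T} ≤
      n * ((L + 4 * (T + K * T / a)) / (L + (sᶜ.card : ℝ) / 6)) ^ m := by
  set q : ℝ := n * ((L + 4 * (T + K * T / a)) / (L + (sᶜ.card : ℝ) / 6)) ^ m with hq
  have hq0 : 0 ≤ q := by positivity
  set E : Set (ι → Fin n → ℝ) := {x | x ∈ A ∧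
      (∀ v : Fin n → ℝ, v ⬝ᵥ v = 1 → v ⬝ᵥ (rowGram Finset.univ x *ᵥ v) ≤ K) ∧
      ∃ v : Fin n → ℝ, v ⬝ᵥ v = 1 ∧ v ⬝ᵥ (rowGram Finset.univ x *ᵥ v) ≤ T} with hE
  have hEm : MeasurableSet E := hA.inter
    ((isClosed_forall_unit_form_le _ K).measurableSet.inter
      (isClosed_exists_unit_form_le _ T).measurableSet)
  have hmp := measurePreserving_piecewise ν s
  rw [measureReal_def]
  refine ENNReal.toReal_le_of_le_ofReal hq0 ?_
  -- The rows in `s` are taken from one copy `x` of the sample and the others from an independent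
  -- copy `x'`. For fixed `x` the eigenbasis is deterministic, so it need not depend measurably on
  -- `x`.
  rw [← hmp.measure_preimage hEm.nullMeasurableSet,
    Measure.prod_apply_symm (hmp.measurable hEm)]
  calc _ ≤ ∫⁻ _ : ι → Fin n → ℝ, ENNReal.ofReal q ∂Measure.pi ν := lintegral_mono fun x => ?_
    _ = ENNReal.ofReal q := by simp
  have hs : ∀ x' : ι → Fin n → ℝ, ∀ j ∈ s, s.piecewise x x' j = x j := fun x' j hj =>
    Finset.piecewise_eq_of_mem _ _ _ hj
  have hsc : ∀ x' : ι → Fin n → ℝ, ∀ j ∈ sᶜ, s.piecewise x x' j = x' j := fun x' j hj =>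
    Finset.piecewise_eq_of_notMem _ _ _ (Finset.mem_compl.1 hj)
  by_cases hxA : x ∈ A
  · obtain ⟨U, d, hU, hU', hS, hd⟩ := (formGE_zero_rowGram s x).exists_spectral
    have hcard := hb x hxA U d hU hU' hd hS
    -- The starting matrix has value `L` on the few low directions and `L + G` elsewhere, so that
    -- the trace of its inverse is small.
    have hLd : ∀ l, L ≤ if d l ≤ a then L else L + G := fun l => by split_ifs <;> linarith
    have htr : (conjDiag U fun l => if d l ≤ a then L else L + G)⁻¹.trace ≤
        b / L + n / (L + G) := by
      rw [conjDiag_inv hU hU' fun l => (hL.trans_le (hLd l)).ne', trace_conjDiag hU]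
      calc _ ≤ ∑ l, ((if d l ≤ a then L⁻¹ else 0) + (L + G)⁻¹) := by
            refine Finset.sum_le_sum fun l _ => ?_
            have : 0 < (L + G)⁻¹ := by positivity
            split_ifs <;> linarith
        _ = ((Finset.univ.filter fun l => d l ≤ a).card : ℝ) / L + n / (L + G) := by
            rw [Finset.sum_add_distrib, ← Finset.sum_filter]
            simp [div_eq_mul_inv]
        _ ≤ _ := by gcongr
    have key := measureReal_exists_form_le hν hH hL (formGE_conjDiag hU' hLd) hσ
      (by linarith) hσ2 hmL sᶜ (t := L + 4 * (T + K * T / a)) (by positivity)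
    rw [← hq] at key
    rw [← ofReal_measureReal]
    refine ENNReal.ofReal_le_ofReal ((measureReal_mono ?_).trans key)
    rintro x' ⟨-, hxK, v, hv, hvT⟩
    have e1 : rowGram s (s.piecewise x x') = rowGram s x := rowGram_congr (hs x')
    have e2 : rowGram sᶜ (s.piecewise x x') = rowGram sᶜ x' := rowGram_congr (hsc x')
    have e : rowGram Finset.univ (s.piecewise x x') = rowGram s x + rowGram sᶜ x' := by
      rw [← e1, ← e2]; exact (Finset.sum_add_sum_compl s _).symm
    simp only [e] at hxK hvT
    have hS' : rowGram s (s.piecewise x x') = conjDiag U d := e1.trans hS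
    have := exists_unit_form_le_of_split (s := s) (t := sᶜ) (x := s.piecewise x x') hU hU' hd hS'
      ha hTa (K := K) (fun w hw => by
        have h1 := hxK w hw
        rw [Matrix.add_mulVec, dotProduct_add] at h1
        rw [e2]
        linarith [rowGram_form_nonneg s x w]) hK hv
      (by rw [e1, e2, ← dotProduct_add, ← Matrix.add_mulVec]; exact hvT) L G
    rwa [e2] at this
  · have : (fun x' => (x', x)) ⁻¹' ((fun z : (ι → Fin n → ℝ) × (ι → Fin n → ℝ) =>
        s.piecewise z.2 z.1) ⁻¹' E) = ∅ := by
      ext x'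
      simp only [Set.mem_preimage, Set.mem_empty_iff_false, iff_false]
      exact fun h => hxA (hAs _ _ (hs x') h.1)
    rw [this]; simp

end Splitting

/-! ### Few small eigenvalues after the first stage -/

section LowSet

/-- Chooses the order `m` of the differences so that every loss exponential in `m` is a small power
of `ℓ`. -/
lemma exists_pow_four_le {ℓ : ℝ} (hℓ : 17 ^ 4 ≤ ℓ) :
    ∃ m : ℕ, 0 < m ∧ ((17 : ℝ) ^ m) ^ 4 ≤ ℓ ∧ ℓ ≤ 17 ^ 4 * ((17 : ℝ) ^ m) ^ 4 := by
  obtain ⟨m, h1, h2⟩ := exists_nat_pow_near (x := ℓ) (y := 17 ^ 4)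
    (le_trans (by norm_num) hℓ) (by norm_num)
  have e : ((17 : ℝ) ^ m) ^ 4 = (17 ^ 4) ^ m := by rw [← pow_mul, ← pow_mul, mul_comm]
  refine ⟨m, ?_, by rw [e]; exact h1, by rw [e, ← pow_succ']; exact h2.le⟩
  rcases Nat.eq_zero_or_pos m with rfl | h
  · exact absurd h2 (by simpa using hℓ)
  · exact h

/-- The error in the self-consistent equation is of lower order than `1 / log N`. -/
lemma selfConsistent_error_le {κ c₁ M B ℓ w D N n N₁ y : ℝ} (hκ : 0 < κ) (hc₁ : 0 < c₁)
    (hM : 0 ≤ M) (hB : 0 < B) (hℓ : 1 ≤ ℓ) (hw : 1 ≤ w) (hwℓ : w ^ 4 ≤ ℓ) (hD : B * ℓ ^ 3 ≤ D)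
    (hDN : D ≤ N) (hn0 : 0 ≤ n) (hn : n ≤ N) (hN : 1 ≤ N) (hN₁ : c₁ * N ≤ N₁)
    (hy : |n / N₁ - y| ≤ 1 / N₁) :
    ((1 + √((M * N / D + 2) * n)) / (κ * N₁) + |n / N₁ - y|) / κ ≤
      (1 + √(M + 2) + κ) / (κ ^ 2 * c₁ * √B) / (ℓ * w ^ 2) := by
  have hN0 : 0 < N := by linarith
  have hD0 : 0 < D := lt_of_lt_of_le (by positivity) hD
  have hN₁0 : 0 < N₁ := lt_of_lt_of_le (by positivity) hN₁
  -- The error is of order `1 / √D`. The third power of `ℓ` in the sparsity bound is what leaves the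
  -- spare factor `w ^ 2` beyond `1 / ℓ`.
  have hsD : √B * (ℓ * w ^ 2) ≤ √D := by
    refine Real.le_sqrt_of_sq_le ?_
    rw [mul_pow, Real.sq_sqrt hB.le]
    refine le_trans ?_ hD
    gcongr
    calc (ℓ * w ^ 2) ^ 2 = ℓ ^ 2 * w ^ 4 := by ring
      _ ≤ ℓ ^ 2 * ℓ := by gcongr
      _ = ℓ ^ 3 := by ring
  have hsD0 : 0 < √D := Real.sqrt_pos.2 hD0
  have h1 : 1 ≤ N / √D := by
    rw [one_le_div hsD0]
    refine Real.sqrt_le_iff.2 ⟨hN0.le, hDN.trans ?_⟩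
    nlinarith
  have h2 : √((M * N / D + 2) * n) ≤ N / √D * √(M + 2) := by
    refine Real.sqrt_le_iff.2 ⟨by positivity, ?_⟩
    rw [mul_pow, div_pow, Real.sq_sqrt hD0.le, Real.sq_sqrt (by positivity)]
    have h3 : M * N / D + 2 ≤ (M + 2) * (N / D) := by
      have : 1 ≤ N / D := by rwa [one_le_div hD0]
      rw [mul_div_assoc]; linarith
    calc _ ≤ (M + 2) * (N / D) * N := by gcongr
      _ = _ := by ring
  calc _ ≤ ((N / √D + N / √D * √(M + 2)) / (κ * N₁) + N / √D / N₁) / κ := by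
        gcongr
        exact hy.trans (by gcongr)
    _ = (N / N₁) * ((1 + √(M + 2) + κ) / κ ^ 2 / √D) := by field_simp
    _ ≤ (1 / c₁) * ((1 + √(M + 2) + κ) / κ ^ 2 / (√B * (ℓ * w ^ 2))) := by
        have hq : N / N₁ ≤ 1 / c₁ := by rw [div_le_div_iff₀ hN₁0 hc₁]; linarith
        have hsB : 0 < √B := Real.sqrt_pos.2 hB
        gcongr
    _ = _ := by
        have hsB : 0 < √B := Real.sqrt_pos.2 hB
        field_simp

lemma two_exp_one_le : 2 * Real.exp 1 ≤ 17 / 3 := by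
  have := Real.exp_one_lt_d9
  norm_num at this ⊢
  linarith

/-- The statistic has mean `O(N / (ℓ w²))` up to the factor `(2e) ^ m`, where `w = 17 ^ m` and `w ^
4` is comparable to `ℓ`. Converting it into a count costs another `3 ^ (m + 1)`. Since `6 e ≤ 17`,
the two exponential factors cost at most `3 w`, so a factor `1 / w` is left to beat any `η`. The
radius `κ` depends on `y` alone because only the domain of analyticity of `φ` enters. -/
theorem exists_lowSet {y : ℝ} (hy0 : 0 < y) (hy1 : y < 1) :
    ∃ κ : ℝ, 0 < κ ∧ ∀ {η M B c₁ : ℝ}, 0 < η → 0 ≤ M → 0 < B → 0 < c₁ → ∃ Z : ℝ,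
      ∀ {N n : ℕ} {D ℓ : ℝ}, Z ≤ ℓ → 1 ≤ ℓ → B * ℓ ^ 3 ≤ D → D ≤ N → n ≤ N →
      ∀ {s : Finset (Fin N)}, c₁ * N ≤ s.card → |(n : ℝ) / s.card - y| ≤ 1 / s.card →
      ∀ {ν : Fin N → Measure (Fin n → ℝ)} [∀ j, IsProbabilityMeasure (ν j)],
      (∀ j, IsUnitRow (ν j) (M * N / D)) →
      ∃ A : Set (Fin N → Fin n → ℝ), MeasurableSet A ∧
        (∀ x x' : Fin N → Fin n → ℝ, (∀ j ∈ s, x j = x' j) → x ∈ A → x' ∈ A) ∧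
        (∀ x ∈ A, ∀ (U : Matrix (Fin n) (Fin n) ℝ) (d : Fin n → ℝ), Uᵀ * U = 1 → U * Uᵀ = 1 →
          (∀ l, 0 ≤ d l) → rowGram s x = conjDiag U d →
          ((Finset.univ.filter fun l => d l ≤ κ * s.card).card : ℝ) ≤ η * N / ℓ) ∧
        (Measure.pi ν).real Aᶜ ≤ Real.exp (-(N / (2 * ℓ ^ 4))) := by
  obtain ⟨φ, hφa, hφ⟩ := exists_analyticAt_selfConsistent hy0 hy1
  obtain ⟨ρ, C, hρ, hC, hpf⟩ := exists_abs_sum_pfCoeff_le hφa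
  -- This makes `(2 κ / ρ) ^ m = w ^ (-6)`, which is of order `1 / (ℓ w²)`, like the other error.
  refine ⟨ρ / (2 * 17 ^ 6), by positivity, fun {η M B c₁} hη hM hB hc₁ => ?_⟩
  set κ := ρ / (2 * 17 ^ 6) with hκdef
  have hκ : 0 < κ := by positivity
  set C₂ := (1 + √(M + 2) + κ) / (κ ^ 2 * c₁ * √B) with hC₂
  have hsB : 0 < √B := Real.sqrt_pos.2 hB
  have hC₂0 : 0 < C₂ := by positivity
  set C₃ := κ * (C₂ + 17 ^ 4 * C) + 1 with hC₃
  have hC₃0 : 0 < C₃ := by positivity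
  set R := 3 * C₃ / η with hR
  have hR0 : 0 < R := by positivity
  refine ⟨17 ^ 4 * R ^ 4 + 17 ^ 4, fun {N n D ℓ} hZ hℓ hD hDN hn {s} hs hys {ν} _ hν => ?_⟩
  have hD0 : 0 < D := lt_of_lt_of_le (by positivity) hD
  have hN0 : (0 : ℝ) < N := hD0.trans_le hDN
  have hN1 : (1 : ℝ) ≤ N := by
    have : 0 < N := by exact_mod_cast hN0
    exact_mod_cast this
  have hnR : (n : ℝ) ≤ N := by exact_mod_cast hn
  have hs0' : (0 : ℝ) < s.card := lt_of_lt_of_le (by positivity) hs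
  have hs0 : 0 < s.card := by exact_mod_cast hs0'
  have hsN : (s.card : ℝ) ≤ N := by
    exact_mod_cast (Finset.card_le_univ s).trans (by simp)
  obtain ⟨m, hm, hw1, hw2⟩ := exists_pow_four_le (ℓ := ℓ) (by
    have : (0 : ℝ) < 17 ^ 4 * R ^ 4 := by positivity
    linarith)
  have hw1' : (1 : ℝ) ≤ 17 ^ m := one_le_pow₀ (by norm_num)
  set w : ℝ := 17 ^ m with hw
  have hw0 : 0 < w := by positivity
  have hRw : R ≤ w := by
    refine le_of_pow_le_pow_left₀ (n := 4) (by norm_num) hw0.le ?_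
    have h1 : (17 : ℝ) ^ 4 * R ^ 4 ≤ 17 ^ 4 * w ^ 4 := by
      have : (0 : ℝ) < 17 ^ 4 := by positivity
      linarith
    exact le_of_mul_le_mul_left h1 (by positivity)
  have hE : (3 : ℝ) ^ m * (2 * Real.exp 1) ^ m ≤ w := by
    rw [← mul_pow]
    refine pow_le_pow_left₀ (by positivity) ?_ m
    linarith [two_exp_one_le]
  have hE' : (2 * Real.exp 1) ^ m ≤ w :=
    pow_le_pow_left₀ (by positivity) (by linarith [two_exp_one_le]) m
  have hE1 : 1 ≤ (2 * Real.exp 1) ^ m :=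
    one_le_pow₀ (by linarith [Real.add_one_le_exp 1])
  have hη' := hpf κ m hκ hm (by rw [hκdef]; rw [mul_div_assoc', div_lt_iff₀ (by positivity)]; linarith)
  have hpow : (2 * κ / ρ) ^ m = (w ^ 6)⁻¹ := by
    have : 2 * κ / ρ = (17 ^ 6)⁻¹ := by rw [hκdef]; field_simp
    rw [this, inv_pow, hw, ← pow_mul, ← pow_mul, mul_comm]
  rw [hpow] at hη'
  have hint := integral_lowStat_le hν (by positivity) hφ hκ hm hs0 hη'
  have herr := selfConsistent_error_le (κ := κ) (n := n) hκ hc₁ hM hB hℓ hw1' hw1 hD hDN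
    (Nat.cast_nonneg n) hnR hN1 hs hys
  rw [← hC₂] at herr
  have herr2 : C * (w ^ 6)⁻¹ ≤ 17 ^ 4 * C / (ℓ * w ^ 2) := by
    rw [← div_eq_mul_inv, div_le_div_iff₀ (by positivity) (by positivity)]
    calc C * (ℓ * w ^ 2) ≤ C * (17 ^ 4 * w ^ 4 * w ^ 2) := by gcongr
      _ = 17 ^ 4 * C * w ^ 6 := by ring
  have hint2 : ∫ x, lowStat κ m s x ∂Measure.pi ν ≤
      (2 * Real.exp 1) ^ m * (N * (κ * (C₂ + 17 ^ 4 * C)) / (ℓ * w ^ 2)) := by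
    refine hint.trans ?_
    calc _ ≤ (N : ℝ) * (κ * (2 * Real.exp 1) ^ m *
          (C₂ / (ℓ * w ^ 2) + 17 ^ 4 * C / (ℓ * w ^ 2))) := by gcongr
      _ = _ := by ring
  have ht0 : 0 ≤ N / (ℓ * w ^ 2) := by positivity
  refine ⟨{x | lowStat κ m s x < ∫ x, lowStat κ m s x ∂Measure.pi ν + N / (ℓ * w ^ 2)},
    measurableSet_lt (measurable_lowStat κ m s) measurable_const, ?_, ?_, ?_⟩
  · intro x x' hxx' hx
    have : lowStat κ m s x' = lowStat κ m s x := by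
      simp only [lowStat, resolventTrace, rowGram_congr hxx']
    simpa [this] using hx
  · intro x hx U d hU hU' hd h
    refine (card_low_le_lowStat hκ hm hs0 x hU hU' hd h).trans ?_
    have hx' : lowStat κ m s x ≤ (2 * Real.exp 1) ^ m * (N * C₃ / (ℓ * w ^ 2)) := by
      have hx1 : lowStat κ m s x < ∫ x, lowStat κ m s x ∂Measure.pi ν + N / (ℓ * w ^ 2) := hx
      have h2 : N / (ℓ * w ^ 2) ≤ (2 * Real.exp 1) ^ m * (N / (ℓ * w ^ 2)) :=
        le_mul_of_one_le_left ht0 hE1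
      have e : (2 * Real.exp 1) ^ m * (N * C₃ / (ℓ * w ^ 2)) =
          (2 * Real.exp 1) ^ m * (N * (κ * (C₂ + 17 ^ 4 * C)) / (ℓ * w ^ 2)) +
            (2 * Real.exp 1) ^ m * (N / (ℓ * w ^ 2)) := by rw [hC₃]; ring
      linarith
    calc (3 : ℝ) ^ (m + 1) * lowStat κ m s x
        ≤ 3 ^ (m + 1) * ((2 * Real.exp 1) ^ m * (N * C₃ / (ℓ * w ^ 2))) := by gcongr
      _ = 3 ^ m * (2 * Real.exp 1) ^ m * (3 * (N * C₃ / (ℓ * w ^ 2))) := by rw [pow_succ]; ring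
      _ ≤ w * (3 * (N * C₃ / (ℓ * w ^ 2))) := by gcongr
      _ = 3 * C₃ / w * (N / ℓ) := by field_simp
      _ ≤ η * (N / ℓ) := by
          gcongr
          rw [div_le_iff₀ hw0]
          rw [hR, div_le_iff₀ hη] at hRw
          linarith
      _ = η * N / ℓ := by ring
  · have hmd := measureReal_ge_le_of_bounded_differences ν (measurable_lowStat κ m s)
      (abs_lowStat_le hκ hm hs0) (d := (2 * Real.exp 1) ^ m) (by positivity)
      (by rw [Fintype.card_fin]; exact_mod_cast hN0)
      (fun j x r r' => abs_lowStat_update_sub_le hκ hm hs0 j x r r') ht0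
    rw [Fintype.card_fin] at hmd
    have e : {x : Fin N → Fin n → ℝ |
        lowStat κ m s x < ∫ x, lowStat κ m s x ∂Measure.pi ν + N / (ℓ * w ^ 2)}ᶜ =
        {x | ∫ x, lowStat κ m s x ∂Measure.pi ν + N / (ℓ * w ^ 2) ≤ lowStat κ m s x} := by
      ext x; simp
    rw [e]
    -- McDiarmid with `N` rows, deviation `N / (ℓ w²)` and differences at most `w`: the exponent is
    -- at least `N / (2 ℓ² w ^ 6)`, and `w ^ 6 ≤ w ^ 8 ≤ ℓ²`.
    refine hmd.trans (Real.exp_le_exp.2 (neg_le_neg ?_))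
    rw [div_le_div_iff₀ (by positivity) (by positivity), div_pow, div_mul_eq_mul_div,
      le_div_iff₀ (by positivity)]
    calc (N : ℝ) * (2 * N * ((2 * Real.exp 1) ^ m) ^ 2) * (ℓ * w ^ 2) ^ 2
        ≤ N * (2 * N * w ^ 2) * (ℓ * w ^ 2) ^ 2 := by gcongr
      _ = N ^ 2 * (2 * ℓ ^ 2 * (w ^ 6)) := by ring
      _ ≤ N ^ 2 * (2 * ℓ ^ 2 * (w ^ 8)) := by gcongr; norm_num
      _ = N ^ 2 * (2 * ℓ ^ 2 * (w ^ 4) ^ 2) := by ring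
      _ ≤ N ^ 2 * (2 * ℓ ^ 2 * ℓ ^ 2) := by gcongr
      _ = _ := by ring

end LowSet

/-! ### Both stages combined -/

section LeastForm

lemma eventually_mul_log_pow_le (A : ℝ) (k : ℕ) :
    ∀ᶠ N : ℕ in atTop, A * Real.log N ^ k ≤ N := by
  have h := ((Real.isLittleO_pow_log_id_atTop (n := k)).const_mul_left A).bound one_pos
  filter_upwards [tendsto_natCast_atTop_atTop.eventually h] with N hN
  simp only [id, Real.norm_eq_abs, one_mul, Nat.abs_cast] at hN
  exact (le_abs_self _).trans hN

/-- Proportions of the rows used for the two stages. -/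
lemma exists_eventually_card {y₀ : ℝ} (hy₀ : 0 < y₀) (hy₁ : y₀ < 1) :
    ∃ y ε : ℝ, 0 < y ∧ y < 1 ∧ 0 < ε ∧ ∀ n : ℕ → ℕ,
      Tendsto (fun N : ℕ => (n N : ℝ) / (N : ℝ)) atTop (𝓝 y₀) →
      ∀ᶠ N : ℕ in atTop, ∃ s : Finset (Fin N), y₀ / 2 * N ≤ s.card ∧
        |(n N : ℝ) / s.card - y| ≤ 1 / s.card ∧ ε * N ≤ sᶜ.card := by
  -- Any `y` strictly between `y₀` and 1 would do: about `n / y` rows are used first, leaving a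
  -- positive proportion, and the aspect ratio of the first group stays below 1. The ceiling changes
  -- `n / |s|` by at most `1 / |s|`.
  set y := (1 + y₀) / 2 with hy
  set ε := (1 - y₀ / y) / 3 with hε
  have hy0 : 0 < y := by linarith
  have hyy : y₀ / y < 1 := by rw [div_lt_one hy0]; linarith
  have hε0 : 0 < ε := by linarith
  refine ⟨y, ε, hy0, by linarith, hε0, fun n hn => ?_⟩
  have hlim : y₀ < y * (1 - 2 * ε) := by
    have : y₀ = y * (y₀ / y) := by field_simp
    have h2 : y₀ / y < 1 - 2 * ε := by linarith
    calc y₀ = y * (y₀ / y) := this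
      _ < _ := by gcongr
  filter_upwards [hn.eventually_le_const hlim, eventually_half_le_ratio hy₀ hn,
    tendsto_natCast_atTop_atTop.eventually_ge_atTop (1 / ε), eventually_ge_atTop 1] with N h1 h2 h3 h4
  have hN0 : (0 : ℝ) < N := by exact_mod_cast h4
  rw [div_le_iff₀ hN0] at h1
  rw [div_le_iff₀ hε0] at h3
  set N₁ := ⌈(n N : ℝ) / y⌉₊ with hN₁
  have c1 : (n N : ℝ) / y ≤ N₁ := Nat.le_ceil _
  have c2 : (N₁ : ℝ) < n N / y + 1 := Nat.ceil_lt_add_one (by positivity)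
  have c3 : (n N : ℝ) / y ≤ (1 - 2 * ε) * N := by rw [div_le_iff₀ hy0]; linarith
  have c4 : (N₁ : ℝ) ≤ (1 - ε) * N := by linarith
  have c5 : N₁ ≤ N := by
    have : (N₁ : ℝ) ≤ N := c4.trans (by nlinarith)
    exact_mod_cast this
  obtain ⟨s, -, hs⟩ := Finset.exists_subset_card_eq (s := (Finset.univ : Finset (Fin N)))
    (n := N₁) (by simpa using c5)
  have c6 : (n N : ℝ) ≤ n N / y := by
    rw [le_div_iff₀ hy0]
    exact mul_le_of_le_one_right (Nat.cast_nonneg _) (by linarith)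
  have c7 : (0 : ℝ) < N₁ := by
    have : 0 < y₀ / 2 * N := by positivity
    linarith
  refine ⟨s, by rw [hs]; linarith, ?_, ?_⟩
  · rw [hs]
    have e : (n N : ℝ) / N₁ - y = (n N - y * N₁) / N₁ := by field_simp
    rw [e, abs_div, abs_of_pos c7]
    gcongr
    rw [div_le_iff₀ hy0] at c1
    rw [← sub_lt_iff_lt_add, lt_div_iff₀ hy0] at c2
    rw [abs_le]
    constructor <;> nlinarith
  · rw [Finset.card_compl, Fintype.card_fin, hs, Nat.cast_sub c5]
    linarith

/-- The three terms are the low directions, the high directions and the fluctuation of the quadratic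
form. Each is at most `1 / (12 A ℓ)`: the first by the choice of `η`, the second by the choice of
`G`, the third because `D` is at least of order `ℓ ^ 3`. -/
lemma potential_sum_le {A ε M B ℓ D N n L : ℝ} (hA : 0 < A) (hε : 0 < ε) (hM : 0 ≤ M)
    (hB : 0 < B) (hℓ : 1 ≤ ℓ) (hℓ2 : 288 * A * (M + 2) / (ε * B) ≤ ℓ) (hD : B * ℓ ^ 3 ≤ D)
    (hDN : D ≤ N) (hn : n ≤ N) (hN : 0 < N) (hL : L = ε * N / 24) :
    2 * (ε / (288 * A) * N / ℓ / L + n / (L + 12 * A * ℓ * N) + (2 + M * N / D) / L) ≤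
      1 / (2 * A * ℓ) := by
  have hD0 : 0 < D := lt_of_lt_of_le (by positivity) hD
  have hL0 : 0 < L := by rw [hL]; positivity
  have h1 : ε / (288 * A) * N / ℓ / L = 1 / (12 * A * ℓ) := by rw [hL]; field_simp; norm_num
  have h2 : n / (L + 12 * A * ℓ * N) ≤ 1 / (12 * A * ℓ) := by
    rw [div_le_div_iff₀ (by positivity) (by positivity)]
    have : n * (12 * A * ℓ) ≤ N * (12 * A * ℓ) := by gcongr
    linarith
  have h3 : (2 + M * N / D) / L ≤ 1 / (12 * A * ℓ) := by
    have h4 : 2 + M * N / D ≤ (M + 2) * N / D := by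
      have : 1 ≤ N / D := by rwa [one_le_div hD0]
      rw [mul_div_assoc, mul_div_assoc]; linarith
    calc _ ≤ (M + 2) * N / D / L := by gcongr
      _ = 24 * (M + 2) / ε / D := by rw [hL]; field_simp
      _ ≤ 24 * (M + 2) / ε / (B * ℓ ^ 3) := by gcongr
      _ = (288 * A * (M + 2) / (ε * B)) / (12 * A * ℓ ^ 3) := by field_simp; norm_num
      _ ≤ ℓ / (12 * A * ℓ ^ 3) := by gcongr
      _ = 1 / (12 * A * ℓ) / ℓ := by field_simp
      _ ≤ _ := div_le_self (by positivity) hℓ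
  calc _ ≤ 2 * (1 / (12 * A * ℓ) + 1 / (12 * A * ℓ) + 1 / (12 * A * ℓ)) := by rw [h1]; gcongr
    _ = _ := by field_simp; norm_num

lemma two_fifths_pow_le {x : ℝ} {m : ℕ} (hx : 2 * x ≤ m) : ((2 : ℝ) / 5) ^ m ≤ Real.exp (-x) := by
  have h1 : (2 : ℝ) / 5 ≤ Real.exp (-(1 / 2)) := by
    have := Real.add_one_le_exp (-(1 / 2) : ℝ)
    linarith
  calc _ ≤ Real.exp (-(1 / 2)) ^ m := by gcongr
    _ = Real.exp (-(m / 2)) := by rw [← Real.exp_nat_mul]; congr 1; ring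
    _ ≤ _ := Real.exp_le_exp.2 (by linarith)

/-- The level `τ` is fixed before `M`, `B` and `Q`, since it depends only on the spectral radius
`κ`, the proportion `ε` and the norm bound `K`. The power `Q` enters only through the order of the
potential and the size of `N`. -/
theorem exists_least_form_bound {y₀ K : ℝ} (hy₀ : 0 < y₀) (hy₁ : y₀ < 1) (hK : 0 ≤ K) :
    ∃ τ : ℝ, 0 < τ ∧ ∀ {M B Q : ℝ}, 0 ≤ M → 0 < B → 0 ≤ Q → ∀ {n : ℕ → ℕ},
      Tendsto (fun N : ℕ => (n N : ℝ) / (N : ℝ)) atTop (𝓝 y₀) →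
      ∀ᶠ N : ℕ in atTop, n N < N → ∀ {D : ℝ}, B * Real.log N ^ 3 ≤ D → D ≤ N →
      ∀ {ν : Fin N → Measure (Fin (n N) → ℝ)} [∀ j, IsProbabilityMeasure (ν j)],
      (∀ j, IsUnitRow (ν j) (M * N / D)) →
      (Measure.pi ν).real {x |
        (∀ v : Fin (n N) → ℝ, v ⬝ᵥ v = 1 → v ⬝ᵥ (rowGram Finset.univ x *ᵥ v) ≤ K * N) ∧
        ∃ v : Fin (n N) → ℝ, v ⬝ᵥ v = 1 ∧ v ⬝ᵥ (rowGram Finset.univ x *ᵥ v) ≤ τ * N} ≤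
      2 * (N : ℝ) ^ (-Q) := by
  obtain ⟨y, ε, hy0, hy1, hε, hcard⟩ := exists_eventually_card hy₀ hy₁
  obtain ⟨κ, hκ, hlow⟩ := exists_lowSet hy0 hy1
  set c₁ := y₀ / 2 with hc₁
  have hc₁0 : 0 < c₁ := by positivity
  -- The first entry gives `2 T ≤ a`, the second makes the gluing error at most `L = ε N / 24`.
  set τ := min (κ * c₁ / 2) (ε / (96 * (1 + K / (κ * c₁)))) with hτ
  have hτ0 : 0 < τ := lt_min (by positivity) (by positivity)
  have hτ1 : 2 * τ ≤ κ * c₁ := by linarith [min_le_left (κ * c₁ / 2) (ε / (96 * (1 + K / (κ * c₁))))]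
  have hτ2 : 4 * (τ + K * τ / (κ * c₁)) ≤ ε / 24 := by
    have := min_le_right (κ * c₁ / 2) (ε / (96 * (1 + K / (κ * c₁))))
    rw [← hτ, le_div_iff₀ (by positivity)] at this
    have e : 4 * (τ + K * τ / (κ * c₁)) = τ * (96 * (1 + K / (κ * c₁))) / 24 := by ring
    rw [e]; linarith
  clear_value τ
  refine ⟨τ, hτ0, fun {M B Q} hM hB hQ {n} hn => ?_⟩
  -- Then `m + 1 ≤ A ℓ`, and `σ = 1 / (2 A ℓ)` satisfies `(m + 1) σ ≤ 1 / 2`.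
  set A := 2 * Q + 4 with hA
  have hA0 : 0 < A := by positivity
  obtain ⟨Z, hZ⟩ := hlow (η := ε / (288 * A)) (by positivity) hM hB hc₁0
  filter_upwards [hcard n hn, tendsto_log_natCast.eventually_ge_atTop Z,
    tendsto_log_natCast.eventually_ge_atTop 1,
    tendsto_log_natCast.eventually_ge_atTop (288 * A * (M + 2) / (ε * B)),
    eventually_mul_log_pow_le (2 * Q) 5, eventually_mul_log_le (4 * A / ε)]
    with N hs hℓZ hℓ hℓ2 hN5 hN1 hnN D hD hDN ν _ hν
  obtain ⟨s, hs1, hs2, hs3⟩ := hs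
  set ℓ := Real.log N with hℓdef
  have hD0 : 0 < D := lt_of_lt_of_le (by positivity) hD
  have hN0 : (0 : ℝ) < N := hD0.trans_le hDN
  have hnR : (n N : ℝ) ≤ N := by exact_mod_cast hnN.le
  obtain ⟨S, hSm, hSs, hSlow, hSP⟩ := hZ hℓZ hℓ hD hDN hnN.le hs1 hs2 hν
  set m := ⌈2 * ((Q + 1) * ℓ)⌉₊ with hm
  have hm1 : 2 * ((Q + 1) * ℓ) ≤ m := Nat.le_ceil _
  have hm2 : (m : ℝ) + 1 ≤ A * ℓ := by
    have := (Nat.ceil_lt_add_one (show 0 ≤ 2 * ((Q + 1) * ℓ) by positivity)).le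
    rw [← hm] at this
    have e : A * ℓ = 2 * ((Q + 1) * ℓ) + 2 * ℓ := by rw [hA]; ring
    linarith
  set L := ε * N / 24 with hL
  have hL0 : 0 < L := by positivity
  set a := κ * s.card with ha
  have haN : κ * c₁ * N ≤ a := by rw [ha, mul_assoc]; gcongr
  have ha0 : 0 < a := lt_of_lt_of_le (by positivity) haN
  have hsum := potential_sum_le hA0 hε hM hB hℓ hℓ2 hD hDN hnR hN0 hL
  have hsplit := measureReal_split_le hν (by positivity) hSm hSs (a := a) (T := τ * N) (K := K * N)
    (L := L) (G := 12 * A * ℓ * N) (σ := 1 / (2 * A * ℓ)) (m := m) ha0 (by positivity)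
    (by
      have : 2 * τ * N ≤ κ * c₁ * N := by gcongr
      linarith) (by positivity) hL0 (by positivity) hSlow (by positivity) hsum
    (by
      rw [mul_one_div, div_le_iff₀ (by positivity)]; linarith)
    (by
      rw [div_mul_eq_mul_div, div_le_iff₀ hε] at hN1
      rw [hL]; linarith)
  -- The numerator is at most `2 L`, while the remaining rows contribute `ε N / 6 = 4 L` to the
  -- denominator.
  have hratio : (L + 4 * (τ * N + K * N * (τ * N) / a)) / (L + (sᶜ.card : ℝ) / 6) ≤ 2 / 5 := by
    have h1 : K * N * (τ * N) / a ≤ K * τ / (κ * c₁) * N := by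
      calc _ ≤ K * N * (τ * N) / (κ * c₁ * N) := by gcongr
        _ = _ := by field_simp
    have h2 : 4 * (τ * N + K * N * (τ * N) / a) ≤ L := by
      have : 4 * (τ + K * τ / (κ * c₁)) * N ≤ ε / 24 * N := by gcongr
      rw [hL]; linarith
    rw [div_le_div_iff₀ (by positivity) (by norm_num)]
    rw [hL] at h2 ⊢
    linarith
  have hfin : (n N : ℝ) * ((L + 4 * (τ * N + K * N * (τ * N) / a)) / (L + (sᶜ.card : ℝ) / 6)) ^ m ≤
      (N : ℝ) ^ (-Q) := by
    calc _ ≤ (N : ℝ) * (2 / 5) ^ m := by gcongr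
      _ ≤ N * Real.exp (-((Q + 1) * ℓ)) := by gcongr; exact two_fifths_pow_le hm1
      _ = Real.exp ℓ * Real.exp (-((Q + 1) * ℓ)) := by rw [hℓdef, Real.exp_log hN0]
      _ = (N : ℝ) ^ (-Q) := by
          rw [← Real.exp_add, Real.rpow_def_of_pos hN0, ← hℓdef]; congr 1; ring
  have hSP' : (Measure.pi ν).real Sᶜ ≤ (N : ℝ) ^ (-Q) := by
    refine hSP.trans ?_
    rw [Real.rpow_def_of_pos hN0, ← hℓdef, Real.exp_le_exp, mul_neg]
    refine neg_le_neg ?_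
    rw [le_div_iff₀ (by positivity)]
    calc _ = 2 * Q * ℓ ^ 5 := by ring
      _ ≤ _ := hN5
  rw [two_mul]
  refine le_trans ?_ (add_le_add hSP' (hsplit.trans hfin))
  refine le_trans (measureReal_mono fun x hx => ?_) (measureReal_union_le _ _)
  by_cases hxS : x ∈ S
  · exact Or.inr ⟨hxS, hx⟩
  · exact Or.inl hxS

end LeastForm

/-! ### Law of the normalized rows -/

section RowLaws

variable {Ω : Type*} {N n : ℕ} {p : ℝ} {ξ X : Fin N → Fin n → Ω → ℝ}

/-- The entries, normalized to unit variance. -/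
noncomputable def normalizedRows (p : ℝ) (ξ X : Fin N → Fin n → Ω → ℝ) (ω : Ω) :
    Fin N → Fin n → ℝ :=
  fun j k => (√p)⁻¹ * sparseMatrix ξ X ω j k

lemma dotProduct_rowGram_normalizedRows (hp : 0 < p) (ω : Ω) (v : Fin n → ℝ) :
    v ⬝ᵥ (rowGram Finset.univ (normalizedRows p ξ X ω) *ᵥ v) =
      (sparseMatrix ξ X ω *ᵥ v) ⬝ᵥ (sparseMatrix ξ X ω *ᵥ v) / p := by
  have hs : √p ^ 2 = p := Real.sq_sqrt hp.le
  rw [dotProduct_rowGram_mulVec, dotProduct, Finset.sum_div]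
  refine Finset.sum_congr rfl fun j _ => ?_
  have e : normalizedRows p ξ X ω j ⬝ᵥ v = (√p)⁻¹ * (sparseMatrix ξ X ω *ᵥ v) j := by
    simp only [normalizedRows, dotProduct, Matrix.mulVec, Finset.mul_sum, mul_assoc]
  rw [e, mul_pow, inv_pow, hs, inv_mul_eq_div, sq]

variable [MeasurableSpace Ω] {P : Measure Ω}

namespace IsSparseModel

lemma measurable_normalizedRows (h : IsSparseModel P p ξ X) :
    Measurable (normalizedRows p ξ X) :=
  measurable_pi_lambda _ fun j => measurable_pi_lambda _ fun k =>
    (h.measurable_sparseMatrix j k).const_mul _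

lemma iIndepFun_normalizedRows (h : IsSparseModel P p ξ X) :
    iIndepFun (fun (a : Fin N × Fin n) ω => normalizedRows p ξ X ω a.1 a.2) P :=
  h.iIndepFun_sparseMatrix.comp (fun _ x => (√p)⁻¹ * x) fun _ => by fun_prop

/-- Transfers events about the matrix to a product measure on rows, the setting of the resampling
arguments. -/
lemma map_normalizedRows [IsProbabilityMeasure P] (h : IsSparseModel P p ξ X) :
    P.map (normalizedRows p ξ X) =
      Measure.pi fun j => P.map fun ω => normalizedRows p ξ X ω j := by
  have hm : ∀ j k, Measurable fun ω => normalizedRows p ξ X ω j k := fun j k =>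
    (measurable_pi_apply k).comp ((measurable_pi_apply j).comp h.measurable_normalizedRows)
  have h1 := iIndepFun_curry (Y := fun j k ω => normalizedRows p ξ X ω j k) hm
    h.iIndepFun_normalizedRows
  exact h1.map_fun_eq_pi_map fun j =>
    ((measurable_pi_apply j).comp h.measurable_normalizedRows).aemeasurable

lemma isUnitRow_map_normalizedRows [IsProbabilityMeasure P] (h : IsSparseModel P p ξ X)
    (hp : 0 < p) {δ μ : ℝ} (hδ : 0 < δ)
    (hX : ∀ j k, ∫⁻ ω, ENNReal.ofReal (|X j k ω| ^ (4 + δ)) ∂P ≤ ENNReal.ofReal μ) (j : Fin N) :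
    IsUnitRow (P.map fun ω => normalizedRows p ξ X ω j) ((1 + |μ|) / p) := by
  have hs : √p ^ 2 = p := Real.sq_sqrt hp.le
  have hs4 : √p ^ 4 = p ^ 2 := by rw [show 4 = 2 * 2 by norm_num, pow_mul, hs]
  have hm : Measurable fun ω => normalizedRows p ξ X ω j :=
    (measurable_pi_apply j).comp h.measurable_normalizedRows
  have hmk : ∀ k, Measurable fun ω => normalizedRows p ξ X ω j k :=
    fun k => (measurable_pi_apply k).comp hm
  refine ⟨Measure.isProbabilityMeasure_map hm.aemeasurable, ?_, ?_, ?_, ?_, ?_⟩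
  · have := Measure.isProbabilityMeasure_map (μ := P) hm.aemeasurable
    have hind : iIndepFun (fun k ω => normalizedRows p ξ X ω j k) P :=
      h.iIndepFun_normalizedRows.precomp (g := fun k => (j, k)) fun _ _ e => (Prod.ext_iff.1 e).2
    rw [iIndepFun_iff_map_fun_eq_pi_map fun i => (measurable_pi_apply i).aemeasurable]
    have e1 : ∀ i, (P.map fun ω => normalizedRows p ξ X ω j).map (fun r : Fin n → ℝ => r i) =
        P.map fun ω => normalizedRows p ξ X ω j i := fun i =>
      Measure.map_map (measurable_pi_apply i) hm
    simp only [e1]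
    exact (Measure.map_id (μ := P.map fun ω => normalizedRows p ξ X ω j)).trans
      (hind.map_fun_eq_pi_map fun k => (hmk k).aemeasurable)
  · intro k
    rw [integral_map hm.aemeasurable (measurable_pi_apply k).aestronglyMeasurable]
    simp only [normalizedRows]
    rw [integral_const_mul, h.integral_sparseMatrix, mul_zero]
  · intro k
    rw [integral_map hm.aemeasurable ((measurable_pi_apply k).pow_const 2).aestronglyMeasurable]
    simp only [normalizedRows, mul_pow, inv_pow, hs]
    rw [integral_const_mul, h.integral_sparseMatrix_sq, inv_mul_cancel₀ hp.ne']
  · intro k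
    rw [integrable_map_measure ((measurable_pi_apply k).pow_const 4).aestronglyMeasurable
      hm.aemeasurable]
    simp only [Function.comp_def, normalizedRows, mul_pow]
    exact (h.integrable_sparseMatrix_four j k hδ (hX j k)).1.const_mul _
  · intro k
    rw [integral_map hm.aemeasurable ((measurable_pi_apply k).pow_const 4).aestronglyMeasurable]
    simp only [normalizedRows, mul_pow, inv_pow, hs4]
    rw [integral_const_mul]
    calc _ ≤ (p ^ 2)⁻¹ * ((1 + |μ|) * p) := by
          gcongr; exact (h.integrable_sparseMatrix_four j k hδ (hX j k)).2
      _ = _ := by field_simp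

end IsSparseModel

end RowLaws

/-! ### The smallest singular value and the theorem -/

section SmallestSingularValue

/-- Off the exceptional event for the operator norm, the normalized Gram matrix has form at most
`1001² N`, and a small singular value provides a unit vector of form at most `τ N`. The square root
in `√τ` converts a bound for the Gram matrix into one for the singular value. -/
theorem exists_const_singVal_last {δ μ B C₀ c y₀ : ℝ} (hδ : 0 < δ) (hB : 0 < B) (hC₀ : 0 < C₀)
    (hc : 0 < c) (hy₀ : 0 < y₀) (hy₁ : y₀ < 1) :
    ∃ τ₀ : ℝ, 0 < τ₀ ∧ ∀ Q : ℝ, 1 ≤ Q → ∀ n : ℕ → ℕ,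
      Tendsto (fun N : ℕ => (n N : ℝ) / (N : ℝ)) atTop (𝓝 y₀) →
      ∃ C : ℝ, 0 < C ∧ ∀ τ : ℝ, τ ≤ τ₀ → ∀ N : ℕ, 1 ≤ n N → n N < N →
        ∀ (p : ℝ) (Ω : Type u) [MeasurableSpace Ω] (P : Measure Ω) [IsProbabilityMeasure P]
          (ξ X : Fin N → Fin (n N) → Ω → ℝ), SparseAssumptions P δ μ B C₀ c p ξ X →
          P.real {ω | singVal (sparseMatrix ξ X ω) (n N) ≤ τ * √(N * p)} ≤ C * (N : ℝ) ^ (-Q) := by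
  obtain ⟨τ, hτ, hleast⟩ := exists_least_form_bound hy₀ hy₁ (show (0 : ℝ) ≤ 1001 ^ 2 by norm_num)
  refine ⟨√τ, Real.sqrt_pos.2 hτ, fun Q hQ n hn => ?_⟩
  obtain ⟨C, hC, h⟩ := exists_const_of_eventually (Q := Q)
    (f := fun N x => 1 ≤ n N ∧ n N < N ∧ ∃ (p : ℝ) (Ω : Type u) (_ : MeasurableSpace Ω)
      (P : Measure Ω) (_ : IsProbabilityMeasure P) (ξ X : Fin N → Fin (n N) → Ω → ℝ),
      SparseAssumptions P δ μ B C₀ c p ξ X ∧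
      x = P.real {ω | singVal (sparseMatrix ξ X ω) (n N) ≤ √τ * √(N * p)}) (by linarith) (by
    filter_upwards [eventually_opNorm_le (μ := μ) hδ hB hC₀ hc hy₀ hn
        (show 0 ≤ Q + 1 by linarith),
      hleast (M := 1 + |μ|) (Q := Q + 1) (by positivity) hB (by linarith) hn,
      tendsto_log_natCast.eventually_ge_atTop 1, eventually_ge_atTop 3] with N hop hN l1 hN3 x
    rintro ⟨h1, h2, p, Ω, _, P, _, ξ, X, hA, rfl⟩
    have hN0 : (0 : ℝ) < N := by
      have : 0 < N := by omega
      exact_mod_cast this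
    have hD3 := mul_log_pow_three_le hδ hB l1 hA.sparsity
    have hD : 0 < N * p := lt_of_lt_of_le (by positivity) hD3
    have hp : 0 < p := pos_of_mul_pos_right hD hN0.le
    have hp1 : p ≤ 1 := hA.toIsSparseModel.prob_le_one ⟨0, by omega⟩ ⟨0, by omega⟩
    have hrow := hA.toIsSparseModel.isUnitRow_map_normalizedRows hp hδ hA.moment_delta
    have hprob := fun j => (hrow j).prob
    have key := hN h2 hD3 (mul_le_of_le_one_right hN0.le hp1) (fun j => by
      have := hrow j
      rwa [← mul_div_mul_left (1 + |μ|) p hN0.ne', mul_comm (N : ℝ) (1 + |μ|)] at this)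
    have hmeas : MeasurableSet {x : Fin N → Fin (n N) → ℝ |
        (∀ v : Fin (n N) → ℝ, v ⬝ᵥ v = 1 →
          v ⬝ᵥ (rowGram Finset.univ x *ᵥ v) ≤ 1001 ^ 2 * N) ∧
        ∃ v : Fin (n N) → ℝ, v ⬝ᵥ v = 1 ∧ v ⬝ᵥ (rowGram Finset.univ x *ᵥ v) ≤ τ * N} :=
      (isClosed_forall_unit_form_le _ _).measurableSet.inter
        (isClosed_exists_unit_form_le _ _).measurableSet
    rw [← hA.toIsSparseModel.map_normalizedRows, measureReal_def, Measure.map_apply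
      hA.toIsSparseModel.measurable_normalizedRows hmeas, ← measureReal_def] at key
    have hsub : P.real {ω | singVal (sparseMatrix ξ X ω) (n N) ≤ √τ * √(N * p)} ≤
        (N : ℝ) ^ (-(Q + 1)) + 2 * (N : ℝ) ^ (-(Q + 1)) := by
      refine le_trans ?_ (add_le_add (hop h1 h2 p Ω P ξ X hA) key)
      refine le_trans (measureReal_mono fun ω hω => ?_) (measureReal_union_le _ _)
      by_cases hcon : ∀ x : Fin (n N) → ℝ, x ⬝ᵥ x = 1 →
          (sparseMatrix ξ X ω *ᵥ x) ⬝ᵥ (sparseMatrix ξ X ω *ᵥ x) ≤ 1001 ^ 2 * (N * p)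
      · refine Or.inr ⟨fun v hv => ?_, ?_⟩
        · rw [dotProduct_rowGram_normalizedRows hp, div_le_iff₀ hp]
          linarith [hcon v hv]
        · obtain ⟨x, hx, hxs⟩ := exists_unit_singVal (sparseMatrix ξ X ω) h1 le_rfl
          refine ⟨x, hx, ?_⟩
          rw [dotProduct_rowGram_normalizedRows hp, div_le_iff₀ hp, hxs]
          have h0 : 0 ≤ singVal (sparseMatrix ξ X ω) (n N) :=
            singVal_nonneg _ _
          calc _ ≤ (√τ * √(N * p)) ^ 2 := pow_le_pow_left₀ h0 hω 2
            _ = τ * N * p := by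
              rw [mul_pow, Real.sq_sqrt hτ.le, Real.sq_sqrt hD.le]; ring
      · exact Or.inl hcon
    refine hsub.trans ?_
    -- Both bounds were taken with `Q + 1`; the spare `1 / N` absorbs the total constant 3.
    have e : (N : ℝ) ^ (-(Q + 1)) = (N : ℝ) ^ (-Q) / N := by
      rw [neg_add, Real.rpow_add hN0, Real.rpow_neg_one, div_eq_mul_inv]
    have hN3' : (3 : ℝ) ≤ N := by exact_mod_cast hN3
    have hpos : 0 < (N : ℝ) ^ (-Q) := by positivity
    rw [e, ← one_add_mul, mul_div_assoc', div_le_iff₀ hN0]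
    nlinarith)
  -- The event grows with `τ`, so the constant found at the threshold serves all smaller values.
  refine ⟨C, hC, fun τ' hτ' N h1 h2 p Ω _ P _ ξ X hA => ?_⟩
  refine le_trans (measureReal_mono fun ω hω => ?_) (h N (by omega) _ measureReal_le_one
    ⟨h1, h2, p, Ω, _, P, inferInstance, ξ, X, hA, rfl⟩)
  exact le_trans hω (mul_le_mul_of_nonneg_right hτ' (Real.sqrt_nonneg _))

end SmallestSingularValue

theorem mainTheorem5 (δ μ : ℝ) (hδ : 0 < δ) :
    (∀ Q : ℝ, 1 ≤ Q → ∃ K : ℝ, 0 < K ∧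
      ∀ B C₀ c y₀ : ℝ, 0 < B → 0 < C₀ → 0 < c → 0 < y₀ → y₀ < 1 →
      ∀ n : ℕ → ℕ, Tendsto (fun N : ℕ => (n N : ℝ) / (N : ℝ)) atTop (𝓝 y₀) →
      ∃ C : ℝ, 0 < C ∧
        ∀ N : ℕ, 1 ≤ n N → n N < N →
        ∀ (p : ℝ) (Ω : Type*) [MeasurableSpace Ω] (P : Measure Ω) [IsProbabilityMeasure P]
          (ξ X : Fin N → Fin (n N) → Ω → ℝ),
          SparseAssumptions P δ μ B C₀ c p ξ X →
          P.real {ω | K * √(N * p) ≤ singVal (sparseMatrix ξ X ω) 1} ≤ C * (N : ℝ) ^ (-Q))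
    ∧
    (∀ B C₀ c y₀ : ℝ, 0 < B → 0 < C₀ → 0 < c → 0 < y₀ → y₀ < 1 →
      ∃ τ₀ : ℝ, 0 < τ₀ ∧
      ∀ Q : ℝ, 1 ≤ Q →
      ∀ n : ℕ → ℕ, Tendsto (fun N : ℕ => (n N : ℝ) / (N : ℝ)) atTop (𝓝 y₀) →
      ∃ C : ℝ, 0 < C ∧
        ∀ τ : ℝ, τ ≤ τ₀ →
        ∀ N : ℕ, 1 ≤ n N → n N < N →
        ∀ (p : ℝ) (Ω : Type*) [MeasurableSpace Ω] (P : Measure Ω) [IsProbabilityMeasure P]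
          (ξ X : Fin N → Fin (n N) → Ω → ℝ),
          SparseAssumptions P δ μ B C₀ c p ξ X →
          P.real {ω | singVal (sparseMatrix ξ X ω) (n N) ≤ τ * √(N * p)} ≤
            C * (N : ℝ) ^ (-Q)) := by
  -- The constant for the largest singular value is absolute; 1002 instead of 1001 makes the event
  -- with a non-strict inequality fall outside the norm bound.
  refine ⟨fun Q hQ => ⟨1002, by norm_num, fun B C₀ c y₀ hB hC₀ hc hy₀ _ n hn => ?_⟩,
    fun B C₀ c y₀ hB hC₀ hc hy₀ hy₁ => ?_⟩
  · exact exists_const_singVal_one hδ hQ hB hC₀ hc hy₀ hn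
  · exact exists_const_singVal_last hδ hB hC₀ hc hy₀ hy₁
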